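/- **Theorem.** Let $n\ge 4$ be an integer and let $q=p^r$ be a prime power ($p$ prime, $r\ge 1$). A *Lunardon–Polverino linear set* is a set of points of $\mathrm{PG}(1,q^n)$ of the form $$L_{s,\delta}=\{\langle (x,\;x^{q^s}+\delta x^{q^{n-s}})\rangle_{\mathbb F_{q^n}} : x\in\mathbb F_{q^n}^*\},\qquad 1\le s<n,\ \gcd(s,n)=1,\ \delta\in\mathbb F_{q^n}^*,\ \delta^{\frac{q^n-1}{q-1}}\neq 1 .$$ Let $\Lambda(n,q)$ be the number of $\mathrm{P\Gamma L}(2,q^n)$-equivalence classes of Lunardon–Polverino linear sets in $\mathrm{PG}(1,q^n)$. Let $\varphi$ be Euler's totient function, $\sigma(m)=\sum_{d\mid m}d$, let $r_1$ be the smallest prime factor of $r$ (when $r>1$), and let $\epsilon=0$ if $p=2$, $\epsilon=\frac{p-1}2$ if $p$ and $n$ are odd, and $\epsilon=\frac{p-3}2$ if $p$ is odd and $n$ is even. Put $E=\frac{\Lambda(n,q)}{\varphi(n)/2}-\epsilon$. Suppose $r>1$. (1) If $n$ is odd, then $\frac{p^r-p}{2r}\le E$, with equality if $r$ is an odd prime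 and strict inequality otherwise, and $$E<\begin{cases} \frac{p^r}{2r}\left(1+\frac{\sigma(r)-r-1}{p^{r(1-1/r_1)}}\right), & r \text{ odd},\\ \frac{p^r}{2r}\left(1+\frac{\sigma(r)-r-1}{p^{r/2}}\right)+\sum_{i=1}^{s_1}p^{2^{i-1}}, & r=2^{s_1},\\ \frac{p^r}{2r}\left(1+\frac{\sigma(r)-r}{p^{r/2}}+\frac{\sigma(r)-r-1}{p^{3r/4}}\right), & r \text{ even with at least two distinct prime factors}. \end{cases}$$ (2) If $n$ is even, then $$E<\begin{cases} \frac{p^{2r}}{4r}\left(1+\frac{\sigma(2r)-2r-1}{p^{r}}\right), & r \text{ odd},\\ \frac{p^{2r}}{4r}\left(1+\frac{\sigma(2r)-2r-1}{p^{r}}\right)+\sum_{i=1}^{s_1}p^{2^{i-1}}, & r=2^{s_1},\\ \frac{p^{2r}}{4r}\left(1+\frac{\sigma(2r)-2r-1}{p^{r}}+\frac{2}{p^{3r/2}}+\frac{2(\sigma(r)-r-1)}{p^{7r/4}}\right), & r \text{ even with at least two distinct prime factors}, \end{cases}$$ and $$E>\begin{cases} \frac{p^{2r}-p}{4r}-\sum_{i=1}^{s_1+1}p^{2^{i-1}},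 & r=2^{s_1},\\ \frac{p^{2r}}{4r}\left(1-\frac1{p^r}-\frac{\sigma(2r)-2r-1}{p^{3r/2}}-\frac1{p^{2r-1}}\right), & r \text{ not a power of } 2. \end{cases}$$ (3) For each fixed $n\ge 4$, as $q=p^r\to\infty$ through all prime powers (with $r\ge 1$), the ratio of $\Lambda(n,q)$ to $\frac{p^r\varphi(n)}{4r}$ tends to $1$ if $n$ is odd, and the ratio of $\Lambda(n,q)$ to $\frac{p^{2r}\varphi(n)}{8r}$ tends to $1$ if $n$ is even. -/

import Mathlib

open scoped LinearAlgebra.Projectivization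

universe u

namespace LunardonPolverino

/-- The projective line `PG(1, K)`: the one-dimensional subspaces of `K²`. -/
abbrev ProjLine (K : Type u) [Field K] : Type u := ℙ K (Fin 2 → K)

/-- The point set `L_f = {⟨(x, f x)⟩ : x ∈ K, x ≠ 0}` of `PG(1, K)`. -/
def linearSetOf (K : Type u) [Field K] (f : K → K) : Set (ProjLine K) :=
  {P | ∃ (x : K) (h : (![x, f x] : Fin 2 → K) ≠ 0), x ≠ 0 ∧ P = Projectivization.mk K ![x, f x] h}

/-- The Lunardon-Polverino linear sets of `PG(1, q ^ n)`, where `K` is the field with `q ^ n`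
elements: the sets `L_f` with `f = X ^ (q ^ s) + δ X ^ (q ^ (n - s))`, `1 ≤ s < n`, `gcd (s, n) = 1`,
`δ ≠ 0` and norm `N(δ) = δ ^ ((q ^ n - 1) / (q - 1)) ≠ 1` over the subfield with `q` elements. -/
def lpSets (K : Type u) [Field K] (q n : ℕ) : Set (Set (ProjLine K)) :=
  {L | ∃ (s : ℕ) (δ : K), 1 ≤ s ∧ s < n ∧ Nat.gcd s n = 1 ∧ δ ≠ 0 ∧
    δ ^ ((q ^ n - 1) / (q - 1)) ≠ 1 ∧
    L = linearSetOf K (fun x => x ^ (q ^ s) + δ * x ^ (q ^ (n - s)))}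

/-- Two point sets of `PG(1, K)` are `PΓL`-equivalent if the collineation induced by a bijective
semilinear map of `K²` (with respect to some field automorphism) sends one onto the other. -/
def PGammaLEquiv (K : Type u) [Field K] (L L' : Set (ProjLine K)) : Prop :=
  ∃ (τ : K ≃+* K) (g : (Fin 2 → K) →ₛₗ[(τ : K →+* K)] (Fin 2 → K)) (hg : Function.Bijective g),
    Projectivization.map g hg.injective '' L = L'

theorem PGammaLEquiv.refl (K : Type u) [Field K] (L : Set (ProjLine K)) : PGammaLEquiv K L L := by
  refine ⟨RingEquiv.refl K,
    { toFun := fun v => v, map_add' := fun _ _ => rfl, map_smul' := fun _ _ => rfl },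
    Function.bijective_id, ?_⟩
  ext P
  constructor
  · rintro ⟨Q, hQ, rfl⟩
    induction Q using Projectivization.ind with
    | h v hv => exact hQ
  · intro hP
    refine ⟨P, hP, ?_⟩
    induction P using Projectivization.ind with
    | h v hv => rfl

theorem PGammaLEquiv.trans {K : Type u} [Field K] {L L' L'' : Set (ProjLine K)}
    (h : PGammaLEquiv K L L') (h' : PGammaLEquiv K L' L'') : PGammaLEquiv K L L'' := by
  obtain ⟨τ, g, hg, rfl⟩ := h
  obtain ⟨τ', g', hg', rfl⟩ := h'
  refine ⟨τ.trans τ',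
    { toFun := fun v => g' (g v)
      map_add' := fun v w => by rw [map_add, map_add]
      map_smul' := fun a v => by rw [LinearMap.map_smulₛₗ, LinearMap.map_smulₛₗ]; rfl },
    hg'.comp hg, ?_⟩
  rw [Set.image_image]
  refine Set.image_congr fun P _ => ?_
  induction P using Projectivization.ind with
  | h v hv => rfl

theorem PGammaLEquiv.symm {K : Type u} [Field K] {L L' : Set (ProjLine K)}
    (h : PGammaLEquiv K L L') : PGammaLEquiv K L' L := by
  obtain ⟨τ, g, hg, rfl⟩ := h
  let e := Equiv.ofBijective g hg
  have he : ∀ v, g (e.symm v) = v := fun v => e.apply_symm_apply v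
  have he' : ∀ v, e.symm (g v) = v := fun v => e.symm_apply_apply v
  refine ⟨τ.symm,
    { toFun := e.symm
      map_add' := fun v w => hg.injective (by rw [map_add g, he, he, he])
      map_smul' := fun a v => hg.injective (by
        rw [LinearMap.map_smulₛₗ, he, he]
        simp) },
    e.symm.bijective, ?_⟩
  rw [Set.image_image]
  refine (Set.image_congr fun P _ => ?_).trans (Set.image_id _)
  induction P using Projectivization.ind with
  | h v hv =>
    simp only [Projectivization.map_mk, LinearMap.coe_mk, AddHom.coe_mk, he', id]

/-- `PΓL`-equivalence of point sets of `PG(1, K)`, as a setoid. -/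
def pGammaLSetoid (K : Type u) [Field K] : Setoid (Set (ProjLine K)) where
  r := PGammaLEquiv K
  iseqv := ⟨PGammaLEquiv.refl K, PGammaLEquiv.symm, PGammaLEquiv.trans⟩

/-- `Λ(n, q)`, computed in a field `K` with `q ^ n` elements: the number of `PΓL`-equivalence
classes of Lunardon-Polverino linear sets. -/
noncomputable def numLP (K : Type u) [Field K] (q n : ℕ) : ℕ :=
  (Quotient.mk (pGammaLSetoid K) '' lpSets K q n).ncard

/-- The constant `ε`: `0` if `p = 2`, and for odd `p` it is `(p - 1) / 2` for odd `n` and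
`(p - 3) / 2` for even `n`. -/
noncomputable def eps (p n : ℕ) : ℝ :=
  if p = 2 then 0 else if Odd n then ((p : ℝ) - 1) / 2 else ((p : ℝ) - 3) / 2

/-- The quantity `Λ(n, q) / (φ(n) / 2) - ε` with `q = p ^ r`. -/
noncomputable def excess (K : Type u) [Field K] (p r n : ℕ) : ℝ :=
  (numLP K (p ^ r) n : ℝ) / ((Nat.totient n : ℝ) / 2) - eps p n

end LunardonPolverino

/-! ### Determinants of cyclically tridiagonal matrices -/

namespace LunardonPolverino
open Matrix Finset

/-! A point set `L_f` is known from its slopes, the values `f x / x`. Put `σ = x ^ (q ^ t)` and `g =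
σ + θ σ⁻¹`. A slope `m` of `g` makes the Dickson matrix of `g` plus `diag (σ ^ i (-m))` singular,
and this determinant is a polynomial in `-m` of degree `(q ^ n - 1) / (q - 1)`. Since `N(θ) ≠ 1`,
the map `g` is scattered and has at least that many slopes, so the slope set determines the
polynomial. Its coefficients are the principal minors of the Dickson matrix, because subset sums of
distinct powers of `q` are distinct (`minors_eq_of_slopes_eq`).

If an equivalence with field automorphism `τ` carries `L_f` to `L_g`, write `f` for its
`τ`-conjugate as well. Then `(c + d f) ∘ (a + b f)⁻¹` is again a combination of powers of `σ` and
has the slopes of `g`. Equality of the minors of sizes one and two and of the blocks of consecutive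
indices forces it to be `α σ + β σ⁻¹` with `N(α)` equal to `1` or `N(θ)`
(`eq_pairCoeff_of_minors_eq`). Comparing coefficients in `(α σ + β σ⁻¹) ∘ (a + b f) = c + d f`
yields `t = s` or `t = n - s`, and taking norms to the field with `q ^ gcd (2, n)` elements shows
that the norms of `δ` and `θ` agree up to Frobenius and inversion (`necessary_relation`). Conversely
Hilbert 90, Frobenius and the adjoint map realise all these coincidences (`sufficient_relation`).

In discrete logarithms, `Λ(n, q)` is therefore `φ(n) / 2` times the number of orbits of
multiplication by `p` and `-1` on the residues modulo `q ^ gcd (2, n) - 1` not divisible by `q - 1`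
(`two_mul_numLP_eq`). Burnside's lemma turns this into a sum of greatest common divisors of numbers
`p ^ j ± 1` with `p ^ N - 1`, where `N = r gcd (2, n)`, and with `p ^ r + 1` when `n` is even. The
index `j = 0` dominates. The other terms depend essentially on `gcd (j, N)` and on the parity of
quotients such as `N / gcd (j, N)`, which leads to the bounds with `φ` and the divisor sum and to
the asymptotics. -/

/-- The cyclically tridiagonal matrix of size `k + 1` with zero diagonal, superdiagonal `a`,
subdiagonal `b`, upper right corner `u` and lower left corner `v`. -/
def cycTridiag {K : Type*} [Field K] (k : ℕ) (a b : ℕ → K) (u v : K) :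
    Matrix (Fin (k + 1)) (Fin (k + 1)) K :=
  Matrix.of fun i j =>
    (if (j : ℕ) = i + 1 then a i else 0) + (if (i : ℕ) = j + 1 then b j else 0) +
    (if (i : ℕ) = 0 ∧ (j : ℕ) = k then u else 0) + (if (i : ℕ) = k ∧ (j : ℕ) = 0 then v else 0)

section
variable {K : Type*} [Field K]

theorem cycTridiag_transpose (k : ℕ) (a b : ℕ → K) (u v : K) :
    (cycTridiag k a b u v)ᵀ = cycTridiag k b a v u := by
  ext i j
  simp only [cycTridiag, transpose_apply, of_apply]
  simp only [and_comm (a := (j : ℕ) = 0), and_comm (a := (j : ℕ) = k)]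
  ring

theorem cycTridiag_row_zero (k : ℕ) (a b : ℕ → K) (u v : K) :
    cycTridiag k a b u v = (cycTridiag k a b 0 v).updateRow 0
      ((cycTridiag k a b 0 v) 0 + u • Pi.single (Fin.last k) 1) := by
  ext i j
  rcases eq_or_ne i 0 with rfl | hi
  · rw [updateRow_self]
    have hj : (j : ℕ) = k ↔ j = Fin.last k := by rw [Fin.ext_iff]; simp
    simp only [cycTridiag, of_apply, Pi.add_apply, Pi.smul_apply, Pi.single_apply, hj]
    simp only [Fin.val_zero, true_and, smul_eq_mul, mul_ite, mul_one, mul_zero, ite_self, add_zero]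
    ring
  · rw [updateRow_ne hi]
    have : (i : ℕ) ≠ 0 := fun h => hi (Fin.ext h)
    simp only [cycTridiag, of_apply, this, false_and, if_false]

theorem cycTridiag_row_last {k : ℕ} (hk : k ≠ 0) (a b : ℕ → K) (v : K) :
    cycTridiag k a b 0 v = (cycTridiag k a b 0 0).updateRow (Fin.last k)
      ((cycTridiag k a b 0 0) (Fin.last k) + v • Pi.single 0 1) := by
  ext i j
  rcases eq_or_ne i (Fin.last k) with rfl | hi
  · rw [updateRow_self]
    have hj : (j : ℕ) = 0 ↔ j = 0 := by rw [Fin.ext_iff]; simp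
    simp only [cycTridiag, of_apply, Pi.add_apply, Pi.smul_apply, Pi.single_apply, hj]
    simp [hk]
  · rw [updateRow_ne hi]
    have : (i : ℕ) ≠ k := fun h => hi (Fin.ext (by simpa using h))
    simp [cycTridiag, this]

/-- Expansion along the new first row leaves the rows `1, …, k` and the columns `0, …, k - 1`: an
upper triangular block whose diagonal is `b`. -/
theorem det_cycTridiag_updateRow_zero {k : ℕ} (a b : ℕ → K) :
    ((cycTridiag k a b 0 0).updateRow 0 (Pi.single (Fin.last k) 1)).det =
      (-1) ^ k * ∏ i ∈ range k, b i := by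
  rw [det_succ_row_zero, Finset.sum_eq_single (Fin.last k)]
  · rw [updateRow_self, Pi.single_eq_same, mul_one, Fin.val_last, det_of_isUpperTriangular]
    · congr 1
      rw [Finset.prod_range]
      refine Finset.prod_congr rfl fun i _ => ?_
      rw [submatrix_apply, updateRow_ne (Fin.succ_ne_zero i), Fin.succAbove_last]
      simp only [cycTridiag, of_apply, Fin.val_succ, Fin.val_castSucc, ite_self, add_zero]
      rw [if_neg (by omega), if_pos trivial, zero_add]
    · intro i j hij
      have hij : (j : ℕ) < i := hij
      rw [submatrix_apply, updateRow_ne (Fin.succ_ne_zero i), Fin.succAbove_last]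
      simp only [cycTridiag, of_apply, Fin.val_succ, Fin.val_castSucc, ite_self, add_zero]
      rw [if_neg (by omega), if_neg (by omega), add_zero]
  · intro j _ hj
    rw [updateRow_self, Pi.single_eq_of_ne hj]
    simp
  · simp

/-- Each corner lies in a row of its own, as `k ≠ 0`, so the determinant is affine in `u` and in `v`
separately. The coefficient `X` of `u v` is never computed; it only matters that it depends on
neither corner. -/
theorem det_cycTridiag {k : ℕ} (hk : k ≠ 0) (a b : ℕ → K) :
    ∃ X : K, ∀ u v : K, (cycTridiag k a b u v).det = (cycTridiag k a b 0 0).det +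
      (-1) ^ k * (u * ∏ i ∈ range k, b i + v * ∏ i ∈ range k, a i) + u * v * X := by
  refine ⟨(((cycTridiag k a b 0 0).updateRow 0 (Pi.single (Fin.last k) 1)).updateRow (Fin.last k)
    (Pi.single 0 1)).det, fun u v => ?_⟩
  have h1 : ∀ (a b : ℕ → K) (u v : K), (cycTridiag k a b u v).det = (cycTridiag k a b 0 v).det +
      u * ((cycTridiag k a b 0 v).updateRow 0 (Pi.single (Fin.last k) 1)).det := by
    intro a b u v
    rw [cycTridiag_row_zero, det_updateRow_add, det_updateRow_smul, updateRow_eq_self]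
  have h2 : (cycTridiag k a b 0 v).det = (cycTridiag k a b 0 0).det +
      v * ((-1) ^ k * ∏ i ∈ range k, a i) := by
    rw [← det_transpose, cycTridiag_transpose, h1, det_cycTridiag_updateRow_zero,
      ← cycTridiag_transpose, det_transpose]
  have h3 : ((cycTridiag k a b 0 v).updateRow 0 (Pi.single (Fin.last k) 1)).det =
      ((cycTridiag k a b 0 0).updateRow 0 (Pi.single (Fin.last k) 1)).det +
      v * (((cycTridiag k a b 0 0).updateRow 0 (Pi.single (Fin.last k) 1)).updateRow (Fin.last k)
    (Pi.single 0 1)).det := by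
    have h0 : Fin.last k ≠ 0 := by simpa [Fin.ext_iff] using hk
    rw [cycTridiag_row_last hk, updateRow_comm _ h0, det_updateRow_add, det_updateRow_smul,
      ← updateRow_comm _ h0, updateRow_eq_self]
  rw [h1, h2, h3, det_cycTridiag_updateRow_zero]
  ring

/-- The hypotheses say that the invertible matrix `diagonal d` intertwines the two matrices. -/
theorem det_cycTridiag_congr {k : ℕ} {a b a' b' : ℕ → K} {u v u' v' : K} (d : ℕ → K)
    (hd : ∀ i ≤ k, d i ≠ 0) (ha : ∀ i < k, d i * a i = a' i * d (i + 1))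
    (hb : ∀ i < k, d (i + 1) * b i = b' i * d i) (hu : d 0 * u = u' * d k)
    (hv : d k * v = v' * d 0) :
    (cycTridiag k a b u v).det = (cycTridiag k a' b' u' v').det := by
  have hne : (Matrix.diagonal fun i : Fin (k + 1) => d i).det ≠ 0 := by
    rw [det_diagonal]
    exact Finset.prod_ne_zero_iff.2 fun i _ => hd i (by omega)
  refine mul_left_cancel₀ hne ?_
  rw [← det_mul, mul_comm, ← det_mul]
  congr 1
  ext i j
  rw [diagonal_mul, mul_diagonal]
  simp only [cycTridiag, of_apply, mul_add, add_mul, mul_ite, ite_mul, mul_zero, zero_mul]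
  have h1 := i.2
  have h2 := j.2
  congr 1
  · congr 1
    · congr 1
      · split_ifs with h
        · rw [h, ha _ (by omega)]
        · rfl
      · split_ifs with h
        · rw [h, hb _ (by omega)]
        · rfl
    · split_ifs with h
      · rw [h.1, h.2, hu]
      · rfl
  · split_ifs with h
    · rw [h.1, h.2, hv]
    · rfl

/-- Two cyclically tridiagonal matrices with the same products of opposite entries and the same
determinant have the same sum of the two cyclic products, up to normalisation. -/
theorem cycTridiag_corner {k : ℕ} (hk : k ≠ 0) {a b a' b' : ℕ → K} {u v u' v' : K}
    (ha : ∀ i < k, a i ≠ 0) (ha' : ∀ i < k, a' i ≠ 0)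
    (hab : ∀ i < k, a i * b i = a' i * b' i) (huv : u * v = u' * v')
    (hdet : (cycTridiag k a b u v).det = (cycTridiag k a' b' u' v').det) :
    (u / ∏ i ∈ range k, a i / a' i) * ∏ i ∈ range k, b' i + v * ∏ i ∈ range k, a i =
      u' * ∏ i ∈ range k, b' i + v' * ∏ i ∈ range k, a' i := by
  -- Conjugation by this diagonal matrix turns `a, b` into `a', b'` and the corners into `u / d k`
  -- and `v * d k`, whose product is unchanged. With equal corner products the constant and the `X`
  -- terms of the two determinants cancel, and the terms linear in the corners remain.
  set d : ℕ → K := fun j => ∏ i ∈ range j, a i / a' i with hd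
  have hdne : ∀ j ≤ k, d j ≠ 0 := fun j hj => Finset.prod_ne_zero_iff.2 fun i hi =>
    div_ne_zero (ha i (by have := Finset.mem_range.1 hi; omega))
      (ha' i (by have := Finset.mem_range.1 hi; omega))
  have hdk := hdne k le_rfl
  have hds : ∀ i, d (i + 1) = d i * (a i / a' i) := fun i => Finset.prod_range_succ _ _
  have hd0 : d 0 = 1 := Finset.prod_range_zero _
  have hA : ∏ i ∈ range k, a i = d k * ∏ i ∈ range k, a' i := by
    rw [hd, ← Finset.prod_mul_distrib]
    refine Finset.prod_congr rfl fun i hi => ?_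
    rw [div_mul_cancel₀ _ (ha' i (Finset.mem_range.1 hi))]
  have hconj : (cycTridiag k a b u v).det = (cycTridiag k a' b' (u / d k) (v * d k)).det := by
    refine det_cycTridiag_congr d hdne (fun i hi => ?_) (fun i hi => ?_) ?_ ?_
    · rw [hds]; field_simp [ha' i hi]
    · rw [hds, mul_assoc, mul_comm (b' i)]
      congr 1
      rw [div_mul_eq_mul_div, hab i hi, mul_div_cancel_left₀ _ (ha' i hi)]
    · rw [hd0, one_mul, div_mul_cancel₀ _ hdk]
    · rw [hd0, mul_one, mul_comm]
  obtain ⟨X, hX⟩ := det_cycTridiag hk a' b'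
  rw [hconj, hX, hX u' v'] at hdet
  have huv' : u / d k * (v * d k) = u' * v' := by
    rw [← huv]; field_simp
  rw [huv'] at hdet
  have h3 := mul_left_cancel₀ (pow_ne_zero k (neg_ne_zero.2 one_ne_zero))
    (add_left_cancel (add_right_cancel hdet))
  change u / d k * _ + _ = _
  rw [hA, ← h3]
  ring
end
end LunardonPolverino

/-! ### Slopes, Dickson matrices and principal minors -/

namespace LunardonPolverino
open Matrix Finset Polynomial

/-- The slopes of the linear set of `f`: the `m` with `f x = m x` for some nonzero `x`. -/
def slopes {K : Type*} [Field K] (f : K → K) : Set K := {m | ∃ x ≠ 0, f x = m * x}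

section
variable {K : Type*} [Field K]

/-- Multilinearity in the rows: `S` is the set of rows taken from `D`, and the other rows are
multiples of unit vectors, which cut out the principal minor on `S`. -/
theorem det_add_diagonal {ι : Type*} [Fintype ι] [DecidableEq ι] (D : Matrix ι ι K) (y : ι → K) :
    (D + diagonal y).det = ∑ S : Finset ι, (∏ i ∈ Sᶜ, y i) *
      (D.submatrix (Subtype.val : S → ι) Subtype.val).det := by
  have h := (detRowAlternating (n := ι) (R := K)).map_add_univ D (diagonal y)
  change (D + diagonal y).det = _ at h
  rw [h]
  refine Finset.sum_congr rfl fun S _ => ?_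
  rw [← det_piecewise_one_eq_submatrix_det]
  have h2 := det_mul_column (fun i => if i ∈ S then 1 else y i)
    (Matrix.of (S.piecewise D.row (1 : Matrix ι ι K).row))
  have h3 : ∏ i, (if i ∈ S then 1 else y i) = ∏ i ∈ Sᶜ, y i := by
    rw [Finset.prod_ite]
    simp only [Finset.prod_const_one, one_mul]
    refine Finset.prod_congr ?_ fun _ _ => rfl
    ext i; simp
  rw [h3] at h2
  rw [← h2]
  change Matrix.det (S.piecewise D (diagonal y)) = _
  congr 1
  ext i j
  simp only [Finset.piecewise, of_apply]
  split_ifs with hi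
  · exact (one_mul _).symm
  · change diagonal y i j = y i * (1 : Matrix ι ι K) i j
    simp [diagonal_apply, one_apply]

/-- The polynomial whose value at `x` is the determinant of `D + diag (x ^ E i)`. -/
noncomputable def detPoly {ι : Type*} [Fintype ι] [DecidableEq ι] (D : Matrix ι ι K) (E : ι → ℕ) :
    K[X] :=
  ∑ S : Finset ι, C (D.submatrix (Subtype.val : S → ι) Subtype.val).det * X ^ (∑ i ∈ Sᶜ, E i)

theorem eval_detPoly {ι : Type*} [Fintype ι] [DecidableEq ι] (D : Matrix ι ι K) (E : ι → ℕ)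
    (x : K) : (detPoly D E).eval x = (D + diagonal fun i => x ^ E i).det := by
  rw [det_add_diagonal, detPoly, eval_finsetSum]
  refine Finset.sum_congr rfl fun S _ => ?_
  rw [eval_mul, eval_C, eval_pow, eval_X, Finset.prod_pow_eq_pow_sum, mul_comm]

/-- Distinct subsets have distinct exponent sums, so no two minors share a monomial and each can be
read off from the polynomial. -/
theorem coeff_detPoly {ι : Type*} [Fintype ι] [DecidableEq ι] (D : Matrix ι ι K) {E : ι → ℕ}
    (hE : Function.Injective fun S : Finset ι => ∑ i ∈ S, E i) (S : Finset ι) :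
    (detPoly D E).coeff (∑ i ∈ Sᶜ, E i) =
      (D.submatrix (Subtype.val : S → ι) Subtype.val).det := by
  rw [detPoly, finsetSum_coeff, Finset.sum_eq_single S]
  · simp
  · intro T _ hT
    rw [coeff_C_mul_X_pow, if_neg]
    intro h
    exact hT (compl_injective (hE h)).symm
  · simp

/-- The top monomial belongs to the empty minor, which is `1` for both matrices and cancels. -/
theorem degree_detPoly_sub_lt {ι : Type*} [Fintype ι] [DecidableEq ι] (D D' : Matrix ι ι K)
    {E : ι → ℕ} (hE : ∀ i, 0 < E i) :
    (detPoly D E - detPoly D' E).degree < ((∑ i, E i : ℕ) : WithBot ℕ) := by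
  rw [← mem_degreeLT, detPoly, detPoly, ← Finset.sum_sub_distrib]
  refine Submodule.sum_mem _ fun S _ => ?_
  rcases S.eq_empty_or_nonempty with rfl | hS
  · rw [det_isEmpty, det_isEmpty, sub_self]
    exact Submodule.zero_mem _
  · rw [← sub_mul, ← C_sub, mem_degreeLT]
    refine (degree_C_mul_X_pow_le _ _).trans_lt ?_
    obtain ⟨i, hi⟩ := hS
    exact_mod_cast Finset.sum_lt_sum_of_subset (Finset.subset_univ _) (Finset.mem_univ i)
      (by simpa using hi) (hE i) fun _ _ _ => Nat.zero_le _

theorem degree_detPoly_le {ι : Type*} [Fintype ι] [DecidableEq ι] (D : Matrix ι ι K)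
    (E : ι → ℕ) : (detPoly D E).degree ≤ ((∑ i, E i : ℕ) : WithBot ℕ) := by
  refine (degree_sum_le _ _).trans (Finset.sup_le fun S _ => ?_)
  refine (degree_C_mul_X_pow_le _ _).trans ?_
  exact_mod_cast Finset.sum_le_sum_of_subset (Finset.subset_univ _)

theorem sum_pow_injective {ι : Type*} [Fintype ι] [DecidableEq ι] {q : ℕ} (hq : 2 ≤ q)
    {E : ι → ℕ} (hE : Function.Injective E) :
    Function.Injective fun S : Finset ι => ∑ i ∈ S, q ^ E i := by
  intro S T h
  have h2 : ∑ i ∈ S.image E, q ^ i = ∑ i ∈ T.image E, q ^ i := by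
    rw [Finset.sum_image hE.injOn, Finset.sum_image hE.injOn]
    exact h
  exact Finset.image_injective hE (geomSum_injective hq h2)

end

/-- The power `σ ^ i` of an automorphism of order dividing `n`, for `i` modulo `n`. -/
def autPow {K : Type*} [Field K] {n : ℕ} (σ : K ≃+* K) (i : ZMod n) : K ≃+* K := σ ^ i.val

/-- The additive map `∑ A_i σ^i`. -/
def skewEval {K : Type*} [Field K] {n : ℕ} [NeZero n] (σ : K ≃+* K) (A : ZMod n → K) (x : K) : K :=
  ∑ i, A i * autPow σ i x

/-- The Dickson matrix of the additive map `∑ A_i σ^i`. -/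
def dickson {K : Type*} [Field K] {n : ℕ} (σ : K ≃+* K) (A : ZMod n → K) :
    Matrix (ZMod n) (ZMod n) K :=
  Matrix.of fun i j => autPow σ i (A (j - i))

section
variable {K : Type*} [Field K] {n : ℕ} {σ : K ≃+* K}

@[simp] theorem autPow_zero (x : K) : autPow σ (0 : ZMod n) x = x := by
  rw [autPow, ZMod.val_zero, pow_zero]; rfl

variable [NeZero n]

theorem autPow_add (hσ : σ ^ n = 1) (i j : ZMod n) (x : K) :
    autPow σ (i + j) x = autPow σ i (autPow σ j x) := by
  rw [autPow, autPow, autPow, ZMod.val_add, ← pow_eq_pow_mod _ hσ, pow_add]; rfl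

/-- The conjugates of the value are linear in the conjugates of `x`. Hence a slope `m` at `x` places
the conjugate vector of `x` in the kernel of the Dickson matrix shifted by `diag (σ ^ i (-m))`. -/
theorem dickson_mulVec (hσ : σ ^ n = 1) (A : ZMod n → K) (x : K) :
    dickson σ A *ᵥ (fun j => autPow σ j x) = fun i => autPow σ i (skewEval σ A x) := by
  ext i
  simp only [mulVec, dotProduct, dickson, of_apply, skewEval, map_sum, map_mul]
  rw [← Equiv.sum_comp (Equiv.addLeft i)]
  refine Finset.sum_congr rfl fun j _ => ?_
  rw [Equiv.coe_addLeft, add_sub_cancel_left, autPow_add hσ]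

theorem det_dickson_add_diagonal_eq_zero (hσ : σ ^ n = 1) {A : ZMod n → K} {m : K}
    (hm : m ∈ slopes (skewEval σ A)) :
    (dickson σ A + diagonal fun i => autPow σ i (-m)).det = 0 := by
  obtain ⟨x, hx, h⟩ := hm
  refine exists_mulVec_eq_zero_iff.1 ⟨fun j => autPow σ j x, fun h0 => hx ?_, ?_⟩
  · simpa using congrFun h0 0
  · rw [add_mulVec, dickson_mulVec hσ, h]
    ext i
    simp [mulVec_diagonal]

variable {q : ℕ} {E : ZMod n → ℕ}

theorem sum_pow_eq_of_injective (hq : 2 ≤ q) (hE : Function.Injective E) (hEn : ∀ i, E i < n) :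
    ∑ i, q ^ E i = (q ^ n - 1) / (q - 1) := by
  rw [← Nat.geomSum_eq hq, ← Finset.sum_image (f := fun i => q ^ i) hE.injOn]
  congr 1
  refine Finset.eq_of_subset_of_card_le (fun j hj => ?_) ?_
  · obtain ⟨i, -, rfl⟩ := Finset.mem_image.1 hj
    exact Finset.mem_range.2 (hEn i)
  · rw [Finset.card_image_of_injective _ hE, Finset.card_range, Finset.card_univ, ZMod.card]

theorem exists_finset_slopes {f : K → K} (hq : 2 ≤ q)
    (hQ : (q ^ n - 1) / (q - 1) ≤ (slopes f).ncard) :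
    ∃ s : Finset K, (∀ m, m ∈ s ↔ -m ∈ slopes f) ∧ (q ^ n - 1) / (q - 1) ≤ s.card := by
  have hfin : (slopes f).Finite := by
    refine Set.finite_of_ncard_pos (lt_of_lt_of_le ?_ hQ)
    rw [← Nat.geomSum_eq hq]
    exact Finset.sum_pos (fun i _ => by positivity)
      ⟨0, Finset.mem_range.2 (Nat.pos_of_ne_zero (NeZero.ne n))⟩
  refine ⟨hfin.toFinset.map (Equiv.neg K).toEmbedding, fun m => ?_, ?_⟩
  · simp only [Finset.mem_map, Set.Finite.mem_toFinset, Equiv.coe_toEmbedding, Equiv.neg_apply]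
    exact ⟨by rintro ⟨a, ha, rfl⟩; rwa [neg_neg], fun h => ⟨-m, h, neg_neg m⟩⟩
  · rw [Finset.card_map, ← Set.ncard_eq_toFinset_card _ hfin]
    exact hQ

/-- The two determinant polynomials agree at the negatives of all common slopes, of which there are
at least `(q ^ n - 1) / (q - 1)`, while their difference has smaller degree. So they coincide
coefficient by coefficient. -/
theorem minors_eq_of_slopes_eq (hσ : σ ^ n = 1) (hq : 2 ≤ q) (hE : Function.Injective E)
    (hEn : ∀ i, E i < n) (hEσ : ∀ i x, autPow σ i x = x ^ q ^ E i) {A B : ZMod n → K}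
    (hAB : slopes (skewEval σ A) = slopes (skewEval σ B))
    (hQ : (q ^ n - 1) / (q - 1) ≤ (slopes (skewEval σ B)).ncard) (S : Finset (ZMod n)) :
    ((dickson σ A).submatrix (Subtype.val : S → ZMod n) Subtype.val).det =
      ((dickson σ B).submatrix (Subtype.val : S → ZMod n) Subtype.val).det := by
  obtain ⟨s, hs, hcard⟩ := exists_finset_slopes hq hQ
  have hinj := sum_pow_injective hq hE
  rw [← coeff_detPoly _ hinj, ← coeff_detPoly _ hinj]
  congr 1
  rw [← sub_eq_zero]
  refine Polynomial.eq_zero_of_degree_lt_of_eval_finset_eq_zero s ?_ fun m hm => ?_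
  · refine (degree_detPoly_sub_lt _ _ fun i => by positivity).trans_le ?_
    rw [sum_pow_eq_of_injective hq hE hEn]
    exact_mod_cast hcard
  · have hm := (hs m).1 hm
    have h1 := det_dickson_add_diagonal_eq_zero hσ hm
    have h2 := det_dickson_add_diagonal_eq_zero hσ (hAB ▸ hm)
    simp only [neg_neg, hEσ] at h1 h2
    rw [eval_sub, eval_detPoly, eval_detPoly, h1, h2, sub_self]

/-- A root that is not the negative of a slope would give the determinant polynomial more roots than
its degree. It would vanish identically, although its top coefficient is the empty minor `1`. -/
theorem mem_slopes_iff_det (hσ : σ ^ n = 1) (hq : 2 ≤ q) (hE : Function.Injective E)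
    (hEn : ∀ i, E i < n) (hEσ : ∀ i x, autPow σ i x = x ^ q ^ E i) {A : ZMod n → K}
    (hQ : (q ^ n - 1) / (q - 1) ≤ (slopes (skewEval σ A)).ncard) (m : K) :
    m ∈ slopes (skewEval σ A) ↔
      (dickson σ A + diagonal fun i => autPow σ i (-m)).det = 0 := by
  classical
  refine ⟨det_dickson_add_diagonal_eq_zero hσ, fun h => ?_⟩
  by_contra hm
  obtain ⟨s, hs, hcard⟩ := exists_finset_slopes hq hQ
  have hms : -m ∉ s := fun h' => hm (by simpa using (hs _).1 h')
  have hzero : detPoly (dickson σ A) (fun i => q ^ E i) = 0 := by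
    refine Polynomial.eq_zero_of_degree_lt_of_eval_finset_eq_zero (insert (-m) s) ?_
      fun x hx => ?_
    · refine (degree_detPoly_le _ _).trans_lt ?_
      rw [sum_pow_eq_of_injective hq hE hEn, Finset.card_insert_of_notMem hms]
      exact_mod_cast Nat.lt_succ_of_le hcard
    · rw [eval_detPoly]
      simp only [← hEσ]
      rcases Finset.mem_insert.1 hx with rfl | hx
      · exact h
      · simpa using det_dickson_add_diagonal_eq_zero hσ ((hs x).1 hx)
  have h1 := coeff_detPoly (dickson σ A) (sum_pow_injective hq hE) ∅
  rw [hzero, coeff_zero, det_isEmpty] at h1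
  exact zero_ne_one h1
end
end LunardonPolverino

/-! ### Recovering a binomial map from its principal minors -/

namespace LunardonPolverino
open Matrix Finset Polynomial

/-- The coefficients of `u σ + v σ⁻¹`, more generally `u σ^k + v σ^(-k)`. -/
def pairCoeff {K : Type*} [Field K] {n : ℕ} (k : ZMod n) (u v : K) : ZMod n → K :=
  Pi.single k u + Pi.single (-k) v

/-- The norm `∏ σ^i x` down to the fixed field of `σ`. -/
def autNorm {K : Type*} [Field K] (n : ℕ) [NeZero n] (σ : K ≃+* K) (x : K) : K :=
  ∏ i : ZMod n, autPow σ i x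

section
variable {K : Type*} [Field K] {n : ℕ} [NeZero n] {σ : K ≃+* K}

theorem autNorm_eq_prod_range (x : K) :
    autNorm n σ x = ∏ i ∈ range n, autPow σ (i : ZMod n) x := by
  refine Finset.prod_nbij' (fun i => i.val) (fun i => (i : ZMod n)) ?_ ?_ ?_ ?_ ?_
  · intro i _; exact Finset.mem_range.2 (ZMod.val_lt i)
  · intro i _; exact Finset.mem_univ _
  · intro i _; exact ZMod.natCast_rightInverse i
  · intro i hi; exact ZMod.val_cast_of_lt (Finset.mem_range.1 hi)
  · intro i _; rw [ZMod.natCast_rightInverse i]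

theorem autNorm_mul (x y : K) : autNorm n σ (x * y) = autNorm n σ x * autNorm n σ y := by
  simp only [autNorm, map_mul, Finset.prod_mul_distrib]

theorem autNorm_ne_zero {x : K} (hx : x ≠ 0) : autNorm n σ x ≠ 0 :=
  Finset.prod_ne_zero_iff.2 fun i _ => (map_ne_zero_iff _ (autPow σ i).injective).2 hx

theorem autNorm_autPow (hσ : σ ^ n = 1) (i : ZMod n) (x : K) :
    autNorm n σ (autPow σ i x) = autNorm n σ x := by
  simp only [autNorm, ← autPow_add hσ]
  exact Equiv.prod_comp (Equiv.addRight i) (fun j => autPow σ j x)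

omit [NeZero n] in
theorem autPow_ne_zero {x : K} (hx : x ≠ 0) (i : ZMod n) : autPow σ i x ≠ 0 :=
  (map_ne_zero_iff _ (autPow σ i).injective).2 hx

omit [NeZero n] in
theorem natCast_ne_zero_of_lt {k : ℕ} (h0 : 0 < k) (hk : k < n) : (k : ZMod n) ≠ 0 := by
  rw [Ne, ZMod.natCast_eq_zero_iff]
  exact Nat.not_dvd_of_pos_of_lt h0 hk

omit [NeZero n] in
theorem natCast_ne_natCast {j k : ℕ} (hjk : j < k) (hk : k < n) : (j : ZMod n) ≠ k := by
  intro h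
  refine natCast_ne_zero_of_lt (n := n) (Nat.sub_pos_of_lt hjk) (by omega) ?_
  rw [Nat.cast_sub hjk.le, h, sub_self]

/-- On the consecutive indices `0, …, k` the entry at `(i, j)` involves only `A (j - i)`, so once
the intermediate coefficients vanish only the two adjacent diagonals and the two corners survive. -/
theorem dickson_submatrix_eq_cycTridiag (hσ : σ ^ n = 1) {A : ZMod n → K} (hA0 : A 0 = 0) {k : ℕ}
    (hk : 2 ≤ k) (hA : ∀ j : ℕ, 2 ≤ j → j < k → A j = 0 ∧ A (-j) = 0) :
    (dickson σ A).submatrix (fun i : Fin (k + 1) => ((i : ℕ) : ZMod n))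
      (fun i : Fin (k + 1) => ((i : ℕ) : ZMod n)) =
    cycTridiag k (fun i => autPow σ (i : ZMod n) (A 1))
      (fun i => autPow σ (i : ZMod n) (autPow σ (1 : ZMod n) (A (-1))))
      (A k) (autPow σ (k : ZMod n) (A (-k))) := by
  ext ⟨i, hi⟩ ⟨j, hj⟩
  simp only [submatrix_apply, dickson, cycTridiag, of_apply, ← autPow_add hσ]
  rcases lt_trichotomy i j with h | rfl | h
  · obtain ⟨d, rfl⟩ := Nat.exists_eq_add_of_lt h
    have e : (((i + d + 1 : ℕ) : ZMod n) - (i : ℕ)) = ((d + 1 : ℕ) : ZMod n) := by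
      push_cast; ring
    rw [e, if_neg (show ¬ i = i + d + 1 + 1 by omega), if_neg (show ¬ (i = k ∧ _) by omega)]
    rcases Nat.eq_zero_or_pos d with rfl | hd
    · rw [if_pos rfl, if_neg (by omega)]
      simp
    · rw [if_neg (by omega)]
      split_ifs with h'
      · obtain ⟨rfl, rfl⟩ := h'
        simp
      · rw [(hA (d + 1) (by omega) (by omega)).1]
        simp
  · rw [sub_self, hA0, if_neg (by omega), if_neg (by omega), if_neg (by omega), if_neg (by omega)]
    simp
  · obtain ⟨d, rfl⟩ := Nat.exists_eq_add_of_lt h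
    have e : ((j : ZMod n) - ((j + d + 1 : ℕ) : ZMod n)) = -((d + 1 : ℕ) : ZMod n) := by
      push_cast; ring
    rw [e, if_neg (show ¬ j = j + d + 1 + 1 by omega),
      if_neg (show ¬ (j + d + 1 = 0 ∧ _) by omega)]
    rcases Nat.eq_zero_or_pos d with rfl | hd
    · rw [if_pos rfl, if_neg (by omega)]
      simp
    · rw [if_neg (by omega)]
      split_ifs with h'
      · obtain ⟨rfl, rfl⟩ := h'
        simp
      · rw [(hA (d + 1) (by omega) (by omega)).2]
        simp

omit [NeZero n] in
theorem pairCoeff_one_apply (hn : 4 ≤ n) (u v : K) :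
    pairCoeff (1 : ZMod n) u v 0 = 0 ∧ pairCoeff (1 : ZMod n) u v 1 = u ∧
      pairCoeff (1 : ZMod n) u v (-1) = v ∧
      ∀ j : ℕ, 2 ≤ j → j ≤ n - 2 → pairCoeff (1 : ZMod n) u v j = 0 ∧
        pairCoeff (1 : ZMod n) u v (-j) = 0 := by
  have h01 : (0 : ZMod n) ≠ 1 := by
    have := natCast_ne_natCast (n := n) (show 0 < 1 by norm_num) (by omega); simpa using this
  have h2 : (1 : ZMod n) ≠ -1 := by
    intro h
    refine natCast_ne_zero_of_lt (n := n) (show 0 < 2 by norm_num) (by omega) ?_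
    push_cast
    linear_combination h
  refine ⟨?_, ?_, ?_, fun j hj hjn => ?_⟩
  · simp [pairCoeff, h01.symm]
  · simp [pairCoeff, h2]
  · simp [pairCoeff, h2.symm]
  · have h1 : (j : ZMod n) ≠ 1 := by
      have := natCast_ne_natCast (n := n) (show 1 < j by omega) (by omega)
      simpa using this.symm
    have h3 : (j : ZMod n) ≠ -1 := by
      intro h
      refine natCast_ne_zero_of_lt (n := n) (show 0 < j + 1 by omega) (by omega) ?_
      push_cast
      linear_combination h
    have h4 : -(j : ZMod n) ≠ 1 := fun h => h3 (by linear_combination -h)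
    simp [pairCoeff, h1, h3, h4]

/-- A map with the same principal minors as `σ + θ σ⁻¹` is of the form `α σ + β σ⁻¹`. -/
theorem eq_pairCoeff_of_minors_eq (hn : 4 ≤ n) (hσ : σ ^ n = 1) {A : ZMod n → K} {θ : K}
    (hθ : θ ≠ 0)
    (hmin : ∀ S : Finset (ZMod n),
      ((dickson σ A).submatrix (Subtype.val : S → ZMod n) Subtype.val).det =
      ((dickson σ (pairCoeff 1 1 θ)).submatrix (Subtype.val : S → ZMod n) Subtype.val).det) :
    ∃ α β : K, A = pairCoeff 1 α β ∧ α * autPow σ (1 : ZMod n) β = autPow σ (1 : ZMod n) θ ∧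
      (autNorm n σ α = 1 ∨ autNorm n σ α = autNorm n σ θ) := by
  obtain ⟨hB0, hB1, hBm, hBj⟩ := pairCoeff_one_apply hn 1 θ
  set B : ZMod n → K := pairCoeff 1 1 θ with hB
  have hmin' : ∀ (k : ℕ) (f : Fin k → ZMod n), Function.Injective f →
      ((dickson σ A).submatrix f f).det = ((dickson σ B).submatrix f f).det := by
    intro k f hf
    let e : Fin k ≃ (Finset.univ.image f : Finset (ZMod n)) :=
      Equiv.ofBijective (fun i => ⟨f i, Finset.mem_image_of_mem f (Finset.mem_univ i)⟩)
        ⟨fun i j h => hf (congrArg Subtype.val h), fun ⟨y, hy⟩ => by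
          obtain ⟨i, -, rfl⟩ := Finset.mem_image.1 hy
          exact ⟨i, rfl⟩⟩
    have h := hmin (Finset.univ.image f)
    rw [← det_submatrix_equiv_self e, ← det_submatrix_equiv_self e
      ((dickson σ B).submatrix _ _), submatrix_submatrix, submatrix_submatrix] at h
    exact h
  -- The minors of size one kill the diagonal; those of size two then give the products of opposite
  -- entries.
  have hA0 : A 0 = 0 := by
    have h := hmin' 1 (fun _ => 0) (Function.injective_of_subsingleton _)
    rw [det_fin_one, det_fin_one] at h
    simpa [dickson, hB0] using h
  have hpair : ∀ j : ZMod n, j ≠ 0 → A j * autPow σ j (A (-j)) = B j * autPow σ j (B (-j)) := by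
    intro j hj
    have h := hmin' 2 ![0, j] (by
      intro a b hab
      fin_cases a <;> fin_cases b
      · rfl
      · exact (hj hab.symm).elim
      · exact (hj hab).elim
      · rfl)
    rw [det_fin_two, det_fin_two] at h
    simpa [dickson, hB0, hA0] using h
  have h10 : (1 : ZMod n) ≠ 0 := by
    have := natCast_ne_zero_of_lt (n := n) (show 0 < 1 by norm_num) (by omega); simpa using this
  have h1 : A 1 * autPow σ (1 : ZMod n) (A (-1)) = autPow σ (1 : ZMod n) θ := by
    rw [hpair 1 h10, hB1, hBm, one_mul]
  have hσθ : autPow σ (1 : ZMod n) θ ≠ 0 := autPow_ne_zero hθ _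
  have hα : A 1 ≠ 0 := fun h => hσθ (by rw [← h1, h, zero_mul])
  have hι : ∀ k < n, Function.Injective (fun i : Fin (k + 1) => ((i : ℕ) : ZMod n)) := by
    intro k hk i j hij
    by_contra hne
    rcases lt_or_gt_of_ne (fun h => hne (Fin.ext h) : (i : ℕ) ≠ j) with h | h
    · exact natCast_ne_natCast h (by omega) hij
    · exact natCast_ne_natCast h (by omega) hij.symm
  -- The minor on `0, …, k` links the corner coefficients `A k` and `A (-k)`, provided that
  -- everything strictly between is already known to vanish.
  have hcorner : ∀ k : ℕ, 2 ≤ k → k < n →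
      (∀ j : ℕ, 2 ≤ j → j < k → A j = 0 ∧ A (-j) = 0) →
      A k / (∏ i ∈ range k, autPow σ (i : ZMod n) (A 1)) *
          ∏ i ∈ range k, autPow σ (i : ZMod n) (autPow σ (1 : ZMod n) θ) +
        autPow σ (k : ZMod n) (A (-k)) * ∏ i ∈ range k, autPow σ (i : ZMod n) (A 1) =
      B k * ∏ i ∈ range k, autPow σ (i : ZMod n) (autPow σ (1 : ZMod n) θ) +
        autPow σ (k : ZMod n) (B (-k)) := by
    intro k hk2 hkn hAk
    have h := hmin' (k + 1) _ (hι k hkn)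
    rw [dickson_submatrix_eq_cycTridiag hσ hA0 hk2 hAk,
      dickson_submatrix_eq_cycTridiag hσ hB0 hk2 fun j h2 hjk => hBj j h2 (by omega)] at h
    have h' := cycTridiag_corner (by omega) (fun i _ => autPow_ne_zero hα _)
      (fun i _ => by rw [hB1, map_one]; exact one_ne_zero)
      (fun i _ => by rw [← map_mul, h1, hB1, hBm, map_one, one_mul])
      (hpair k (natCast_ne_zero_of_lt (by omega) hkn)) h
    simpa [hB1, hBm] using h'
  -- The minor on `{0, k}` makes one of `A k`, `A (-k)` vanish, and the corner relation then kills
  -- the other. For `2 * k = n` the two are the same coefficient.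
  have hzero : ∀ k : ℕ, 2 ≤ k → 2 * k ≤ n → A k = 0 ∧ A (-k) = 0 := by
    intro k
    induction k using Nat.strong_induction_on with
    | _ k ih =>
      intro hk2 hkn
      have hk0 : (k : ZMod n) ≠ 0 := natCast_ne_zero_of_lt (by omega) (by omega)
      have hp := hpair k hk0
      rw [(hBj k hk2 (by omega)).1, zero_mul] at hp
      rcases eq_or_lt_of_le hkn with h | h
      · have hneg : -(k : ZMod n) = k := by
          have : ((2 * k : ℕ) : ZMod n) = 0 := by rw [h]; simp
          push_cast at this
          linear_combination -this
        rw [hneg] at hp ⊢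
        have : A k = 0 := by
          rcases mul_eq_zero.1 hp with h | h
          · exact h
          · exact (map_eq_zero_iff _ (autPow σ (k : ZMod n)).injective).1 h
        exact ⟨this, this⟩
      · have hc := hcorner k hk2 (by omega) fun j hj hjk => ih j hjk hj (by omega)
        rw [(hBj k hk2 (by omega)).1, (hBj k hk2 (by omega)).2, map_zero, zero_mul, add_zero] at hc
        have hP : ∏ i ∈ range k, autPow σ (i : ZMod n) (A 1) ≠ 0 :=
          Finset.prod_ne_zero_iff.2 fun i _ => autPow_ne_zero hα _
        have hP' : ∏ i ∈ range k, autPow σ (i : ZMod n) (autPow σ (1 : ZMod n) θ) ≠ 0 :=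
          Finset.prod_ne_zero_iff.2 fun i _ => autPow_ne_zero hσθ _
        rcases mul_eq_zero.1 hp with h0 | h0
        · rw [h0, zero_div, zero_mul, zero_add] at hc
          exact ⟨h0, (map_eq_zero_iff _ (autPow σ (k : ZMod n)).injective).1
            ((mul_eq_zero.1 hc).resolve_right hP)⟩
        · rw [h0, zero_mul, add_zero] at hc
          exact ⟨(div_eq_zero_iff.1 ((mul_eq_zero.1 hc).resolve_right hP')).resolve_right hP,
            (map_eq_zero_iff _ (autPow σ (k : ZMod n)).injective).1 h0⟩
  have hneg : ∀ j : ℕ, j ≤ n → ((n - j : ℕ) : ZMod n) = -(j : ZMod n) := by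
    intro j hj
    rw [Nat.cast_sub hj]
    simp
  have hall : ∀ j : ℕ, 2 ≤ j → j ≤ n - 2 → A j = 0 := by
    intro j hj hjn
    rcases le_total (2 * j) n with h | h
    · exact (hzero j hj h).1
    · have := (hzero (n - j) (by omega) (by omega)).2
      rwa [hneg j (by omega), neg_neg] at this
  refine ⟨A 1, A (-1), ?_, h1, ?_⟩
  · obtain ⟨h0', h1', hm', hj'⟩ := pairCoeff_one_apply hn (A 1) (A (-1))
    ext i
    obtain ⟨j, hj, rfl⟩ : ∃ j : ℕ, j < n ∧ (j : ZMod n) = i :=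
      ⟨i.val, ZMod.val_lt i, ZMod.natCast_rightInverse i⟩
    rcases (by omega : j = 0 ∨ j = 1 ∨ (2 ≤ j ∧ j ≤ n - 2) ∨ j = n - 1) with rfl | rfl | h | rfl
    · simp [hA0, h0']
    · simp [h1']
    · rw [hall j h.1 h.2, (hj' j h.1 h.2).1]
    · rw [hneg 1 (by omega), Nat.cast_one, hm']
  -- For `k = n - 1` the corners are `A (-1)` and, up to conjugation, `A 1`. The corner relation
  -- becomes a quadratic equation for `N(α)` with roots `1` and `N(θ)`.
  · have hc := hcorner (n - 1) (by omega) (by omega) fun j hj hjn =>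
      ⟨hall j hj (by omega), by
        have := hall (n - j) (by omega) (by omega)
        rwa [hneg j (by omega)] at this⟩
    rw [hneg 1 (by omega), Nat.cast_one, neg_neg, hBm, hB1, map_one] at hc
    have hNα : autNorm n σ (A 1) = (∏ i ∈ range (n - 1), autPow σ (i : ZMod n) (A 1)) *
        autPow σ (-1 : ZMod n) (A 1) := by
      obtain ⟨m, rfl⟩ : ∃ m, n = m + 1 := ⟨n - 1, by omega⟩
      have h' := hneg 1 (by omega)
      rw [Nat.cast_one, Nat.add_sub_cancel] at h'
      rw [autNorm_eq_prod_range, Finset.prod_range_succ, h', Nat.add_sub_cancel]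
    have hNθ : autNorm n σ θ = θ *
        ∏ i ∈ range (n - 1), autPow σ (i : ZMod n) (autPow σ (1 : ZMod n) θ) := by
      obtain ⟨m, rfl⟩ : ∃ m, n = m + 1 := ⟨n - 1, by omega⟩
      rw [autNorm_eq_prod_range, Finset.prod_range_succ', mul_comm]
      simp [← autPow_add hσ]
    have hθ' : A (-1) * autPow σ (-1 : ZMod n) (A 1) = θ := by
      have := congrArg (autPow σ (-1 : ZMod n)) h1
      rw [map_mul, ← autPow_add hσ, ← autPow_add hσ, neg_add_cancel, autPow_zero,
        autPow_zero] at this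
      rw [mul_comm, this]
    set P := ∏ i ∈ range (n - 1), autPow σ (i : ZMod n) (A 1)
    set P' := ∏ i ∈ range (n - 1), autPow σ (i : ZMod n) (autPow σ (1 : ZMod n) θ)
    set x := autPow σ (-1 : ZMod n) (A 1)
    have hP : P ≠ 0 := Finset.prod_ne_zero_iff.2 fun i _ => autPow_ne_zero hα _
    have key : (P * x - 1) * (P * x - θ * P') = 0 := by
      have h3 : A (-1) * P' + x * P * P = θ * P' * P + P := by
        field_simp at hc
        linear_combination hc
      rw [← hθ'] at h3 ⊢
      linear_combination x * h3
    rw [hNα, hNθ]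
    rcases mul_eq_zero.1 key with h | h
    · exact Or.inl (sub_eq_zero.1 h)
    · exact Or.inr (sub_eq_zero.1 h)
end
end LunardonPolverino

/-! ### Compositions of combinations of powers of `σ` -/

namespace LunardonPolverino
open Matrix Finset Polynomial

section
variable {K : Type*} [Field K] {n : ℕ} [NeZero n] {σ : K ≃+* K}

/-- Dedekind's independence of characters, which justifies comparing coefficients. -/
theorem skewEval_injective (hinj : Function.Injective (autPow σ : ZMod n → K ≃+* K)) :
    Function.Injective (skewEval σ : (ZMod n → K) → K → K) := by
  have hli := (linearIndependent_monoidHom K K).comp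
    (fun i : ZMod n => ((autPow σ i : K ≃+* K) : K →* K)) (fun i j hij => hinj (by
      ext x; exact DFunLike.congr_fun hij x))
  rw [Fintype.linearIndependent_iff] at hli
  intro A B hAB
  ext i
  rw [← sub_eq_zero]
  refine hli (fun i => A i - B i) ?_ i
  ext x
  have := congrFun hAB x
  simp only [skewEval] at this
  simp only [Finset.sum_apply, Pi.smul_apply, Function.comp_apply, smul_eq_mul, sub_mul,
    Finset.sum_sub_distrib, Pi.zero_apply, sub_eq_zero]
  exact this

theorem skewEval_add (A B : ZMod n → K) (x : K) :
    skewEval σ (A + B) x = skewEval σ A x + skewEval σ B x := by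
  simp [skewEval, add_mul, Finset.sum_add_distrib]

theorem skewEval_single (k : ZMod n) (u x : K) :
    skewEval σ (Pi.single k u) x = u * autPow σ k x := by
  rw [skewEval, Finset.sum_eq_single k]
  · simp
  · intro j _ hj
    simp [hj]
  · simp

theorem skewEval_pairCoeff (k : ZMod n) (u v x : K) :
    skewEval σ (pairCoeff k u v) x = u * autPow σ k x + v * autPow σ (-k) x := by
  rw [pairCoeff, skewEval_add, skewEval_single, skewEval_single]

theorem skewEval_comp (hσ : σ ^ n = 1) (A B : ZMod n → K) :
    ∃ C : ZMod n → K, ∀ x, skewEval σ C x = skewEval σ A (skewEval σ B x) := by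
  refine ⟨fun k => ∑ i, A i * autPow σ i (B (k - i)), fun x => ?_⟩
  simp only [skewEval, map_sum, map_mul, Finset.sum_mul, Finset.mul_sum]
  rw [Finset.sum_comm]
  refine Finset.sum_congr rfl fun i _ => ?_
  rw [← Equiv.sum_comp (Equiv.addRight i)]
  refine Finset.sum_congr rfl fun j _ => ?_
  simp only [Equiv.coe_addRight, add_comm j i, autPow_add hσ, add_sub_cancel_left]
  ring

/-- On a finite field an injective map is a permutation of finite order, so its inverse is one of
its iterates and is again a combination of powers of `σ`. -/
theorem exists_skewEval_comp_eq [Finite K] (hσ : σ ^ n = 1) (A B : ZMod n → K)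
    (hA : Function.Injective (skewEval σ A)) :
    ∃ H : ZMod n → K, ∀ x, skewEval σ H (skewEval σ A x) = skewEval σ B x := by
  have hiter : ∀ j : ℕ, ∃ C : ZMod n → K, ∀ x, skewEval σ C x = (skewEval σ A)^[j] x := by
    intro j
    induction j with
    | zero => exact ⟨Pi.single 0 1, fun x => by simp [skewEval_single]⟩
    | succ j ih =>
      obtain ⟨C, hC⟩ := ih
      obtain ⟨C', hC'⟩ := skewEval_comp hσ C A
      exact ⟨C', fun x => by rw [hC', hC, Function.iterate_succ_apply]⟩
  let e : Equiv.Perm K := Equiv.ofBijective _ (Finite.injective_iff_bijective.1 hA)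
  obtain ⟨C, hC⟩ := hiter (orderOf e - 1)
  obtain ⟨H, hH⟩ := skewEval_comp hσ B C
  refine ⟨H, fun x => ?_⟩
  rw [hH, hC, ← Function.iterate_succ_apply]
  congr 1
  rw [Nat.succ_eq_add_one, Nat.sub_add_cancel (orderOf_pos e)]
  have h := congrArg (fun f : Equiv.Perm K => f x) (pow_orderOf_eq_one e)
  simp only [Equiv.Perm.coe_pow, Equiv.Perm.coe_one, id] at h
  exact h

omit [NeZero n] in
theorem natCast_ne_zero_of_four_le (hn : 4 ≤ n) :
    (1 : ZMod n) ≠ 0 ∧ (2 : ZMod n) ≠ 0 ∧ (3 : ZMod n) ≠ 0 := by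
  have h := fun k h0 hk => natCast_ne_zero_of_lt (n := n) (k := k) h0 hk
  refine ⟨?_, ?_, ?_⟩
  · exact_mod_cast h 1 (by norm_num) (by omega)
  · exact_mod_cast h 2 (by norm_num) (by omega)
  · exact_mod_cast h 3 (by norm_num) (by omega)

-- The nonzero coefficients at `1 + k` and `1 - k` must be cancelled or matched, so each of these
-- exponents meets another exponent in the list. The listed coincidences, combined with the
-- invertibility of `k`, leave only `k = ± 1` and the exceptional `n = 5`, `k = ± 2`.
omit [NeZero n] in
theorem single_support_cases (hn : 4 ≤ n) {k l : ZMod n} (hkl : k * l = 1)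
    {x₁ x₂ x₃ x₄ x₅ x₆ y₀ y₁ y₂ : K} (h2 : x₂ ≠ 0) (h3 : x₃ ≠ 0)
    (h : (Pi.single 1 x₁ + Pi.single (1 + k) x₂ + Pi.single (1 - k) x₃ + Pi.single (-1) x₄ +
      Pi.single (-1 + k) x₅ + Pi.single (-1 - k) x₆ : ZMod n → K) =
      Pi.single 0 y₀ + Pi.single k y₁ + Pi.single (-k) y₂) :
    k = 1 ∨ k = -1 ∨ n = 5 ∧ (k = 2 ∨ k = -2) := by
  obtain ⟨z1, z2, z3⟩ := natCast_ne_zero_of_four_le hn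
  have hk0 : k ≠ 0 := by rintro rfl; exact z1 (by rw [← hkl, zero_mul])
  have h2k : 2 * k ≠ 0 := fun h => z2 (by linear_combination l * h - 2 * hkl)
  have c1 : k = -1 ∨ k = -2 ∨ 2 * k = -2 ∨ 2 * k = -1 := by
    by_contra hc
    simp only [not_or] at hc
    obtain ⟨c1, c2, c3, c4⟩ := hc
    have e := congrFun h (1 + k)
    simp only [Pi.add_apply, Pi.single_apply] at e
    rw [if_neg (fun h => hk0 (by linear_combination h)), if_pos trivial,
      if_neg (fun h => h2k (by linear_combination h)),
      if_neg (fun h => c2 (by linear_combination h)),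
      if_neg (fun h => z2 (by linear_combination h)),
      if_neg (fun h => c3 (by linear_combination h)),
      if_neg (fun h => c1 (by linear_combination h)),
      if_neg (fun h => z1 (by linear_combination h)),
      if_neg (fun h => c4 (by linear_combination h))] at e
    exact h2 (by simpa using e)
  have c2 : k = 1 ∨ k = 2 ∨ 2 * k = 2 ∨ 2 * k = 1 := by
    by_contra hc
    simp only [not_or] at hc
    obtain ⟨c1, c2, c3, c4⟩ := hc
    have e := congrFun h (1 - k)
    simp only [Pi.add_apply, Pi.single_apply] at e
    rw [if_neg (fun h => hk0 (by linear_combination -h)),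
      if_neg (fun h => h2k (by linear_combination -h)), if_pos trivial,
      if_neg (fun h => c2 (by linear_combination -h)),
      if_neg (fun h => c3 (by linear_combination -h)),
      if_neg (fun h => z2 (by linear_combination h)),
      if_neg (fun h => c1 (by linear_combination -h)),
      if_neg (fun h => c4 (by linear_combination -h)),
      if_neg (fun h => z1 (by linear_combination h))] at e
    exact h3 (by simpa using e)
  have five : (5 : ZMod n) = 0 → n = 5 := by
    intro h
    have h' : ((5 : ℕ) : ZMod n) = 0 := by exact_mod_cast h
    rw [ZMod.natCast_eq_zero_iff] at h'
    exact ((Nat.dvd_prime (by norm_num)).1 h').resolve_left (by omega)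
  rcases c1 with c1 | c1 | c1 | c1
  · exact Or.inr (Or.inl c1)
  · rcases c2 with c2 | c2 | c2 | c2
    · exact Or.inl c2
    · exact (z2 (by linear_combination l * (c1 + c2) - 2 * hkl)).elim
    · exact (z3 (by linear_combination l * (c1 + c2) - 3 * hkl)).elim
    · exact Or.inr (Or.inr ⟨five (by linear_combination 2 * c1 - c2), Or.inr c1⟩)
  · rcases c2 with c2 | c2 | c2 | c2
    · exact Or.inl c2
    · exact (z3 (by linear_combination l * (c1 + c2) - 3 * hkl)).elim
    · have h4 : n = 4 := by
        have h' : ((4 : ℕ) : ZMod n) = 0 := by push_cast; linear_combination c1 - c2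
        rw [ZMod.natCast_eq_zero_iff] at h'
        exact le_antisymm (Nat.le_of_dvd (by norm_num) h') hn
      subst h4
      have hdec : ∀ k : ZMod 4, 2 * k = 2 → k = 1 ∨ k = -1 := by decide
      exact (hdec k c2).imp_right Or.inl
    · exact (z3 (by linear_combination c1 - c2)).elim
  · rcases c2 with c2 | c2 | c2 | c2
    · exact Or.inl c2
    · exact Or.inr (Or.inr ⟨five (by linear_combination c1 - 2 * c2), Or.inl c2⟩)
    · exact (z3 (by linear_combination c1 - c2)).elim
    · exact (z2 (by linear_combination c1 - c2)).elim

/-- The composition `(α σ + β σ⁻¹) ∘ (a + b (u σ^k + v σ^(-k)))` written out. -/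
theorem pairCoeff_comp_coeff (hσ : σ ^ n = 1)
    (hinj : Function.Injective (autPow σ : ZMod n → K ≃+* K)) {k : ZMod n} {α β a b c d u v : K}
    (h : ∀ x, skewEval σ (pairCoeff (1 : ZMod n) α β) (a * x + b * skewEval σ (pairCoeff k u v) x) =
      c * x + d * skewEval σ (pairCoeff k u v) x) :
    (Pi.single 1 (α * autPow σ (1 : ZMod n) a) +
      Pi.single (1 + k) (α * autPow σ (1 : ZMod n) (b * u)) +
      Pi.single (1 - k) (α * autPow σ (1 : ZMod n) (b * v)) +
      Pi.single (-1) (β * autPow σ (-1 : ZMod n) a) +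
      Pi.single (-1 + k) (β * autPow σ (-1 : ZMod n) (b * u)) +
      Pi.single (-1 - k) (β * autPow σ (-1 : ZMod n) (b * v)) : ZMod n → K) =
    Pi.single 0 c + Pi.single k (d * u) + Pi.single (-k) (d * v) := by
  refine skewEval_injective hinj (funext fun x => ?_)
  have := h x
  simp only [skewEval_pairCoeff] at this
  simp only [skewEval_add, skewEval_single, sub_eq_add_neg, autPow_add hσ, map_mul, map_add,
    autPow_zero] at this ⊢
  linear_combination this

theorem autNorm_five (σ : K ≃+* K) [NeZero 5] (x : K) : autNorm 5 σ x =
    x * autPow σ (1 : ZMod 5) x * autPow σ (2 : ZMod 5) x * autPow σ (-2 : ZMod 5) x *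
      autPow σ (-1 : ZMod 5) x := by
  have := Fin.prod_univ_five (fun i : Fin 5 => autPow (n := 5) σ i x)
  rw [autNorm]
  refine this.trans ?_
  rw [show autPow (n := 5) σ (0 : Fin 5) x = x from autPow_zero (n := 5) x]
  rfl

/-- For `k = 2` modulo `5` the exponents overlap so that the coefficients at `1, 2, 3, 4` give four
equations. Eliminating `α`, `β` and `d` leaves two relations between conjugates of `u`, `v` and `y =
a / b`; one conjugate of each combines to the equality of norms. This excludes the exceptional case
for scattered maps. -/
theorem autNorm_eq_of_comp_five [NeZero 5] {σ : K ≃+* K} (hσ : σ ^ 5 = 1)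
    {α β a b c d u v : K} (hα : α ≠ 0) (hβ : β ≠ 0) (hb : b ≠ 0) (hv : v ≠ 0)
    (h : (Pi.single 1 (α * autPow σ (1 : ZMod 5) a) +
      Pi.single (1 + 2) (α * autPow σ (1 : ZMod 5) (b * u)) +
      Pi.single (1 - 2) (α * autPow σ (1 : ZMod 5) (b * v)) +
      Pi.single (-1) (β * autPow σ (-1 : ZMod 5) a) +
      Pi.single (-1 + 2) (β * autPow σ (-1 : ZMod 5) (b * u)) +
      Pi.single (-1 - 2) (β * autPow σ (-1 : ZMod 5) (b * v)) : ZMod 5 → K) =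
    Pi.single 0 c + Pi.single 2 (d * u) + Pi.single (-2) (d * v)) :
    autNorm 5 σ u = autNorm 5 σ v := by
  have e1 := congrFun h 1
  have e2 := congrFun h 2
  have e3 := congrFun h 3
  have e4 := congrFun h 4
  simp only [Pi.add_apply, Pi.single_apply] at e1 e2 e3 e4
  simp +decide only [if_true, if_false, add_zero, zero_add] at e1 e2 e3 e4
  have hs : ∀ (i : ZMod 5) {x : K}, x ≠ 0 → autPow σ i x ≠ 0 := fun i x hx => autPow_ne_zero hx i
  set y := a / b with hy
  have ha : a = y * b := (div_mul_cancel₀ a hb).symm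
  have ei : u * autPow σ (1 : ZMod 5) u * autPow σ (-1 : ZMod 5) u =
      -(autPow σ (-1 : ZMod 5) v * v * autPow σ (1 : ZMod 5) y) := by
    refine mul_left_cancel₀ (mul_ne_zero (mul_ne_zero hα hβ) (mul_ne_zero (hs 1 hb) (hs (-1) hb))) ?_
    rw [ha] at e1
    simp only [map_mul] at e1 e2 e3
    linear_combination (u * β * autPow σ (-1 : ZMod 5) b * autPow σ (-1 : ZMod 5) u) * e3 -
      (v * β * autPow σ (-1 : ZMod 5) b * autPow σ (-1 : ZMod 5) u) * e2 +
      (β * autPow σ (-1 : ZMod 5) b * v * autPow σ (-1 : ZMod 5) v) * e1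
  have eii : v * autPow σ (1 : ZMod 5) v * autPow σ (-1 : ZMod 5) v =
      -(autPow σ (-1 : ZMod 5) y * u * autPow σ (1 : ZMod 5) u) := by
    refine mul_left_cancel₀ (mul_ne_zero (mul_ne_zero hα hβ) (mul_ne_zero (hs 1 hb) (hs (-1) hb))) ?_
    rw [ha] at e4
    simp only [map_mul] at e2 e3 e4
    linear_combination (α * autPow σ (1 : ZMod 5) b * autPow σ (1 : ZMod 5) v) * (v * e2 - u * e3) +
      (α * autPow σ (1 : ZMod 5) b * autPow σ (1 : ZMod 5) u * u) * e4
  have hy0 : y ≠ 0 := by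
    intro h0
    rw [ha, h0, zero_mul, map_zero, mul_zero, add_zero] at e4
    exact mul_ne_zero hα (hs 1 (mul_ne_zero hb hv)) e4
  have ei' := congrArg (autPow σ (-1 : ZMod 5)) ei
  have eii' := congrArg (autPow σ (1 : ZMod 5)) eii
  simp only [map_mul, map_neg, ← autPow_add hσ] at ei' eii'
  rw [show (-1 + 1 : ZMod 5) = 0 by decide, show (-1 + -1 : ZMod 5) = -2 by decide,
    autPow_zero, autPow_zero] at ei'
  rw [show (1 + -1 : ZMod 5) = 0 by decide, show (1 + 1 : ZMod 5) = 2 by decide,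
    autPow_zero, autPow_zero] at eii'
  refine mul_left_cancel₀ hy0 ?_
  rw [autNorm_five, autNorm_five]
  linear_combination (y * autPow σ (1 : ZMod 5) u * autPow σ (2 : ZMod 5) u) * ei' -
    (autPow σ (-2 : ZMod 5) v * autPow σ (-1 : ZMod 5) v * y) * eii'

omit [NeZero n] in
/-- If `(α σ + β σ⁻¹) ∘ (a + b f) = c + d f` with `f = u σ + v σ⁻¹`, then `β / α` is determined
by `v / u` up to natural factors. -/
theorem ratio_of_comp_one (hn : 4 ≤ n)
    {α β a b c d u v : K} (hα : α ≠ 0) (hu : u ≠ 0) (hdet : a * d - b * c ≠ 0)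
    (h : (Pi.single 1 (α * autPow σ (1 : ZMod n) a) +
      Pi.single (1 + 1) (α * autPow σ (1 : ZMod n) (b * u)) +
      Pi.single (1 - 1) (α * autPow σ (1 : ZMod n) (b * v)) +
      Pi.single (-1) (β * autPow σ (-1 : ZMod n) a) +
      Pi.single (-1 + 1) (β * autPow σ (-1 : ZMod n) (b * u)) +
      Pi.single (-1 - 1) (β * autPow σ (-1 : ZMod n) (b * v)) : ZMod n → K) =
    Pi.single 0 c + Pi.single 1 (d * u) + Pi.single (-1) (d * v)) :
    (∃ y : K, y ≠ 0 ∧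
      β * autPow σ (-1 : ZMod n) y * u = α * autPow σ (1 : ZMod n) y * v) ∨
    (n = 4 ∧ ∃ y : K, y ≠ 0 ∧
      α * autPow σ (1 : ZMod n) (y * u) = - (β * autPow σ (-1 : ZMod n) (y * v))) := by
  obtain ⟨z1, z2, z3⟩ := natCast_ne_zero_of_four_le hn
  have e1 := congrFun h 1
  have e2 := congrFun h (1 + 1)
  have e3 := congrFun h (-1)
  have w1 : (1 : ZMod n) ≠ -1 := fun h => z2 (by linear_combination h)
  have w2 : (1 + 1 : ZMod n) ≠ 0 := fun h => z2 (by linear_combination h)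
  have w4 : (1 + 1 : ZMod n) ≠ -1 := fun h => z3 (by linear_combination h)
  have w5 : (-1 - 1 : ZMod n) ≠ 1 := fun h => z3 (by linear_combination -h)
  have w6 : (1 + 1 : ZMod n) ≠ 1 := fun h => z1 (by linear_combination h)
  have w7 : (-1 - 1 : ZMod n) ≠ -1 := fun h => z1 (by linear_combination -h)
  simp [Pi.single_apply, w1, w1.symm, w2, w4, w6, w4.symm, w5.symm,
    w6.symm, w7.symm, z1] at e1 e2 e3
  rcases eq_or_ne b 0 with rfl | hb
  · left
    have ha : a ≠ 0 := by rintro rfl; simp at hdet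
    refine ⟨a, ha, ?_⟩
    linear_combination u * e3 - v * e1
  · right
    -- With `b ≠ 0` the coefficient `α σ(b u)` at exponent `2` can only be cancelled by the one at
    -- exponent `-2`, so `4 = 0` in `ZMod n`.
    have h4 : (1 + 1 : ZMod n) = -1 - 1 := by
      by_contra h0
      rw [if_neg h0, add_zero] at e2
      simp [hα, hb, hu] at e2
    have hn4 : n = 4 := by
      have h' : ((4 : ℕ) : ZMod n) = 0 := by push_cast; linear_combination h4
      rw [ZMod.natCast_eq_zero_iff] at h'
      exact le_antisymm (Nat.le_of_dvd (by norm_num) h') hn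
    refine ⟨hn4, b, hb, ?_⟩
    rw [if_pos h4] at e2
    rw [map_mul, map_mul]
    linear_combination e2
end
end LunardonPolverino

/-! ### Scatteredness and projectivities between slope sets -/

namespace LunardonPolverino
open Matrix Finset Polynomial

section
variable {K : Type*} [Field K] {n : ℕ} [NeZero n] {σ : K ≃+* K} {q : ℕ} {E : ZMod n → ℕ}

/-- An element fixed by `σ` is fixed by all its powers. The exponents `E` exhaust `0, …, n - 1`, so
one of these powers is `x ↦ x ^ q`. -/
theorem pow_eq_one_of_autPow_one_fixed (hσ : σ ^ n = 1) (hn : 2 ≤ n)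
    (hE : Function.Injective E)
    (hEn : ∀ i, E i < n) (hEσ : ∀ i x, autPow σ i x = x ^ q ^ E i) (hq : 1 ≤ q) {c : K}
    (hc0 : c ≠ 0) (hc : autPow σ (1 : ZMod n) c = c) : c ^ (q - 1) = 1 := by
  have hfix : ∀ j : ℕ, autPow σ (j : ZMod n) c = c := by
    intro j
    induction j with
    | zero => rw [Nat.cast_zero, autPow_zero]
    | succ j ih => rw [Nat.cast_succ, autPow_add hσ, hc, ih]
  have hsurj : Function.Surjective (fun i => (⟨E i, hEn i⟩ : Fin n)) := by
    refine ((Fintype.bijective_iff_injective_and_card _).2 ⟨fun i j h => hE ?_, ?_⟩).2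
    · exact congrArg Fin.val h
    · rw [ZMod.card, Fintype.card_fin]
  obtain ⟨i, hi⟩ := hsurj ⟨1, by omega⟩
  have hi : E i = 1 := congrArg Fin.val hi
  have h := hEσ i c
  rw [hi, pow_one, ← ZMod.natCast_rightInverse i, hfix] at h
  refine mul_right_cancel₀ hc0 ?_
  rw [← pow_succ, Nat.sub_add_cancel hq, one_mul, ← h]

/-- The map `u σ + v σ⁻¹` with `N u ≠ N v` is scattered. -/
theorem div_fixed_of_slope_eq (hσ : σ ^ n = 1) {u v m x y : K} (hN : autNorm n σ u ≠ autNorm n σ v)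
    (hx : skewEval σ (pairCoeff (1 : ZMod n) u v) x = m * x)
    (hy : skewEval σ (pairCoeff (1 : ZMod n) u v) y = m * y) :
    x * autPow σ (1 : ZMod n) y = y * autPow σ (1 : ZMod n) x := by
  rw [skewEval_pairCoeff] at hx hy
  by_contra hW
  -- Eliminating `m` gives `u W = v σ⁻¹(W)`. For `W ≠ 0` the norms of `u` and `v` would agree.
  set W := x * autPow σ (1 : ZMod n) y - y * autPow σ (1 : ZMod n) x with hWdef
  have hW0 : W ≠ 0 := sub_ne_zero.2 hW
  have h1 : autPow σ (-1 : ZMod n) W = autPow σ (-1 : ZMod n) x * y - autPow σ (-1 : ZMod n) y * x := by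
    rw [hWdef, map_sub, map_mul, map_mul, ← autPow_add hσ, ← autPow_add hσ, neg_add_cancel,
      autPow_zero, autPow_zero]
  have h2 : u * W = v * autPow σ (-1 : ZMod n) W := by
    rw [h1, hWdef]
    linear_combination x * hy - y * hx
  have h3 := congrArg (autNorm n σ) h2
  rw [autNorm_mul, autNorm_mul, autNorm_autPow hσ] at h3
  exact hN (mul_right_cancel₀ (autNorm_ne_zero hW0) h3)

/-- Two nonzero arguments with the same slope have a ratio fixed by `σ`, a root of `X ^ (q - 1) =
1`. So each slope arises from at most `q - 1` of the `q ^ n - 1` nonzero arguments. -/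
theorem le_ncard_slopes [Finite K] (hcard : Nat.card K = q ^ n) (hσ : σ ^ n = 1) (hn : 2 ≤ n)
    (hq : 2 ≤ q) (hE : Function.Injective E) (hEn : ∀ i, E i < n)
    (hEσ : ∀ i x, autPow σ i x = x ^ q ^ E i) {u v : K}
    (hN : autNorm n σ u ≠ autNorm n σ v) :
    (q ^ n - 1) / (q - 1) ≤ (slopes (skewEval σ (pairCoeff (1 : ZMod n) u v))).ncard := by
  classical
  have := Fintype.ofFinite K
  set f := skewEval σ (pairCoeff (1 : ZMod n) u v) with hf
  set s : Finset K := Finset.univ.erase 0 with hs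
  have hscard : s.card = q ^ n - 1 := by
    rw [hs, Finset.card_erase_of_mem (Finset.mem_univ _), Finset.card_univ,
      ← Nat.card_eq_fintype_card, hcard]
  have himg : slopes f = (s.image fun x => f x / x : Finset K) := by
    ext m
    simp only [slopes, Set.mem_ofPred_eq, Finset.coe_image, Set.mem_image, Finset.mem_coe, hs,
      Finset.mem_erase, Finset.mem_univ, and_true]
    refine exists_congr fun x => and_congr_right fun hx => ?_
    rw [div_eq_iff hx]
  rw [himg, Set.ncard_coe_finset]
  refine Nat.div_le_of_le_mul ?_
  rw [← hscard]
  refine Finset.card_le_mul_card_image s (q - 1) fun m hm => ?_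
  obtain ⟨x, hx, rfl⟩ := Finset.mem_image.1 hm
  have hx0 : x ≠ 0 := Finset.ne_of_mem_erase hx
  refine le_trans ?_ ((Multiset.toFinset_card_le _).trans (card_nthRoots (q - 1) (1 : K)))
  refine Finset.card_le_card_of_injOn (fun y => y / x) ?_ ?_
  · intro y hy
    have hy := Finset.mem_filter.1 hy
    have hy0 : y ≠ 0 := Finset.ne_of_mem_erase hy.1
    have hW := div_fixed_of_slope_eq hσ hN (m := f x / x) (x := x) (y := y)
      (by rw [← hf]; field_simp) (by rw [← hf, ← hy.2]; field_simp)
    rw [Finset.mem_coe, Multiset.mem_toFinset, mem_nthRoots (by omega)]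
    refine pow_eq_one_of_autPow_one_fixed hσ hn hE hEn hEσ (by omega) (div_ne_zero hy0 hx0) ?_
    rw [map_div₀, div_eq_div_iff (autPow_ne_zero hx0 _) hx0]
    linear_combination hW
  · intro y _ z _ hyz
    exact (div_left_inj' hx0).1 hyz

omit [NeZero n] in
theorem pairCoeff_neg (k : ZMod n) (u v : K) : pairCoeff (-k) u v = pairCoeff k v u := by
  rw [pairCoeff, pairCoeff, neg_neg, add_comm]

/-- If a projectivity maps the slopes of `u σ^k + v σ^(-k)` to those of `σ + θ σ⁻¹`, then
`k = ± 1` and the coefficients are related. -/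
theorem ratio_of_slopes_image [Finite K] (hn : 4 ≤ n) (hσ : σ ^ n = 1)
    (hinj : Function.Injective (autPow σ : ZMod n → K ≃+* K))
    (hq : 2 ≤ q) (hE : Function.Injective E) (hEn : ∀ i, E i < n)
    (hEσ : ∀ i x, autPow σ i x = x ^ q ^ E i) {θ : K} (hθ : θ ≠ 0)
    (hQ : (q ^ n - 1) / (q - 1) ≤ (slopes (skewEval σ (pairCoeff (1 : ZMod n) 1 θ))).ncard)
    {k l : ZMod n} (hkl : k * l = 1) {a b c d u v : K} (hu : u ≠ 0) (hv : v ≠ 0)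
    (hN : autNorm n σ u ≠ autNorm n σ v) (hdet : a * d - b * c ≠ 0)
    (hden : ∀ m ∈ slopes (skewEval σ (pairCoeff k u v)), a + b * m ≠ 0)
    (himg : slopes (skewEval σ (pairCoeff (1 : ZMod n) 1 θ)) =
      (fun m => (c + d * m) / (a + b * m)) '' slopes (skewEval σ (pairCoeff k u v))) :
    ∃ α β : K, α ≠ 0 ∧ β ≠ 0 ∧ α * autPow σ (1 : ZMod n) β = autPow σ (1 : ZMod n) θ ∧
      (autNorm n σ α = 1 ∨ autNorm n σ α = autNorm n σ θ) ∧
      ∃ u' v' : K, (k = 1 ∧ u' = u ∧ v' = v ∨ k = -1 ∧ u' = v ∧ v' = u) ∧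
      ((∃ y : K, y ≠ 0 ∧
        β * autPow σ (-1 : ZMod n) y * u' = α * autPow σ (1 : ZMod n) y * v') ∨
      (n = 4 ∧ ∃ y : K, y ≠ 0 ∧
        α * autPow σ (1 : ZMod n) (y * u') = - (β * autPow σ (-1 : ZMod n) (y * v')))) := by
  set f := skewEval σ (pairCoeff k u v) with hf
  have hA : ∀ a b x, skewEval σ (Pi.single 0 a + b • pairCoeff k u v) x = a * x + b * f x := by
    intro a b x
    rw [skewEval_add, skewEval_single, autPow_zero, hf]
    simp only [skewEval, Pi.smul_apply, smul_eq_mul, Finset.mul_sum, mul_assoc]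
  have hfadd : ∀ x y, f (x - y) = f x - f y := by
    intro x y
    simp only [hf, skewEval_pairCoeff, map_sub]
    ring
  have hker : ∀ x, x ≠ 0 → a * x + b * f x ≠ 0 := by
    intro x hx h0
    refine hden (f x / x) ⟨x, hx, by field_simp⟩ ?_
    field_simp
    linear_combination h0
  have hFinj : Function.Injective (skewEval σ (Pi.single 0 a + b • pairCoeff k u v)) := by
    intro x y hxy
    rw [hA, hA] at hxy
    by_contra hne
    refine hker (x - y) (sub_ne_zero.2 hne) ?_
    rw [hfadd]
    linear_combination hxy
  -- `H = (c + d f) ∘ (a + b f)⁻¹`: its slopes are the images of the slopes of `f` under the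
  -- projectivity.
  obtain ⟨H, hH⟩ := exists_skewEval_comp_eq hσ _ (Pi.single 0 c + d • pairCoeff k u v) hFinj
  simp only [hA] at hH
  have hslopes : slopes (skewEval σ H) = slopes (skewEval σ (pairCoeff (1 : ZMod n) 1 θ)) := by
    rw [himg]
    have hval : ∀ x, x ≠ 0 → ∀ m, f x = m * x →
        skewEval σ H (a * x + b * f x) = (c + d * m) / (a + b * m) * (a * x + b * f x) := by
      intro x hx m hm
      have h0 := hden m ⟨x, hx, hm⟩
      rw [hH, hm, div_mul_eq_mul_div, eq_div_iff h0]
      ring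
    ext m
    constructor
    · rintro ⟨y, hy, h⟩
      obtain ⟨x, rfl⟩ := (Finite.injective_iff_surjective.1 hFinj) y
      rw [hA] at hy h
      have hx : x ≠ 0 := by
        rintro rfl
        apply hy
        have := hfadd 0 0
        rw [sub_self, sub_self] at this
        rw [this, mul_zero, mul_zero, add_zero]
      have hm : f x = f x / x * x := by field_simp
      refine ⟨f x / x, ⟨x, hx, hm⟩, ?_⟩
      rw [hval x hx _ hm] at h
      exact mul_right_cancel₀ hy h
    · rintro ⟨m', ⟨x, hx, hm⟩, rfl⟩
      exact ⟨a * x + b * f x, hker x hx, hval x hx m' hm⟩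
  obtain ⟨α, β, rfl, hαβ, hNα⟩ := eq_pairCoeff_of_minors_eq hn hσ hθ
    (minors_eq_of_slopes_eq hσ hq hE hEn hEσ hslopes hQ)
  have hθ' := autPow_ne_zero (σ := σ) hθ (1 : ZMod n)
  have hα : α ≠ 0 := by rintro rfl; exact hθ' (by rw [← hαβ, zero_mul])
  have hβ : β ≠ 0 := by rintro rfl; exact hθ' (by rw [← hαβ, map_zero, mul_zero])
  refine ⟨α, β, hα, hβ, hαβ, hNα, ?_⟩
  -- Exchanging `u` and `v` replaces `k` by `-k`, so the negative cases reduce to the positive ones.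
  have hneg : ∀ (k' : ZMod n), k = -k' → ∀ x, skewEval σ (pairCoeff (1 : ZMod n) α β)
      (a * x + b * skewEval σ (pairCoeff k' v u) x) =
        c * x + d * skewEval σ (pairCoeff k' v u) x := by
    rintro k' rfl x
    have h := hH x
    rw [hf, pairCoeff_neg] at h
    exact h
  have hk : k = 1 ∨ k = -1 := by
    rcases eq_or_ne b 0 with rfl | hb
    · have ha : a ≠ 0 := by rintro rfl; simp at hdet
      obtain ⟨z1, z2, z3⟩ := natCast_ne_zero_of_four_le hn
      have e := congrFun (pairCoeff_comp_coeff hσ hinj hH) 1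
      simp only [zero_mul, map_zero, mul_zero, Pi.single_zero, add_zero] at e
      simp only [Pi.add_apply, Pi.single_apply] at e
      rw [if_pos trivial, if_neg (fun h => z2 (by linear_combination h)), if_neg z1] at e
      by_contra hk
      rw [not_or] at hk
      rw [if_neg (fun h => hk.1 h.symm), if_neg (fun h => hk.2 (by linear_combination h))] at e
      simp only [add_zero] at e
      exact mul_ne_zero hα (autPow_ne_zero ha _) e
    · have hb' : ∀ {x : K}, x ≠ 0 → α * autPow σ (1 : ZMod n) (b * x) ≠ 0 := fun hx =>
        mul_ne_zero hα (autPow_ne_zero (mul_ne_zero hb hx) _)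
      rcases single_support_cases hn hkl (hb' hu) (hb' hv) (pairCoeff_comp_coeff hσ hinj hH) with
        h | h | ⟨rfl, h | h⟩
      · exact Or.inl h
      · exact Or.inr h
      · subst h
        exact (hN (autNorm_eq_of_comp_five hσ hα hβ hb hv
          (pairCoeff_comp_coeff hσ hinj hH))).elim
      · exact (hN (autNorm_eq_of_comp_five hσ hα hβ hb hu
          (pairCoeff_comp_coeff hσ hinj (hneg 2 h))).symm).elim
  rcases hk with rfl | hk
  · exact ⟨u, v, Or.inl ⟨rfl, rfl, rfl⟩,
      ratio_of_comp_one hn hα hu hdet (pairCoeff_comp_coeff hσ hinj hH)⟩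
  · exact ⟨v, u, Or.inr ⟨hk, rfl, rfl⟩,
      ratio_of_comp_one hn hα hv hdet (pairCoeff_comp_coeff hσ hinj (hneg 1 hk))⟩

/-- The adjoint map has the same slopes. -/
theorem slopes_pairCoeff_adjoint [Finite K] (hcard : Nat.card K = q ^ n) (hσ : σ ^ n = 1)
    (hn : 2 ≤ n) (hq : 2 ≤ q) (hE : Function.Injective E) (hEn : ∀ i, E i < n)
    (hEσ : ∀ i x, autPow σ i x = x ^ q ^ E i) {u v : K}
    (hN : autNorm n σ u ≠ autNorm n σ v) :
    slopes (skewEval σ (pairCoeff (1 : ZMod n) u v)) =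
      slopes (skewEval σ (pairCoeff (1 : ZMod n) (autPow σ (1 : ZMod n) v)
        (autPow σ (-1 : ZMod n) u))) := by
  have hN' : autNorm n σ (autPow σ (1 : ZMod n) v) ≠ autNorm n σ (autPow σ (-1 : ZMod n) u) := by
    rw [autNorm_autPow hσ, autNorm_autPow hσ]
    exact hN.symm
  ext m
  rw [mem_slopes_iff_det hσ hq hE hEn hEσ (le_ncard_slopes hcard hσ hn hq hE hEn hEσ hN),
    mem_slopes_iff_det hσ hq hE hEn hEσ (le_ncard_slopes hcard hσ hn hq hE hEn hEσ hN'),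
    ← det_transpose, transpose_add, diagonal_transpose]
  -- The transpose of a Dickson matrix is the Dickson matrix of the adjoint. Both maps have enough
  -- slopes for slopes to be detected by a determinant, which transposition preserves.
  have hT : (dickson σ (pairCoeff (1 : ZMod n) u v))ᵀ =
      dickson σ (pairCoeff (1 : ZMod n) (autPow σ (1 : ZMod n) v) (autPow σ (-1 : ZMod n) u)) := by
    ext i j
    simp only [transpose_apply, dickson, of_apply, pairCoeff, Pi.add_apply, Pi.single_apply]
    have h1 : i - j = 1 ↔ j - i = -1 := ⟨fun h => by linear_combination -h,
      fun h => by linear_combination -h⟩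
    have h2 : i - j = -1 ↔ j - i = 1 := ⟨fun h => by linear_combination -h,
      fun h => by linear_combination -h⟩
    rw [map_add, map_add, add_comm]
    congr 1
    · simp only [h2]
      split_ifs with h
      · rw [← autPow_add hσ]
        congr 2
        linear_combination h
      · simp
    · simp only [h1]
      split_ifs with h
      · rw [← autPow_add hσ]
        congr 2
        linear_combination h
      · simp
  rw [hT]
end
end LunardonPolverino

/-! ### From point sets of the projective line to slope sets -/

namespace LunardonPolverino

section
variable {K : Type u} [Field K]

theorem vec_one_ne_zero (m : K) : (![1, m] : Fin 2 → K) ≠ 0 := fun h => by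
  simpa using congrFun h 0

/-- The point `⟨(1, m)⟩` of the projective line. -/
def slopePoint (m : K) : ProjLine K := Projectivization.mk K ![1, m] (vec_one_ne_zero m)

theorem mk_eq_slopePoint_iff {v : Fin 2 → K} (hv : v ≠ 0) (m : K) :
    Projectivization.mk K v hv = slopePoint m ↔ v 0 ≠ 0 ∧ v 1 = m * v 0 := by
  rw [slopePoint, Projectivization.mk_eq_mk_iff']
  constructor
  · rintro ⟨a, rfl⟩
    have ha : a ≠ 0 := by rintro rfl; simp at hv
    simp [ha, mul_comm]
  · rintro ⟨h0, h1⟩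
    refine ⟨v 0, ?_⟩
    ext i
    fin_cases i
    · simp
    · simp [h1, mul_comm]

theorem linearSetOf_eq_image (f : K → K) : linearSetOf K f = slopePoint '' slopes f := by
  ext P
  constructor
  · rintro ⟨x, h, hx, rfl⟩
    refine ⟨f x / x, ⟨x, hx, by field_simp⟩, ?_⟩
    rw [eq_comm, mk_eq_slopePoint_iff]
    exact ⟨hx, by simp [hx]⟩
  · rintro ⟨m, ⟨x, hx, h⟩, rfl⟩
    have hv : (![x, f x] : Fin 2 → K) ≠ 0 := fun h0 => hx (by simpa using congrFun h0 0)
    refine ⟨x, hv, hx, ?_⟩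
    rw [eq_comm, mk_eq_slopePoint_iff]
    exact ⟨hx, h⟩

theorem pGammaLEquiv_of_slopes_eq {f g : K → K} (τ : K ≃+* K) {d : K} (hd : d ≠ 0)
    (h : slopes g = (fun m => d * τ m) '' slopes f) :
    PGammaLEquiv K (linearSetOf K f) (linearSetOf K g) := by
  let G : (Fin 2 → K) →ₛₗ[(τ : K →+* K)] (Fin 2 → K) :=
    { toFun := fun v => ![τ (v 0), d * τ (v 1)]
      map_add' := fun v w => by
        ext i; fin_cases i <;> simp [mul_add]
      map_smul' := fun a v => by
        ext i; fin_cases i <;> simp [mul_left_comm] }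
  have hG : Function.Bijective G := by
    constructor
    · intro v w hvw
      have h0 : τ (v 0) = τ (w 0) := congrFun hvw 0
      have h1 : d * τ (v 1) = d * τ (w 1) := congrFun hvw 1
      ext i; fin_cases i
      · exact τ.injective h0
      · exact τ.injective (mul_left_cancel₀ hd h1)
    · intro w
      refine ⟨![τ.symm (w 0), τ.symm (d⁻¹ * w 1)], ?_⟩
      ext i; fin_cases i
      · simp [G]
      · simp [G, hd]
  refine ⟨τ, G, hG, ?_⟩
  rw [linearSetOf_eq_image, linearSetOf_eq_image, h, Set.image_image, Set.image_image]
  refine Set.image_congr fun m _ => ?_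
  rw [slopePoint, Projectivization.map_mk, mk_eq_slopePoint_iff]
  simp [G]

theorem exists_projectivity_of_pGammaLEquiv {f g : K → K}
    (h : PGammaLEquiv K (linearSetOf K f) (linearSetOf K g)) :
    ∃ (τ : K ≃+* K) (a b c d : K), a * d - b * c ≠ 0 ∧ (∀ m ∈ slopes f, a + b * τ m ≠ 0) ∧
      slopes g = (fun m => (c + d * τ m) / (a + b * τ m)) '' slopes f := by
  obtain ⟨τ, G, hG, h⟩ := h
  rw [linearSetOf_eq_image, linearSetOf_eq_image, Set.image_image] at h
  have hval : ∀ x y : K, G ![x, y] = τ x • G ![1, 0] + τ y • G ![0, 1] := by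
    intro x y
    have : (![x, y] : Fin 2 → K) = x • ![1, 0] + y • ![0, 1] := by
      ext i; fin_cases i <;> simp
    rw [this, map_add, LinearMap.map_smulₛₗ, LinearMap.map_smulₛₗ]
    rfl
  set a := G ![1, 0] 0 with ha
  set c := G ![1, 0] 1 with hc
  set b := G ![0, 1] 0 with hb
  set d := G ![0, 1] 1 with hd
  have hval0 : ∀ x y : K, G ![x, y] 0 = τ x * a + τ y * b := fun x y => by rw [hval]; rfl
  have hval1 : ∀ x y : K, G ![x, y] 1 = τ x * c + τ y * d := fun x y => by rw [hval]; rfl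
  have hker : ∀ x y : K, x * a + y * b = 0 → x * c + y * d = 0 → x = 0 ∧ y = 0 := by
    intro x y h0 h1
    have hz : G ![τ.symm x, τ.symm y] = G 0 := by
      rw [map_zero]
      ext i
      fin_cases i
      · exact (hval0 _ _).trans (by simpa using h0)
      · exact (hval1 _ _).trans (by simpa using h1)
    have hz := hG.injective hz
    exact ⟨by simpa using congrFun hz 0, by simpa using congrFun hz 1⟩
  have hpt : ∀ m, Projectivization.map G hG.injective (slopePoint m) =
      Projectivization.mk K (G ![1, m])
        (by rw [← map_zero G]; exact hG.injective.ne (vec_one_ne_zero m)) := fun m => rfl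
  have hmem : ∀ m m', Projectivization.map G hG.injective (slopePoint m) = slopePoint m' ↔
      a + b * τ m ≠ 0 ∧ m' = (c + d * τ m) / (a + b * τ m) := by
    intro m m'
    rw [hpt, mk_eq_slopePoint_iff, hval0, hval1, map_one, one_mul, one_mul, mul_comm (τ m) b,
      mul_comm (τ m) d]
    refine and_congr_right fun h0 => ?_
    rw [eq_div_iff h0, eq_comm]
  refine ⟨τ, a, b, c, d, fun hdet => ?_, fun m hm => ?_, ?_⟩
  -- A vanishing determinant puts `(d, -c)` and `(b, -a)` in the kernel of an injective map. All
  -- four entries are then zero and `(1, 0)` lies in the kernel too.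
  · have h1 := hker d (-c) (by linear_combination hdet) (by ring)
    have h2 := hker b (-a) (by ring) (by linear_combination -hdet)
    have h3 := hker 1 0 (by linear_combination -h2.2) (by linear_combination -h1.2)
    exact one_ne_zero h3.1
  · have : Projectivization.map G hG.injective (slopePoint m) ∈ slopePoint '' slopes g := by
      rw [← h]; exact ⟨m, hm, rfl⟩
    obtain ⟨m', -, hm'⟩ := this
    exact ((hmem m m').1 hm'.symm).1
  · ext m'
    constructor
    · intro hm'
      have : slopePoint m' ∈ (fun x => Projectivization.map G hG.injective (slopePoint x)) ''
          slopes f := by rw [h]; exact ⟨m', hm', rfl⟩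
      obtain ⟨m, hm, hmm⟩ := this
      exact ⟨m, hm, ((hmem m m').1 hmm).2.symm⟩
    · rintro ⟨m, hm, rfl⟩
      have : Projectivization.map G hG.injective (slopePoint m) ∈ slopePoint '' slopes g := by
        rw [← h]; exact ⟨m, hm, rfl⟩
      obtain ⟨m', hm', hmm⟩ := this
      change (c + d * τ m) / (a + b * τ m) ∈ slopes g
      rw [← ((hmem m m').1 hmm.symm).2]
      exact hm'

theorem exists_pow_of_ringEquiv [Finite K] (p : ℕ) [Fact p.Prime] [CharP K p] (τ : K ≃+* K) :
    ∃ j : ℕ, ∀ x, τ x = x ^ p ^ j := by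
  have := Fintype.ofFinite K
  let := ZMod.algebra K p
  obtain ⟨j, hj⟩ := (FiniteField.bijective_frobeniusAlgEquivOfAlgebraic_pow (ZMod p) K).2
    (AlgEquiv.ofRingEquiv (f := τ) fun x => by
      exact RingHom.congr_fun (Subsingleton.elim
        ((τ : K →+* K).comp (algebraMap (ZMod p) K)) (algebraMap (ZMod p) K)) x)
  refine ⟨j, fun x => ?_⟩
  have := DFunLike.congr_fun hj x
  rw [AlgEquiv.coe_pow, FiniteField.coe_frobeniusAlgEquivOfAlgebraic_iterate, ZMod.card] at this
  exact this.symm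
end
end LunardonPolverino

/-! ### The automorphisms `x ↦ x ^ (q ^ t)` of the finite field -/

namespace LunardonPolverino

/-- The map `x ^ (q ^ s) + δ x ^ (q ^ (n - s))`. -/
def lpFun {K : Type*} [Field K] (q n s : ℕ) (δ x : K) : K := x ^ (q ^ s) + δ * x ^ (q ^ (n - s))

section
variable {K : Type u} [Field K] [Finite K] {p r n t : ℕ} [Fact p.Prime] [CharP K p]

omit [Fact p.Prime] [CharP K p] in
theorem pow_q_pow_mod (hcard : Nat.card K = (p ^ r) ^ n) (x : K) (a : ℕ) :
    x ^ (p ^ r) ^ a = x ^ (p ^ r) ^ (a % n) := by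
  have := Fintype.ofFinite K
  conv_lhs => rw [← Nat.div_add_mod a n, pow_add, pow_mul (p ^ r) n, ← hcard,
    Nat.card_eq_fintype_card, pow_mul, FiniteField.pow_card_pow]

omit [Fact p.Prime] [CharP K p] in
theorem pow_q_pow_congr (hcard : Nat.card K = (p ^ r) ^ n) (x : K) {a b : ℕ}
    (h : (a : ZMod n) = b) : x ^ (p ^ r) ^ a = x ^ (p ^ r) ^ b := by
  rw [pow_q_pow_mod hcard, pow_q_pow_mod hcard x b, (ZMod.natCast_eq_natCast_iff' a b n).1 h]

omit [Fact p.Prime] [CharP K p] in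
theorem exists_generator (hcard : Nat.card K = (p ^ r) ^ n) :
    ∃ γ : Kˣ, (∀ x, x ∈ Subgroup.zpowers γ) ∧ orderOf γ = (p ^ r) ^ n - 1 := by
  obtain ⟨γ, hγ⟩ := IsCyclic.exists_generator (α := Kˣ)
  refine ⟨γ, hγ, ?_⟩
  rw [orderOf_eq_card_of_forall_mem_zpowers hγ, Nat.card_units, hcard]

theorem two_le_q (hr : 1 ≤ r) : 2 ≤ p ^ r :=
  (Nat.Prime.two_le Fact.out).trans (Nat.le_self_pow (by omega) p)

variable (K p r t) in
/-- The automorphism `x ↦ x ^ (q ^ t)` for `q = p ^ r`. -/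
noncomputable def qFrob : K ≃+* K := iterateFrobeniusEquiv K p (r * t)

theorem qFrob_pow_apply (j : ℕ) (x : K) : (qFrob K p r t ^ j) x = x ^ (p ^ r) ^ (t * j) := by
  rw [qFrob, iterateFrobeniusEquiv_eq_pow, ← pow_mul, ← iterateFrobeniusEquiv_eq_pow,
    iterateFrobeniusEquiv_def, mul_assoc, pow_mul p]

theorem qFrob_pow_eq_one (hcard : Nat.card K = (p ^ r) ^ n) : qFrob K p r t ^ n = 1 := by
  ext x
  rw [qFrob_pow_apply, pow_q_pow_congr hcard x (b := 0) (by simp)]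
  simp

theorem autPow_qFrob [NeZero n] (hcard : Nat.card K = (p ^ r) ^ n) {k : ZMod n} {j : ℕ}
    (h : (j : ZMod n) = t * k) (x : K) : autPow (qFrob K p r t) k x = x ^ (p ^ r) ^ j := by
  rw [autPow, qFrob_pow_apply]
  refine pow_q_pow_congr hcard x ?_
  rw [h, Nat.cast_mul, ZMod.natCast_rightInverse k]

/-- The exponent of `q` in the power `σ ^ i` of `σ = x ^ (q ^ t)`. -/
def qExp (n t : ℕ) (i : ZMod n) : ℕ := (t * i.val) % n

theorem qExp_injective {n t : ℕ} [NeZero n] (ht : Nat.gcd t n = 1) :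
    Function.Injective (qExp n t) := by
  intro i j h
  have h' : t * i.val ≡ t * j.val [MOD n] := h
  have h2 := Nat.ModEq.cancel_left_of_coprime (by rw [Nat.gcd_comm]; exact ht) h'
  exact ZMod.val_injective n (Nat.ModEq.eq_of_lt_of_lt h2 (ZMod.val_lt i) (ZMod.val_lt j))

theorem qExp_lt {n t : ℕ} [NeZero n] (i : ZMod n) : qExp n t i < n :=
  Nat.mod_lt _ (Nat.pos_of_ne_zero (NeZero.ne n))

theorem autPow_qFrob_eq [NeZero n] (hcard : Nat.card K = (p ^ r) ^ n) (i : ZMod n) (x : K) :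
    autPow (qFrob K p r t) i x = x ^ (p ^ r) ^ qExp n t i := by
  rw [autPow, qFrob_pow_apply, pow_q_pow_mod hcard, qExp]

/-- A generator of the unit group separates these powers: all exponents `q ^ e` with `e < n` stay
below its order `q ^ n - 1`. -/
theorem autPow_qFrob_injective [NeZero n] (hn : 2 ≤ n) (hr : 1 ≤ r)
    (hcard : Nat.card K = (p ^ r) ^ n) (ht : Nat.gcd t n = 1) :
    Function.Injective (autPow (qFrob K p r t) : ZMod n → K ≃+* K) := by
  intro i j hij
  obtain ⟨γ, -, hγ⟩ := exists_generator hcard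
  have hq := two_le_q (p := p) hr
  have hlt : ∀ i : ZMod n, (p ^ r) ^ qExp n t i < (p ^ r) ^ n - 1 := by
    intro i
    have h1 : (p ^ r) ^ qExp n t i ≤ (p ^ r) ^ (n - 1) :=
      Nat.pow_le_pow_right (by omega) (by have := qExp_lt (t := t) i; omega)
    have h2 : (p ^ r) ^ n = p ^ r * (p ^ r) ^ (n - 1) := by
      rw [← pow_succ', Nat.sub_add_cancel (by omega)]
    have h3 : 2 ≤ (p ^ r) ^ (n - 1) := hq.trans (Nat.le_self_pow (by omega) _)
    have h4 := Nat.mul_le_mul_right ((p ^ r) ^ (n - 1)) hq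
    omega
  have h := DFunLike.congr_fun hij (γ : K)
  rw [autPow_qFrob_eq hcard, autPow_qFrob_eq hcard, ← Units.val_pow_eq_pow_val,
    ← Units.val_pow_eq_pow_val, Units.val_inj] at h
  have h2 := pow_injOn_Iio_orderOf (by rw [hγ]; exact hlt i) (by rw [hγ]; exact hlt j) h
  exact qExp_injective ht (Nat.pow_right_injective hq h2)

theorem autNorm_qFrob [NeZero n] (hr : 1 ≤ r) (hcard : Nat.card K = (p ^ r) ^ n)
    (ht : Nat.gcd t n = 1) (x : K) :
    autNorm n (qFrob K p r t) x = x ^ (((p ^ r) ^ n - 1) / (p ^ r - 1)) := by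
  rw [autNorm, ← sum_pow_eq_of_injective (two_le_q hr) (qExp_injective ht) qExp_lt,
    ← Finset.prod_pow_eq_pow_sum]
  exact Finset.prod_congr rfl fun i _ => autPow_qFrob_eq hcard i x

/-- Maps with different parameters `s` and `t` can be compared over the single automorphism `σ = x ^
(q ^ t)`, since `x ^ (q ^ s)` is its `k`-th power. -/
theorem lpFun_eq_skewEval [NeZero n] (hcard : Nat.card K = (p ^ r) ^ n) {s : ℕ} (hs : s ≤ n)
    {k : ZMod n} (h : (s : ZMod n) = t * k) (δ : K) :
    lpFun (p ^ r) n s δ = skewEval (qFrob K p r t) (pairCoeff k 1 δ) := by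
  ext x
  rw [skewEval_pairCoeff, lpFun, autPow_qFrob hcard h, autPow_qFrob hcard (j := n - s), one_mul]
  rw [Nat.cast_sub hs, h]
  simp

omit [Finite K] in
theorem slopes_lpFun_map (q s : ℕ) (τ : K ≃+* K) (δ : K) :
    slopes (lpFun q n s (τ δ)) = τ '' slopes (lpFun q n s δ) := by
  have key : ∀ x, lpFun q n s (τ δ) (τ x) = τ (lpFun q n s δ x) := fun x => by simp [lpFun]
  ext m
  constructor
  · rintro ⟨x, hx, h⟩
    refine ⟨τ.symm m, ⟨τ.symm x, by simpa using hx, τ.injective ?_⟩, by simp⟩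
    rw [← key]
    simpa using h
  · rintro ⟨m, ⟨x, hx, h⟩, rfl⟩
    exact ⟨τ x, by simpa using hx, by rw [key, h, map_mul]⟩

omit [Finite K] in
/-- Elimination of the auxiliary coefficients, for even `n`. -/
theorem even_relation {A B T U V A' B' T' U' V' : K} (hA : A ≠ 0) (hB' : B' ≠ 0)
    (h1 : A * B' = T') (h2 : A' * B = T) (hN : A * A' = 1 ∨ A * A' = T * T')
    (h : (B * U = A * V ∧ B' * U' = A' * V') ∨ (A * U' = B * V' ∧ A' * U = B' * V)) :
    T * U = V ∨ T * V' = U' := by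
  rcases hN with hN | hN
  · rcases h with ⟨h3, h4⟩ | ⟨h3, h4⟩
    · left; linear_combination -U * h2 + A' * h3 + V * hN
    · right; linear_combination -V' * h2 - A' * h3 + U' * hN
  · have h5 : A' = T * B' := mul_left_cancel₀ hA (by linear_combination hN - T * h1)
    rcases h with ⟨h3, h4⟩ | ⟨h3, h4⟩
    · right; exact mul_left_cancel₀ hB' (by linear_combination -V' * h5 - h4)
    · left; exact mul_left_cancel₀ hB' (by linear_combination -U * h5 + h4)

end
end LunardonPolverino

/-! ### Norms to the field with `q ^ gcd (2, n)` elements; the necessary condition -/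

namespace LunardonPolverino

theorem pow_sub_one_dvd_pow_sub_one (q : ℕ) {a b : ℕ} (h : a ∣ b) : q ^ a - 1 ∣ q ^ b - 1 := by
  rw [← Nat.gcd_eq_left_iff_dvd, Nat.pow_sub_one_gcd_pow_sub_one, Nat.gcd_eq_left h]

/-- The exponent of the norm to the field with `q ^ gcd (2, n)` elements. -/
def lpExp (q n : ℕ) : ℕ := (q ^ n - 1) / (q ^ Nat.gcd 2 n - 1)

theorem lpExp_mul (q n : ℕ) : lpExp q n * (q ^ Nat.gcd 2 n - 1) = q ^ n - 1 :=
  Nat.div_mul_cancel (pow_sub_one_dvd_pow_sub_one q (Nat.gcd_dvd_right 2 n))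

theorem lpExp_of_odd {q n : ℕ} (hn : Odd n) : lpExp q n = (q ^ n - 1) / (q - 1) := by
  rw [lpExp, (Nat.coprime_two_left.2 hn : Nat.gcd 2 n = 1), pow_one]

theorem lpExp_of_even {q n : ℕ} (hq : 2 ≤ q) (hn : Even n) :
    (q ^ n - 1) / (q - 1) = lpExp q n * (q + 1) := by
  refine Nat.div_eq_of_eq_mul_left (by omega) ?_
  rw [← lpExp_mul, Nat.gcd_eq_left hn.two_dvd, mul_assoc]
  congr 1
  obtain ⟨a, rfl⟩ := Nat.exists_eq_add_of_le hq
  rw [show 2 + a - 1 = a + 1 by omega]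
  have : (2 + a) ^ 2 = (2 + a + 1) * (a + 1) + 1 := by ring
  rw [this, Nat.add_sub_cancel]

section
variable {K : Type u} [Field K] [Finite K] {p r n t : ℕ}

theorem pow_card_sub_one {q : ℕ} (hcard : Nat.card K = q ^ n) {y : K} (hy : y ≠ 0) :
    y ^ (q ^ n - 1) = 1 := by
  have := Fintype.ofFinite K
  rw [← hcard, Nat.card_eq_fintype_card, FiniteField.pow_card_sub_one_eq_one y hy]

theorem pow_lpExp_pow_eq_one {q : ℕ} (hcard : Nat.card K = q ^ n) {y : K} (hy : y ≠ 0) {j : ℕ}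
    (hj : Nat.gcd 2 n ∣ j) : (y ^ lpExp q n) ^ (q ^ j - 1) = 1 := by
  obtain ⟨c, hc⟩ := pow_sub_one_dvd_pow_sub_one q hj
  rw [hc, pow_mul, ← pow_mul y, lpExp_mul, pow_card_sub_one hcard hy, one_pow]

/-- The norm lies in the field with `q ^ gcd (2, n)` elements, on which these powers of Frobenius
are trivial. In particular `σ ^ 2` fixes every norm. -/
theorem pow_lpExp_pow_pow {q : ℕ} (hq : 1 ≤ q) (hcard : Nat.card K = q ^ n) {y : K} (hy : y ≠ 0)
    {j : ℕ} (hj : Nat.gcd 2 n ∣ j) : (y ^ lpExp q n) ^ q ^ j = y ^ lpExp q n := by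
  have h := pow_lpExp_pow_eq_one hcard hy hj
  rw [← Nat.sub_add_cancel (Nat.one_le_pow j q hq), pow_succ, h, one_mul]

theorem gcd_two_dvd_two_mul (n t : ℕ) : Nat.gcd 2 n ∣ 2 * t :=
  (Nat.gcd_dvd_left 2 n).mul_right t

variable [Fact p.Prime] [CharP K p]

/-- The coefficient relations of `ratio_of_slopes_image` become independent of the auxiliary `y`
after passing to norms, and the two possible values of `N(α)` then allow `α` and `β` to be
eliminated. They account for the alternative between equality and inversion. -/
theorem necessary_relation (hn : 4 ≤ n) (hr : 1 ≤ r) (hcard : Nat.card K = (p ^ r) ^ n)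
    {s : ℕ} (hs1 : 1 ≤ s) (hsn : s < n) (hs : Nat.gcd s n = 1) (htn : t < n)
    (ht : Nat.gcd t n = 1) {δ θ : K} (hδ : δ ≠ 0) (hθ : θ ≠ 0)
    (hNδ : δ ^ (((p ^ r) ^ n - 1) / (p ^ r - 1)) ≠ 1)
    (hNθ : θ ^ (((p ^ r) ^ n - 1) / (p ^ r - 1)) ≠ 1)
    (h : PGammaLEquiv K (linearSetOf K (lpFun (p ^ r) n s δ)) (linearSetOf K (lpFun (p ^ r) n t θ))) :
    (t = s ∨ t = n - s) ∧ ∃ j : ℕ,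
      θ ^ lpExp (p ^ r) n = (δ ^ lpExp (p ^ r) n) ^ p ^ j ∨
      θ ^ lpExp (p ^ r) n * (δ ^ lpExp (p ^ r) n) ^ p ^ j = 1 := by
  have : NeZero n := ⟨by omega⟩
  have hq := two_le_q (p := p) hr
  obtain ⟨τ, a, b, c, d, hdet, hden, himg⟩ := exists_projectivity_of_pGammaLEquiv h
  obtain ⟨j, hj⟩ := exists_pow_of_ringEquiv p τ
  have hdet' := hdet
  set σ := qFrob K p r t with hσdef
  set q := p ^ r with hqdef
  have hσ : σ ^ n = 1 := qFrob_pow_eq_one hcard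
  have hNorm : ∀ x, autNorm n σ x = x ^ ((q ^ n - 1) / (q - 1)) := autNorm_qFrob hr hcard ht
  have htu : (t : ZMod n) * (t : ZMod n)⁻¹ = 1 := ZMod.coe_mul_inv_eq_one t ht
  have hsu : (s : ZMod n) * (s : ZMod n)⁻¹ = 1 := ZMod.coe_mul_inv_eq_one s hs
  set k : ZMod n := s * (t : ZMod n)⁻¹ with hk
  have htk : (s : ZMod n) = t * k := by rw [hk]; linear_combination -(s : ZMod n) * htu
  have hkl : k * (t * (s : ZMod n)⁻¹) = 1 := by
    have : k * (t * (s : ZMod n)⁻¹) = (s * (s : ZMod n)⁻¹) * (t * (t : ZMod n)⁻¹) := by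
      rw [hk]; ring
    rw [this, hsu, htu, mul_one]
  have hτδ : τ δ ≠ 0 := by simpa using hδ
  have hf := lpFun_eq_skewEval (t := t) hcard hsn.le htk (τ δ)
  have hg := lpFun_eq_skewEval (t := t) hcard htn.le (k := 1) (by simp) θ
  have hN1 : ∀ x : K, x ^ ((q ^ n - 1) / (q - 1)) ≠ 1 → autNorm n σ 1 ≠ autNorm n σ x := by
    intro x hx
    rw [hNorm, hNorm, one_pow]
    exact hx.symm
  have hNτ : (τ δ) ^ ((q ^ n - 1) / (q - 1)) ≠ 1 := by
    rw [← map_pow]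
    intro h1
    exact hNδ (τ.injective (by rw [h1, map_one]))
  obtain ⟨α, β, hα, hβ, hαβ, hNα, u', v', hk', hrat⟩ :=
    ratio_of_slopes_image (σ := σ) hn hσ (autPow_qFrob_injective (by omega) hr hcard ht) hq
      (qExp_injective ht) qExp_lt (autPow_qFrob_eq hcard) hθ
      (le_ncard_slopes hcard hσ (by omega) hq (qExp_injective ht) qExp_lt (autPow_qFrob_eq hcard)
        (hN1 θ hNθ))
      hkl one_ne_zero hτδ (hN1 _ hNτ) hdet
      (by
        rw [← hf, slopes_lpFun_map]
        rintro _ ⟨m, hm, rfl⟩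
        exact hden m hm)
      (by rw [← hf, ← hg, slopes_lpFun_map, Set.image_image]; exact himg)
  set M := lpExp q n with hM
  have hs1' : ∀ x : K, autPow σ (1 : ZMod n) x = x ^ q ^ t := autPow_qFrob hcard (by simp)
  have hs2 : ∀ x : K, autPow σ (1 : ZMod n) (autPow σ (1 : ZMod n) x) = x ^ q ^ (2 * t) := by
    intro x
    rw [hs1', hs1', ← pow_mul, ← pow_add, two_mul]
  -- `σ(y)` and `σ⁻¹(y)` differ by `σ ^ 2`, hence have the same norm.
  have hsm : ∀ {y : K}, y ≠ 0 →
      (autPow σ (1 : ZMod n) y) ^ M = (autPow σ (-1 : ZMod n) y) ^ M := by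
    intro y hy
    have hz := autPow_ne_zero (σ := σ) hy (-1 : ZMod n)
    have h1 : autPow σ (1 : ZMod n) y =
        autPow σ (1 : ZMod n) (autPow σ (1 : ZMod n) (autPow σ (-1 : ZMod n) y)) := by
      rw [← autPow_add hσ, ← autPow_add hσ]
      simp
    rw [h1, hs2, pow_right_comm,
      pow_lpExp_pow_pow (by omega) hcard hz (gcd_two_dvd_two_mul n t)]
  have hu'0 : u' ≠ 0 := by
    rcases hk' with ⟨-, rfl, rfl⟩ | ⟨-, rfl, rfl⟩
    · exact one_ne_zero
    · exact hτδ
  have hv'0 : v' ≠ 0 := by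
    rcases hk' with ⟨-, rfl, rfl⟩ | ⟨-, rfl, rfl⟩
    · exact hτδ
    · exact one_ne_zero
  have hrel : θ ^ M * u' ^ M = v' ^ M ∨
      θ ^ M * autPow σ (1 : ZMod n) (v' ^ M) = autPow σ (1 : ZMod n) (u' ^ M) := by
    have hαβM := congrArg (· ^ M) hαβ
    simp only [mul_pow, ← map_pow] at hαβM
    -- For even `n`, `σ` acts on norms as the involution `x ↦ x ^ q`, because `t` is odd, and the
    -- norm to the small field is `y ^ M * σ (y ^ M)`. For odd `n`, `σ` fixes all norms.
    rcases Nat.even_or_odd n with he | ho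
    · have hss : ∀ {y : K}, y ≠ 0 →
          autPow σ (1 : ZMod n) (autPow σ (1 : ZMod n) (y ^ M)) = y ^ M := by
        intro y hy
        rw [hs2, pow_lpExp_pow_pow (by omega) hcard hy (gcd_two_dvd_two_mul n t)]
      have htodd : Odd t := by
        rw [← Nat.not_even_iff_odd]
        intro hte
        have := Nat.dvd_gcd hte.two_dvd he.two_dvd
        omega
      have hsq : ∀ {y : K}, y ≠ 0 → autPow σ (1 : ZMod n) (y ^ M) = (y ^ M) ^ q := by
        intro y hy
        obtain ⟨c, hc⟩ := htodd
        have h2 := pow_lpExp_pow_pow (by omega) hcard hy (gcd_two_dvd_two_mul n c)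
        rw [hs1', hc, pow_succ, pow_mul, h2]
      have hNM : ∀ {y : K}, y ≠ 0 → autNorm n σ y = y ^ M * autPow σ (1 : ZMod n) (y ^ M) := by
        intro y hy
        rw [hNorm, lpExp_of_even hq he, hsq hy, ← hM, pow_mul, pow_succ' (y ^ M) q]
      have h2 := congrArg (autPow σ (1 : ZMod n)) hαβM
      rw [map_mul, hss hβ, hss hθ] at h2
      rw [hNM hα, hNM hθ] at hNα
      refine even_relation (pow_ne_zero M hα) (autPow_ne_zero (pow_ne_zero M hβ) _) hαβM h2 hNα ?_
      rcases hrat with ⟨y, hy, hrat⟩ | ⟨hn4, y, hy, hrat⟩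
      · left
        have h3 := congrArg (· ^ M) hrat
        simp only [mul_pow] at h3
        rw [← hsm hy] at h3
        have h3 : β ^ M * u' ^ M = α ^ M * v' ^ M :=
          mul_right_cancel₀ (pow_ne_zero M (autPow_ne_zero (σ := σ) hy (1 : ZMod n)))
            (by linear_combination h3)
        refine ⟨h3, ?_⟩
        rw [← map_mul, h3, map_mul]
      · right
        -- The sign in the case `n = 4` disappears: `M = q ^ 2 + 1` is even for odd `q`, and `-1 =
        -- 1` for even `q`.
        have hneg : (-1 : K) ^ M = 1 := by
          rcases Nat.even_or_odd q with hqe | hqo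
          · have hp2 : p = 2 := by
              by_contra hp2
              have : Odd q := (((Fact.out : p.Prime).eq_two_or_odd').resolve_left hp2).pow
              exact (Nat.not_even_iff_odd.2 this) hqe
            subst hp2
            rw [CharTwo.neg_eq, one_pow]
          · have hM4 : M = q ^ 2 + 1 := by
              rw [hM, lpExp, hn4]
              refine Nat.div_eq_of_eq_mul_left ?_ ?_
              · have : 2 ^ 2 ≤ q ^ 2 := Nat.pow_le_pow_left hq 2
                have : Nat.gcd 2 4 = 2 := rfl
                rw [this]; omega
              · have : Nat.gcd 2 4 = 2 := rfl
                rw [this]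
                have : 1 ≤ q ^ 2 := Nat.one_le_pow _ _ (by omega)
                obtain ⟨c, hc⟩ := Nat.exists_eq_add_of_le this
                have h4 : q ^ 4 = (q ^ 2 + 1) * (q ^ 2 - 1) + 1 := by
                  rw [hc, show q ^ 4 = (q ^ 2) ^ 2 by ring, hc, Nat.add_sub_cancel_left]; ring
                rw [h4, Nat.add_sub_cancel]
            rw [hM4]
            exact Even.neg_one_pow (hqo.pow.add_odd odd_one)
        have h3 := congrArg (· ^ M) hrat
        simp only [map_mul] at h3
        rw [neg_pow, hneg, one_mul, mul_pow, mul_pow, mul_pow, mul_pow, ← hsm hy, ← hsm hv'0] at h3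
        simp only [← map_pow] at h3
        have h3 : α ^ M * autPow σ (1 : ZMod n) (u' ^ M) = β ^ M * autPow σ (1 : ZMod n) (v' ^ M) :=
          mul_right_cancel₀ (autPow_ne_zero (σ := σ) (pow_ne_zero M hy) (1 : ZMod n))
            (by linear_combination h3)
        refine ⟨h3, ?_⟩
        have h4 := congrArg (autPow σ (1 : ZMod n)) h3
        rw [map_mul, map_mul, hss hu'0, hss hv'0] at h4
        exact h4
    · have hsid : ∀ {y : K}, y ≠ 0 → autPow σ (1 : ZMod n) (y ^ M) = y ^ M := by
        intro y hy
        have hg : Nat.gcd 2 n = 1 := Nat.coprime_two_left.2 ho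
        rw [hs1', pow_lpExp_pow_pow (by omega) hcard hy (by rw [hg]; exact one_dvd t)]
      rw [hsid hβ, hsid hθ] at hαβM
      rw [hNorm, hNorm, ← lpExp_of_odd ho, ← hM] at hNα
      rcases hrat with ⟨y, hy, hrat⟩ | ⟨hn4, -⟩
      · have h3 := congrArg (· ^ M) hrat
        simp only [mul_pow] at h3
        rw [← hsm hy] at h3
        have h3 : β ^ M * u' ^ M = α ^ M * v' ^ M :=
          mul_right_cancel₀ (pow_ne_zero M (autPow_ne_zero (σ := σ) hy (1 : ZMod n)))
            (by linear_combination h3)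
        rcases hNα with hNα | hNα
        · left
          linear_combination -u' ^ M * hαβM + α ^ M * h3 + (α ^ M + 1) * v' ^ M * hNα
        · right
          rw [hsid hu'0, hsid hv'0]
          have hβ1 : β ^ M = 1 := mul_left_cancel₀ (pow_ne_zero M hθ)
            (by linear_combination hαβM - β ^ M * hNα)
          linear_combination -v' ^ M * hNα - h3 + u' ^ M * hβ1
      · rw [hn4] at ho
        exact absurd ho (by decide)
  have hDj : (τ δ) ^ M = (δ ^ M) ^ p ^ j := by rw [hj, pow_right_comm]
  -- The extra `σ` in the second alternative is absorbed into the Frobenius exponent.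
  have hDj' : autPow σ (1 : ZMod n) ((τ δ) ^ M) = (δ ^ M) ^ p ^ (j + r * t) := by
    rw [hs1', hDj, ← pow_mul, hqdef, ← pow_mul p r t, ← pow_add]
  have hst : ((t : ℕ) : ZMod n) = s → t = s := fun h => by
    have := (ZMod.natCast_eq_natCast_iff' t s n).1 h
    rwa [Nat.mod_eq_of_lt htn, Nat.mod_eq_of_lt hsn] at this
  have hst' : ((t : ℕ) : ZMod n) = ((n - s : ℕ) : ZMod n) → t = n - s := fun h => by
    have := (ZMod.natCast_eq_natCast_iff' t (n - s) n).1 h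
    rwa [Nat.mod_eq_of_lt htn, Nat.mod_eq_of_lt (by omega)] at this
  rcases hk' with ⟨hk1, rfl, rfl⟩ | ⟨hk1, rfl, rfl⟩
  · refine ⟨Or.inl (hst (by rw [htk, hk1, mul_one])), ?_⟩
    rw [one_pow, map_one, mul_one, hDj', hDj] at hrel
    rcases hrel with h | h
    · exact ⟨_, Or.inl h⟩
    · exact ⟨_, Or.inr h⟩
  · refine ⟨Or.inr (hst' (by rw [Nat.cast_sub hsn.le, htk, hk1]; simp)), ?_⟩
    rw [one_pow, map_one, mul_one, hDj', hDj] at hrel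
    rcases hrel with h | h
    · exact ⟨_, Or.inr h⟩
    · exact ⟨_, Or.inl h⟩
end
end LunardonPolverino

/-! ### Equivalences realising the coincidences -/

namespace LunardonPolverino

section
variable {K : Type u} [Field K]

theorem pGammaLEquiv_of_scale {f g : K → K} {c l : K} (hc : c ≠ 0) (hl : l ≠ 0)
    (h : ∀ x, f (l * x) = c * g x) : PGammaLEquiv K (linearSetOf K f) (linearSetOf K g) := by
  refine pGammaLEquiv_of_slopes_eq (RingEquiv.refl K) (div_ne_zero hl hc) ?_
  ext m
  constructor
  · rintro ⟨x, hx, hm⟩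
    refine ⟨c * m / l, ⟨l * x, mul_ne_zero hl hx, ?_⟩, ?_⟩
    · rw [h, hm]; field_simp
    · simp only [RingEquiv.refl_apply]; field_simp
  · rintro ⟨m, ⟨y, hy, hm⟩, rfl⟩
    refine ⟨y / l, div_ne_zero hy hl, mul_left_cancel₀ hc ?_⟩
    rw [← h, mul_div_cancel₀ _ hl, hm]
    change m * y = c * (l / c * m * (y / l))
    field_simp

variable [Finite K] {p r n : ℕ}

/-- Hilbert 90 for `x ↦ x ^ (q ^ (2 s))`. In terms of a generator it is Bézout's identity, because
the greatest common divisor of `q ^ (2 s) - 1` and `q ^ n - 1` is `q ^ gcd (2, n) - 1`. -/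
theorem exists_pow_eq_of_pow_lpExp_eq_one {q : ℕ} (hn : 1 ≤ n) (hq : 2 ≤ q)
    (hcard : Nat.card K = q ^ n) {s : ℕ}
    (hs : Nat.gcd s n = 1) {w : K} (hw : w ≠ 0) (h : w ^ lpExp q n = 1) :
    ∃ z : K, z ≠ 0 ∧ z ^ q ^ (2 * s) = w * z := by
  obtain ⟨γ, hγ⟩ := IsCyclic.exists_generator (α := Kˣ)
  have hord : orderOf γ = q ^ n - 1 := by
    rw [orderOf_eq_card_of_forall_mem_zpowers hγ, Nat.card_units, hcard]
  obtain ⟨a, ha⟩ := Subgroup.mem_zpowers_iff.1 (hγ (Units.mk0 w hw))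
  have h1 : γ ^ (a * (lpExp q n : ℤ)) = 1 := by
    rw [zpow_mul, ha, zpow_natCast]
    exact Units.ext h
  rw [← orderOf_dvd_iff_zpow_eq_one, hord, ← lpExp_mul, Nat.cast_mul, mul_comm a] at h1
  have hM : lpExp q n ≠ 0 := by
    intro h0
    have h2 := lpExp_mul q n
    rw [h0, zero_mul] at h2
    have : q ^ 1 ≤ q ^ n := Nat.pow_le_pow_right (by omega) hn
    rw [pow_one] at this
    omega
  obtain ⟨a', rfl⟩ := (mul_dvd_mul_iff_left (by exact_mod_cast hM)).1 h1
  have hg : Nat.gcd (q ^ (2 * s) - 1) (q ^ n - 1) = q ^ Nat.gcd 2 n - 1 := by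
    rw [Nat.pow_sub_one_gcd_pow_sub_one, Nat.Coprime.gcd_mul_right_cancel 2 hs]
  have hbez := Nat.gcd_eq_gcd_ab (q ^ (2 * s) - 1) (q ^ n - 1)
  rw [hg] at hbez
  set u := Nat.gcdA (q ^ (2 * s) - 1) (q ^ n - 1)
  set v := Nat.gcdB (q ^ (2 * s) - 1) (q ^ n - 1)
  have hz : (γ ^ (u * a')) ^ (q ^ (2 * s) - 1) = Units.mk0 w hw := by
    rw [← ha, ← zpow_natCast, ← zpow_mul, hbez, add_mul, zpow_add, mul_assoc ((q ^ n - 1 : ℕ) : ℤ),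
      zpow_mul γ ((q ^ n - 1 : ℕ) : ℤ), zpow_natCast γ (q ^ n - 1), ← hord, pow_orderOf_eq_one,
      one_zpow, mul_one]
    congr 1
    ring
  refine ⟨(γ ^ (u * a') : Kˣ), Units.ne_zero _, ?_⟩
  have hz' := congrArg Units.val hz
  rw [Units.val_pow_eq_pow_val, Units.val_mk0] at hz'
  rw [← hz', ← pow_succ, Nat.sub_add_cancel (Nat.one_le_pow _ _ (by omega))]

variable [Fact p.Prime] [CharP K p]

-- Substituting `z ^ (q ^ s) x` for `x` multiplies the two coefficients by `z ^ (q ^ (2 s))` and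
-- `z`, and Hilbert 90 provides `z` for which their ratio changes from `δ` to `θ`.
omit [CharP K p] in
theorem lp_equiv_of_norm_eq (hn : 1 ≤ n) (hr : 1 ≤ r) (hcard : Nat.card K = (p ^ r) ^ n) {s : ℕ}
    (hsn : s ≤ n) (hs : Nat.gcd s n = 1) {δ θ : K} (hδ : δ ≠ 0) (hθ : θ ≠ 0)
    (h : δ ^ lpExp (p ^ r) n = θ ^ lpExp (p ^ r) n) :
    PGammaLEquiv K (linearSetOf K (lpFun (p ^ r) n s δ))
      (linearSetOf K (lpFun (p ^ r) n s θ)) := by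
  obtain ⟨z, hz, hzw⟩ := exists_pow_eq_of_pow_lpExp_eq_one hn (two_le_q (p := p) hr) hcard hs
    (div_ne_zero hδ hθ) (by rw [div_pow, h, div_self (pow_ne_zero _ hθ)])
  have h1 : (z ^ (p ^ r) ^ s) ^ (p ^ r) ^ s = z ^ (p ^ r) ^ (2 * s) := by
    rw [← pow_mul, ← pow_add, two_mul]
  have h2 : (z ^ (p ^ r) ^ s) ^ (p ^ r) ^ (n - s) = z := by
    rw [← pow_mul, ← pow_add, Nat.add_sub_cancel' hsn, pow_q_pow_mod hcard]
    simp
  refine pGammaLEquiv_of_scale (c := z ^ (p ^ r) ^ (2 * s)) (l := z ^ (p ^ r) ^ s)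
    (pow_ne_zero _ hz) (pow_ne_zero _ hz) fun x => ?_
  rw [lpFun, lpFun, mul_pow, mul_pow, h1, h2, hzw]
  field_simp

theorem lp_equiv_pow (s : ℕ) (δ : K) (j : ℕ) :
    PGammaLEquiv K (linearSetOf K (lpFun (p ^ r) n s δ))
      (linearSetOf K (lpFun (p ^ r) n s (δ ^ p ^ j))) := by
  refine pGammaLEquiv_of_slopes_eq (iterateFrobeniusEquiv K p j) one_ne_zero ?_
  rw [← iterateFrobeniusEquiv_def, slopes_lpFun_map]
  simp

/-- The adjoint `σ(δ) σ + σ⁻¹` of `σ + δ σ⁻¹` has the same slopes and is proportional to `σ + σ(δ⁻¹)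
σ⁻¹`; a power of Frobenius removes the remaining conjugation. -/
theorem lp_equiv_inv (hn : 2 ≤ n) (hr : 1 ≤ r) (hcard : Nat.card K = (p ^ r) ^ n) {s : ℕ}
    (hsn : s < n) (hs : Nat.gcd s n = 1) {δ : K} (hδ : δ ≠ 0)
    (hN : δ ^ (((p ^ r) ^ n - 1) / (p ^ r - 1)) ≠ 1) :
    PGammaLEquiv K (linearSetOf K (lpFun (p ^ r) n s δ))
      (linearSetOf K (lpFun (p ^ r) n s δ⁻¹)) := by
  have : NeZero n := ⟨by omega⟩
  refine PGammaLEquiv.trans ?_ (lp_equiv_pow (p := p) s δ⁻¹ (r * s)).symm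
  have hf := lpFun_eq_skewEval (p := p) (t := s) hcard hsn.le (k := 1) (by simp) δ
  have hσ : qFrob K p r s ^ n = 1 := qFrob_pow_eq_one hcard
  have hadj := slopes_pairCoeff_adjoint hcard hσ hn (two_le_q hr) (qExp_injective hs) qExp_lt
    (autPow_qFrob_eq hcard) (u := 1) (v := δ)
    (by rw [autNorm_qFrob hr hcard hs, autNorm_qFrob hr hcard hs, one_pow]; exact hN.symm)
  rw [linearSetOf_eq_image, hf, hadj, ← linearSetOf_eq_image]
  have hc := autPow_ne_zero (σ := qFrob K p r s) hδ (1 : ZMod n)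
  refine pGammaLEquiv_of_scale hc one_ne_zero fun x => ?_
  rw [lpFun_eq_skewEval (p := p) (t := s) hcard hsn.le (k := 1) (by simp) (δ⁻¹ ^ p ^ (r * s)),
    skewEval_pairCoeff, skewEval_pairCoeff, pow_mul p r s,
    ← autPow_qFrob (t := s) hcard (k := 1) (j := s) (by simp) δ⁻¹, map_inv₀, map_one, one_mul]
  field_simp

omit [Finite K] [Fact p.Prime] [CharP K p] in
theorem lp_equiv_sub {s : ℕ} (hsn : s ≤ n) {δ : K} (hδ : δ ≠ 0) :
    PGammaLEquiv K (linearSetOf K (lpFun (p ^ r) n (n - s) δ))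
      (linearSetOf K (lpFun (p ^ r) n s δ⁻¹)) := by
  refine pGammaLEquiv_of_scale hδ one_ne_zero fun x => ?_
  rw [lpFun, lpFun, Nat.sub_sub_self hsn, one_mul]
  field_simp
  ring

theorem sufficient_relation (hn : 4 ≤ n) (hr : 1 ≤ r) (hcard : Nat.card K = (p ^ r) ^ n)
    {s t : ℕ} (hsn : s < n) (hs : Nat.gcd s n = 1) {δ θ : K} (hδ : δ ≠ 0) (hθ : θ ≠ 0)
    (hNδ : δ ^ (((p ^ r) ^ n - 1) / (p ^ r - 1)) ≠ 1)
    (hNθ : θ ^ (((p ^ r) ^ n - 1) / (p ^ r - 1)) ≠ 1)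
    (hst : t = s ∨ t = n - s) {j : ℕ}
    (h : θ ^ lpExp (p ^ r) n = (δ ^ lpExp (p ^ r) n) ^ p ^ j ∨
      θ ^ lpExp (p ^ r) n * (δ ^ lpExp (p ^ r) n) ^ p ^ j = 1) :
    PGammaLEquiv K (linearSetOf K (lpFun (p ^ r) n s δ))
      (linearSetOf K (lpFun (p ^ r) n t θ)) := by
  have h1 : PGammaLEquiv K (linearSetOf K (lpFun (p ^ r) n s δ))
      (linearSetOf K (lpFun (p ^ r) n s θ)) := by
    rcases h with h | h
    · refine (lp_equiv_pow (p := p) s δ j).trans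
        (lp_equiv_of_norm_eq (by omega) hr hcard hsn.le hs (pow_ne_zero _ hδ) hθ ?_)
      rw [h, pow_right_comm]
    · refine ((lp_equiv_inv (by omega) hr hcard hsn hs hδ hNδ).trans
        (lp_equiv_pow (p := p) s δ⁻¹ j)).trans
        (lp_equiv_of_norm_eq (by omega) hr hcard hsn.le hs
          (pow_ne_zero _ (inv_ne_zero hδ)) hθ ?_)
      rw [pow_right_comm, inv_pow, inv_pow]
      exact (eq_inv_of_mul_eq_one_left h).symm
  rcases hst with rfl | rfl
  · exact h1
  · exact h1.trans ((lp_equiv_inv (by omega) hr hcard hsn hs hθ hNθ).trans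
      (lp_equiv_sub hsn.le hθ).symm)
end
end LunardonPolverino

/-! ### Burnside's lemma for multiplication by `± p ^ j` on residues -/

namespace LunardonPolverino
open Finset

theorem card_filter_dvd_mul {m : ℕ} (hm : 0 < m) (b : ℕ) :
    ((range m).filter fun k => m ∣ b * k).card = Nat.gcd b m := by
  obtain ⟨d, hd⟩ := Nat.gcd_dvd_right b m
  obtain ⟨b', hb⟩ := Nat.gcd_dvd_left b m
  set g := Nat.gcd b m with hg
  have hg0 : 0 < g := Nat.gcd_pos_of_pos_right b hm
  have hd0 : 0 < d := Nat.pos_of_ne_zero (by rintro rfl; omega)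
  have hcop : Nat.Coprime d b' := by
    have h := Nat.coprime_div_gcd_div_gcd (m := b) (n := m) hg0
    rw [← hg] at h
    rw [hb, hd, Nat.mul_div_cancel_left _ hg0, Nat.mul_div_cancel_left _ hg0] at h
    exact h.symm
  have hiff : ∀ k, m ∣ b * k ↔ d ∣ k := by
    intro k
    rw [hd, hb, mul_assoc, Nat.mul_dvd_mul_iff_left hg0]
    exact hcop.dvd_mul_left
  have himg : ((range m).filter fun k => m ∣ b * k) = (range g).image fun i => d * i := by
    ext k
    simp only [mem_filter, mem_range, mem_image, hiff]
    constructor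
    · rintro ⟨hk, i, rfl⟩
      refine ⟨i, ?_, rfl⟩
      rw [hd, mul_comm g] at hk
      exact Nat.lt_of_mul_lt_mul_left hk
    · rintro ⟨i, hi, rfl⟩
      refine ⟨?_, dvd_mul_right d i⟩
      rw [hd, mul_comm g]
      exact Nat.mul_lt_mul_of_pos_left hi hd0
  rw [himg, card_image_of_injective _ fun i j h => Nat.eq_of_mul_eq_mul_left hd0 h, card_range]

theorem card_filter_dvd_mul_and_dvd {a w : ℕ} (ha : 0 < a) (hw : 0 < w) (b : ℕ) :
    ((range (a * w)).filter fun k => a * w ∣ b * k ∧ a ∣ k).card = Nat.gcd b w := by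
  rw [← card_filter_dvd_mul hw]
  have himg : ((range (a * w)).filter fun k => a * w ∣ b * k ∧ a ∣ k) =
      ((range w).filter fun k => w ∣ b * k).image fun i => a * i := by
    ext k
    simp only [mem_filter, mem_range, mem_image]
    constructor
    · rintro ⟨hk, hdvd, i, rfl⟩
      refine ⟨i, ⟨Nat.lt_of_mul_lt_mul_left hk, ?_⟩, rfl⟩
      rw [mul_left_comm] at hdvd
      exact (Nat.mul_dvd_mul_iff_left ha).1 hdvd
    · rintro ⟨i, ⟨hi, hdvd⟩, rfl⟩
      refine ⟨Nat.mul_lt_mul_of_pos_left hi ha, ?_, dvd_mul_right a i⟩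
      rw [mul_left_comm]
      exact (Nat.mul_dvd_mul_iff_left ha).2 hdvd
  rw [himg, card_image_of_injective _ fun i j h => Nat.eq_of_mul_eq_mul_left ha h]

theorem ncard_setOf_zmod_val {m : ℕ} [NeZero m] (P : ℕ → Prop) [DecidablePred P] :
    {v : ZMod m | P v.val}.ncard = ((range m).filter P).card := by
  have h : {v : ZMod m | P v.val} = ((fun k : ℕ => (k : ZMod m)) '' ((range m).filter P : Finset ℕ)) := by
    ext v
    simp only [Set.mem_ofPred_eq, coe_filter, mem_range, Set.mem_image]
    constructor
    · intro hv
      exact ⟨v.val, ⟨ZMod.val_lt v, hv⟩, ZMod.natCast_rightInverse v⟩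
    · rintro ⟨k, ⟨hk, hP⟩, rfl⟩
      rwa [ZMod.val_cast_of_lt hk]
  rw [h, Set.InjOn.ncard_image, Set.ncard_coe_finset]
  intro j hj k hk hjk
  simp only [coe_filter, mem_range, Set.mem_ofPred_eq] at hj hk
  have := congrArg ZMod.val hjk
  rwa [ZMod.val_cast_of_lt hj.1, ZMod.val_cast_of_lt hk.1] at this

/-- The number of solutions of `b v = 0` in `ZMod (a w)` with `v` not a multiple of `a`. -/
theorem ncard_mul_eq_zero {a w : ℕ} (ha : 0 < a) (hw : 0 < w) (b : ℕ) :
    {v : ZMod (a * w) | ¬ a ∣ v.val ∧ (b : ZMod (a * w)) * v = 0}.ncard + Nat.gcd b w =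
      Nat.gcd b (a * w) := by
  have : NeZero (a * w) := ⟨(Nat.mul_pos ha hw).ne'⟩
  have h : {v : ZMod (a * w) | ¬ a ∣ v.val ∧ (b : ZMod (a * w)) * v = 0} =
      {v : ZMod (a * w) | ¬ a ∣ v.val ∧ a * w ∣ b * v.val} := by
    ext v
    refine and_congr_right fun _ => ?_
    rw [← ZMod.natCast_eq_zero_iff, Nat.cast_mul, ZMod.natCast_rightInverse v]
  rw [h, ncard_setOf_zmod_val fun k => ¬ a ∣ k ∧ a * w ∣ b * k, ← card_filter_dvd_mul_and_dvd ha hw,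
    ← card_filter_dvd_mul (Nat.mul_pos ha hw)]
  rw [← card_union_of_disjoint, ← filter_or]
  · congr 1
    refine filter_congr fun k _ => ?_
    tauto
  · refine disjoint_filter.2 fun k _ h1 h2 => h1.1 h2.2

/-- **Burnside's lemma** for a group of units acting on a subset of a finite ring. -/
theorem card_quotient_mul_card {R G : Type} [CommRing R] [Finite R] [CommGroup G] [Fintype G]
    (f : G →* Rˣ) (V : Set R) (hV : ∀ g, ∀ v ∈ V, (f g : R) * v ∈ V) (S : Setoid V)
    (hS : ∀ v w : V, S v w ↔ ∃ g, (w : R) = f g * v) :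
    Nat.card (Quotient S) * Nat.card G = ∑ g, {v | v ∈ V ∧ (f g : R) * v = v}.ncard := by
  classical
  have := Fintype.ofFinite R
  let inst : MulAction G V :=
    { smul := fun g v => ⟨f g * v, hV g v v.2⟩
      one_smul := fun v => Subtype.ext (by change ((f 1 : Rˣ) : R) * v = v; simp)
      mul_smul := fun g h v => Subtype.ext (by
        change ((f (g * h) : Rˣ) : R) * v = f g * (f h * v)
        rw [map_mul, Units.val_mul, mul_assoc]) }
  have hr : S = MulAction.orbitRel G V := by
    ext v w
    rw [S.comm', MulAction.orbitRel_apply]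
    refine (hS w v).trans ?_
    exact ⟨fun ⟨g, hg⟩ => ⟨g, Subtype.ext hg.symm⟩, fun ⟨g, hg⟩ => ⟨g, (congrArg Subtype.val hg).symm⟩⟩
  have hb := MulAction.sum_card_fixedBy_eq_card_orbits_mul_card_group G V
  subst hr
  rw [Nat.card_eq_fintype_card, Nat.card_eq_fintype_card]
  refine (hb.symm.trans ?_ : Fintype.card (Quotient (MulAction.orbitRel G V)) * _ = _)
  refine Finset.sum_congr rfl fun g _ => ?_
  rw [← Nat.card_eq_fintype_card, ← Nat.card_coe_set_eq]
  refine Nat.card_congr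
    { toFun := fun v => ⟨v.1, v.1.2, congrArg Subtype.val v.2⟩
      invFun := fun v => ⟨⟨v.1, v.2.1⟩, Subtype.ext v.2.2⟩
      left_inv := fun v => rfl
      right_inv := fun v => rfl }

/-- The homomorphism `(j, ε) ↦ ε u ^ j` for a unit `u` with `u ^ N = 1`. -/
def signedPowHom {R : Type} [CommRing R] {N : ℕ} [NeZero N] (u : Rˣ) (hu : u ^ N = 1) :
    Multiplicative (ZMod N) × ℤˣ →* Rˣ :=
  MonoidHom.coprod
    { toFun := fun j => u ^ (Multiplicative.toAdd j).val
      map_one' := by simp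
      map_mul' := fun i j => by
        rw [toAdd_mul, ZMod.val_add, ← pow_eq_pow_mod _ hu, pow_add] }
    (Units.map (Int.castRingHom R).toMonoidHom)

theorem signedPowHom_apply {R : Type} [CommRing R] {N : ℕ} [NeZero N] (u : Rˣ) (hu : u ^ N = 1)
    (j : ZMod N) (ε : ℤˣ) : ((signedPowHom u hu (Multiplicative.ofAdd j, ε) : Rˣ) : R) =
      (u : R) ^ j.val * ((ε : ℤ) : R) := by
  simp [signedPowHom]

theorem exists_signedPowHom_iff {R : Type} [CommRing R] {N : ℕ} [NeZero N] (u : Rˣ)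
    (hu : u ^ N = 1) (v w : R) : (∃ g, w = (signedPowHom u hu g : Rˣ) * v) ↔
      ∃ j : ℕ, w = (u : R) ^ j * v ∨ w = -((u : R) ^ j * v) := by
  constructor
  · rintro ⟨⟨j, ε⟩, rfl⟩
    refine ⟨(Multiplicative.toAdd j).val, ?_⟩
    have := signedPowHom_apply u hu (Multiplicative.toAdd j) ε
    rw [ofAdd_toAdd] at this
    rw [this]
    rcases Int.units_eq_one_or ε with rfl | rfl
    · left; simp
    · right; simp
  · rintro ⟨j, h⟩
    have hj : (u : R) ^ (j : ZMod N).val = (u : R) ^ j := by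
      rw [ZMod.val_natCast, ← Units.val_pow_eq_pow_val, ← Units.val_pow_eq_pow_val,
        ← pow_eq_pow_mod _ hu]
    rcases h with rfl | rfl
    · exact ⟨(Multiplicative.ofAdd (j : ZMod N), 1), by rw [signedPowHom_apply, hj]; simp⟩
    · exact ⟨(Multiplicative.ofAdd (j : ZMod N), -1), by rw [signedPowHom_apply, hj]; simp⟩

/-- The equivalence relation `w = ± u ^ j v` on a set of residues. -/
def signedPowSetoid {R : Type} [CommRing R] {N : ℕ} [NeZero N] (u : Rˣ) (hu : u ^ N = 1)
    (V : Set R) : Setoid V where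
  r v w := ∃ g, (w : R) = (signedPowHom u hu g : Rˣ) * v
  iseqv :=
    { refl := fun v => ⟨1, by simp⟩
      symm := by
        rintro v w ⟨g, hg⟩
        exact ⟨g⁻¹, by rw [hg, map_inv, ← mul_assoc, Units.inv_mul, one_mul]⟩
      trans := by
        rintro v w x ⟨g, hg⟩ ⟨h, hh⟩
        exact ⟨h * g, by rw [hh, hg, map_mul, Units.val_mul, mul_assoc]⟩ }

/-- The difference of greatest common divisors counting the residues fixed by `b`. -/
def gcdDiff (b m w : ℕ) : ℝ := (Nat.gcd b m : ℝ) - Nat.gcd b w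

/-- The residues fixed by `p ^ j` and by `- p ^ j` are the solutions of `(p ^ j - 1) v = 0` and `(p
^ j + 1) v = 0`. The group is `ZMod N` times the signs, of order `2 N`; its action need not be
faithful. -/
theorem card_signedPow_orbits {a w N : ℕ} [NeZero N] (ha : 0 < a) (hw : 0 < w)
    {p : ℕ} (hp : 0 < p) (u : (ZMod (a * w))ˣ) (hup : (u : ZMod (a * w)) = p) (hu : u ^ N = 1) :
    (Nat.card (Quotient (signedPowSetoid u hu {v : ZMod (a * w) | ¬ a ∣ v.val})) : ℝ) * (2 * N) =
      ∑ j ∈ range N, (gcdDiff (p ^ j - 1) (a * w) w + gcdDiff (p ^ j + 1) (a * w) w) := by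
  have : NeZero (a * w) := ⟨(Nat.mul_pos ha hw).ne'⟩
  -- A unit modulo `a * w` is prime to `a`, so multiplying by it cannot create divisibility by `a`.
  have hV : ∀ g, ∀ v ∈ {v : ZMod (a * w) | ¬ a ∣ v.val},
      ((signedPowHom u hu g : (ZMod (a * w))ˣ) : ZMod (a * w)) * v ∈
        {v : ZMod (a * w) | ¬ a ∣ v.val} := by
    intro g v hv h
    refine hv ?_
    set x := signedPowHom u hu g
    have h' : a ∣ ((x : ZMod (a * w)) * v).val := h
    rw [ZMod.val_mul, Nat.dvd_mod_iff (dvd_mul_right a w)] at h'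
    refine Nat.Coprime.dvd_of_dvd_mul_left ?_ h'
    exact (Nat.Coprime.coprime_dvd_right (dvd_mul_right a w) (ZMod.val_coe_unit_coprime x)).symm
  have h := card_quotient_mul_card (signedPowHom u hu) _ hV (signedPowSetoid u hu _)
    fun v w => Iff.rfl
  have hG : Nat.card (Multiplicative (ZMod N) × ℤˣ) = 2 * N := by
    rw [Nat.card_prod, Nat.card_eq_fintype_card, Nat.card_eq_fintype_card, Fintype.card_multiplicative,
      ZMod.card, Fintype.card_units_int, mul_comm]
  rw [hG, Fintype.sum_prod_type] at h
  have hcount : ∀ b : ℕ, ({v : ZMod (a * w) | ¬ a ∣ v.val ∧ (b : ZMod (a * w)) * v = 0}.ncard : ℝ) =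
      gcdDiff b (a * w) w := by
    intro b
    rw [gcdDiff, ← ncard_mul_eq_zero ha hw b]
    push_cast
    ring
  have hfix : ∀ j : ZMod N, (∑ ε : ℤˣ, {v | v ∈ {v : ZMod (a * w) | ¬ a ∣ v.val} ∧
      ((signedPowHom u hu (Multiplicative.ofAdd j, ε) : (ZMod (a * w))ˣ) : ZMod (a * w)) * v =
        v}.ncard : ℝ) =
      gcdDiff (p ^ j.val - 1) (a * w) w + gcdDiff (p ^ j.val + 1) (a * w) w := by
    intro j
    rw [← hcount, ← hcount, UnitsInt.univ, sum_pair (by decide)]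
    congr 2
    · congr 1
      ext v
      refine and_congr_right fun _ => ?_
      rw [signedPowHom_apply, hup, Nat.cast_sub (Nat.one_le_pow _ _ hp)]
      push_cast
      exact ⟨fun h => by linear_combination h, fun h => by linear_combination h⟩
    · congr 1
      ext v
      refine and_congr_right fun _ => ?_
      rw [signedPowHom_apply, hup]
      push_cast
      exact ⟨fun h => by linear_combination -h, fun h => by linear_combination -h⟩
  have h' := congrArg (Nat.cast : ℕ → ℝ) h
  push_cast at h'
  rw [h']
  have e : ∑ j : ZMod N, (gcdDiff (p ^ j.val - 1) (a * w) w + gcdDiff (p ^ j.val + 1) (a * w) w) =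
      ∑ j ∈ range N, (gcdDiff (p ^ j - 1) (a * w) w + gcdDiff (p ^ j + 1) (a * w) w) := by
    refine Finset.sum_nbij' (fun i => i.val) (fun i => (i : ZMod N)) ?_ ?_ ?_ ?_ ?_
    · intro i _; exact Finset.mem_range.2 (ZMod.val_lt i)
    · intro i _; exact Finset.mem_univ _
    · intro i _; exact ZMod.natCast_rightInverse i
    · intro i hi; exact ZMod.val_cast_of_lt (Finset.mem_range.1 hi)
    · intro i _; rfl
  rw [← e]
  exact Fintype.sum_equiv Multiplicative.toAdd _ _ fun j => hfix (Multiplicative.toAdd j)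
end LunardonPolverino

/-! ### The number of classes as a number of orbits -/

namespace LunardonPolverino
open Finset

theorem two_mul_card_coprime_lt_half {n : ℕ} (hn : 3 ≤ n) :
    2 * ((range n).filter fun s => 2 * s < n ∧ Nat.gcd s n = 1).card = Nat.totient n := by
  have hne : ∀ s, Nat.gcd s n = 1 → 2 * s ≠ n := by
    rintro s hs rfl
    rw [Nat.gcd_mul_left_right] at hs
    omega
  have h2 : ((range n).filter fun s => 2 * s < n ∧ Nat.gcd s n = 1).card =
      ((range n).filter fun s => n < 2 * s ∧ Nat.gcd s n = 1).card := by
    have h0 : ¬ Nat.gcd 0 n = 1 := by rw [Nat.gcd_zero_left]; omega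
    refine Finset.card_nbij' (fun s => n - s) (fun s => n - s) ?_ ?_ ?_ ?_
    · intro s hs
      simp only [coe_filter, mem_range, Set.mem_ofPred_eq] at hs ⊢
      have : s ≠ 0 := by rintro rfl; exact h0 hs.2.2
      refine ⟨by omega, by omega, ?_⟩
      rw [← hs.2.2, Nat.gcd_comm, Nat.gcd_comm s, Nat.gcd_self_sub_right hs.1.le]
    · intro s hs
      simp only [coe_filter, mem_range, Set.mem_ofPred_eq] at hs ⊢
      refine ⟨by omega, by omega, ?_⟩
      rw [← hs.2.2, Nat.gcd_comm, Nat.gcd_comm s, Nat.gcd_self_sub_right hs.1.le]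
    · intro s hs
      simp only [coe_filter, mem_range, Set.mem_ofPred_eq] at hs
      exact Nat.sub_sub_self hs.1.le
    · intro s hs
      simp only [coe_filter, mem_range, Set.mem_ofPred_eq] at hs
      exact Nat.sub_sub_self hs.1.le
  rw [two_mul]
  nth_rewrite 2 [h2]
  rw [Nat.totient, ← card_union_of_disjoint, ← filter_or]
  · congr 1
    refine filter_congr fun s _ => ?_
    rw [Nat.coprime_comm, Nat.Coprime]
    constructor
    · tauto
    · intro h
      rcases lt_or_gt_of_ne (hne s h) with h' | h'
      · exact Or.inl ⟨h', h⟩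
      · exact Or.inr ⟨h', h⟩
  · exact disjoint_filter.2 fun s _ h1 h2 => by omega

theorem ncard_range_eq_of_ker_eq {A : Type*} {B : Type*} {C : Type*} (f : A → B) (g : A → C)
    (h : ∀ a b, f a = f b ↔ g a = g b) : (Set.range f).ncard = (Set.range g).ncard := by
  have hk : Setoid.ker f = Setoid.ker g := by
    ext a b
    exact h a b
  rw [← Nat.card_coe_set_eq, ← Nat.card_coe_set_eq,
    ← Nat.card_congr (Setoid.quotientKerEquivRange f),
    ← Nat.card_congr (Setoid.quotientKerEquivRange g), hk]

theorem min_sub_eq_iff {n s t : ℕ} (hs : s < n) (ht : t < n) :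
    min s (n - s) = min t (n - t) ↔ t = s ∨ t = n - s := by
  omega

/-- The number of classes of Lunardon-Polverino linear sets is `φ(n) / 2` times the number of
orbits of the group generated by `p` and `-1` on the residues modulo `q ^ gcd (2, n) - 1` that are
not multiples of `q - 1`. -/
theorem two_mul_numLP_eq {K : Type u} [Field K] {p r n : ℕ} (hp : p.Prime) (hn : 4 ≤ n)
    (hr : 1 ≤ r) (hcard : Nat.card K = (p ^ r) ^ n) {N : ℕ} [NeZero N] {m : ℕ}
    (hMm : lpExp (p ^ r) n * m = (p ^ r) ^ n - 1) (hdvd : p ^ r - 1 ∣ m)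
    (U : (ZMod m)ˣ) (hU : (U : ZMod m) = p) (hUN : U ^ N = 1) :
    2 * numLP K (p ^ r) n = Nat.totient n *
      Nat.card (Quotient (signedPowSetoid U hUN {v : ZMod m | ¬ (p ^ r - 1) ∣ v.val})) := by
  have : Fact p.Prime := ⟨hp⟩
  have : Finite K := Nat.finite_of_card_ne_zero (by rw [hcard]; have := hp.pos; positivity)
  have : CharP K p := by
    have := Fintype.ofFinite K
    refine charP_of_card_eq_prime_pow (f := r * n) ?_
    rw [← Nat.card_eq_fintype_card, hcard, pow_mul]
  obtain ⟨γ, hγ, hord⟩ := exists_generator hcard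
  -- A discrete logarithm to the base `γ`; the value at `0` is arbitrary and is never used.
  have hind : ∀ δ : K, ∃ k : ℕ, δ ≠ 0 → δ = (γ ^ k : Kˣ) := by
    intro δ
    by_cases hδ : δ = 0
    · exact ⟨0, fun h => (h hδ).elim⟩
    · have := hγ (Units.mk0 δ hδ)
      rw [← mem_powers_iff_mem_zpowers] at this
      obtain ⟨k, hk⟩ := this
      exact ⟨k, fun _ => (congrArg Units.val hk).symm⟩
  choose ind hind using hind
  have hq2 := two_le_q (p := p) hr
  set q := p ^ r with hq
  have hqn : 0 < q ^ n - 1 := by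
    have : q ^ 1 ≤ q ^ n := Nat.pow_le_pow_right (by omega) (by omega)
    rw [pow_one] at this
    omega
  have hm0 : 0 < m := Nat.pos_of_ne_zero (by rintro h; rw [h, mul_zero] at hMm; omega)
  have hM0 : 0 < lpExp q n := Nat.pos_of_ne_zero (by rintro h; rw [h, zero_mul] at hMm; omega)
  have : NeZero m := ⟨hm0.ne'⟩
  have hQ : (q ^ n - 1) / (q - 1) * (q - 1) = q ^ n - 1 :=
    Nat.div_mul_cancel (by have := pow_sub_one_dvd_pow_sub_one q (one_dvd n); rwa [pow_one] at this)
  have hpow : ∀ i j : ℕ, ((γ ^ i : Kˣ) : K) = (γ ^ j : Kˣ) ↔ i ≡ j [MOD q ^ n - 1] := by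
    intro i j
    rw [Units.val_inj, pow_eq_pow_iff_modEq, hord]
  have hpow1 : ∀ i : ℕ, ((γ ^ i : Kˣ) : K) = 1 ↔ q ^ n - 1 ∣ i := by
    intro i
    rw [Units.val_eq_one, ← orderOf_dvd_iff_pow_eq_one, hord]
  have hnorm : ∀ k : ℕ, ((γ ^ k : Kˣ) : K) ^ ((q ^ n - 1) / (q - 1)) = 1 ↔ (q - 1) ∣ (k : ZMod m).val := by
    intro k
    rw [← Units.val_pow_eq_pow_val, ← pow_mul, hpow1, ← hQ, mul_comm k,
      Nat.mul_div_cancel _ (by omega), Nat.mul_dvd_mul_iff_left, ZMod.val_natCast,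
      Nat.dvd_mod_iff hdvd]
    exact Nat.pos_of_ne_zero (by rintro h; rw [h, zero_mul] at hQ; omega)
  set V : Set (ZMod m) := {v | ¬ (q - 1) ∣ v.val} with hV
  set S := signedPowSetoid U hUN V with hS
  -- Relations between norms are congruences modulo `q ^ n - 1 = lpExp q n * m` between multiples of
  -- `lpExp q n`, that is, congruences modulo `m` between logarithms.
  have hrel : ∀ k l j : ℕ,
      (((γ ^ l : Kˣ) : K) ^ lpExp q n = (((γ ^ k : Kˣ) : K) ^ lpExp q n) ^ p ^ j ∨
      ((γ ^ l : Kˣ) : K) ^ lpExp q n * (((γ ^ k : Kˣ) : K) ^ lpExp q n) ^ p ^ j = 1) ↔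
      ((l : ZMod m) = (U : ZMod m) ^ j * k ∨ (l : ZMod m) = -((U : ZMod m) ^ j * k)) := by
    intro k l j
    simp only [← Units.val_pow_eq_pow_val, ← Units.val_mul, ← pow_mul, ← pow_add]
    rw [hpow, hpow1, Units.val_pow_eq_pow_val, hU, ← hMm]
    refine or_congr ?_ ?_
    · rw [show k * lpExp q n * p ^ j = lpExp q n * (p ^ j * k) by ring, mul_comm l]
      have : (l : ZMod m) = (p : ZMod m) ^ j * k ↔ ((l : ℕ) : ZMod m) = ((p ^ j * k : ℕ) : ZMod m) := by
        push_cast; rfl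
      rw [this, ZMod.natCast_eq_natCast_iff]
      exact ⟨fun h => Nat.ModEq.mul_left_cancel' hM0.ne' h, fun h => Nat.ModEq.mul_left' _ h⟩
    · rw [show l * lpExp q n + k * lpExp q n * p ^ j = lpExp q n * (l + p ^ j * k) by ring,
        Nat.mul_dvd_mul_iff_left hM0, ← ZMod.natCast_eq_zero_iff, eq_neg_iff_add_eq_zero]
      push_cast
      rfl
  let P := {x : ℕ × K // 1 ≤ x.1 ∧ x.1 < n ∧ Nat.gcd x.1 n = 1 ∧ x.2 ≠ 0 ∧
    x.2 ^ ((q ^ n - 1) / (q - 1)) ≠ 1}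
  have hPV : ∀ x : P, ((ind x.1.2 : ℕ) : ZMod m) ∈ V := by
    intro x h
    have h1 : (q - 1) ∣ (((ind x.1.2 : ℕ) : ZMod m)).val := h
    rw [← hnorm, ← hind _ x.2.2.2.2.1] at h1
    exact x.2.2.2.2.2 h1
  let F : P → Quotient (pGammaLSetoid K) := fun x =>
    Quotient.mk _ (linearSetOf K (lpFun q n x.1.1 x.1.2))
  -- A complete invariant of the class: `s` up to `s ↔ n - s`, and the orbit of the logarithm of
  -- `δ`. These two coordinates vary independently, so the count is a product.
  let G : P → ℕ × Quotient S := fun x =>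
    (min x.1.1 (n - x.1.1), Quotient.mk S ⟨((ind x.1.2 : ℕ) : ZMod m), hPV x⟩)
  have hFG : ∀ x y, F x = F y ↔ G x = G y := by
    intro x y
    have hx := hind _ x.2.2.2.2.1
    have hy := hind _ y.2.2.2.2.1
    have hGiff : G x = G y ↔ (y.1.1 = x.1.1 ∨ y.1.1 = n - x.1.1) ∧ ∃ j : ℕ,
        (((ind y.1.2 : ℕ) : ZMod m) = (U : ZMod m) ^ j * (ind x.1.2 : ℕ) ∨
          ((ind y.1.2 : ℕ) : ZMod m) = -((U : ZMod m) ^ j * (ind x.1.2 : ℕ))) := by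
      rw [Prod.ext_iff, min_sub_eq_iff x.2.2.1 y.2.2.1, Quotient.eq]
      exact and_congr_right fun _ => exists_signedPowHom_iff U hUN _ _
    rw [hGiff, Quotient.eq]
    constructor
    · intro h
      obtain ⟨h1, j, h2⟩ := necessary_relation hn hr hcard x.2.1 x.2.2.1 x.2.2.2.1 y.2.2.1
        y.2.2.2.1 x.2.2.2.2.1 y.2.2.2.2.1 x.2.2.2.2.2 y.2.2.2.2.2 h
      refine ⟨h1, j, (hrel _ _ _).1 ?_⟩
      rw [← hx, ← hy]
      exact h2
    · rintro ⟨h1, j, h2⟩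
      rw [← hrel, ← hx, ← hy] at h2
      exact sufficient_relation hn hr hcard x.2.2.1 x.2.2.2.1 x.2.2.2.2.1
        y.2.2.2.2.1 x.2.2.2.2.2 y.2.2.2.2.2 h1 h2
  have hFrange : Quotient.mk (pGammaLSetoid K) '' lpSets K q n = Set.range F := by
    ext c
    constructor
    · rintro ⟨L, ⟨s, δ, h1, h2, h3, h4, h5, rfl⟩, rfl⟩
      exact ⟨⟨(s, δ), h1, h2, h3, h4, h5⟩, rfl⟩
    · rintro ⟨x, rfl⟩
      exact ⟨_, ⟨x.1.1, x.1.2, x.2.1, x.2.2.1, x.2.2.2.1, x.2.2.2.2.1, x.2.2.2.2.2, rfl⟩, rfl⟩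
  have hGrange : Set.range G =
      (((range n).filter fun s => 2 * s < n ∧ Nat.gcd s n = 1 : Finset ℕ) : Set ℕ) ×ˢ
        (Set.univ : Set (Quotient S)) := by
    ext ⟨s, c⟩
    simp only [Set.mem_range, Set.mem_prod, Set.mem_univ, and_true, coe_filter, mem_range,
      Set.mem_ofPred_eq]
    constructor
    · rintro ⟨x, hx⟩
      have h1 : min x.1.1 (n - x.1.1) = s := congrArg Prod.fst hx
      have h2 := x.2.1
      have h3 := x.2.2.1
      have h4 := x.2.2.2.1
      have h5 : Nat.gcd (n - x.1.1) n = 1 := by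
        rw [Nat.gcd_comm, Nat.gcd_self_sub_right h3.le, Nat.gcd_comm]
        exact h4
      have h6 : Nat.gcd s n = 1 := by
        rcases min_choice x.1.1 (n - x.1.1) with h | h
        · rw [← h1, h]; exact h4
        · rw [← h1, h]; exact h5
      refine ⟨by omega, ?_, h6⟩
      have h7 : 2 * s ≠ n := by
        rintro rfl
        rw [Nat.gcd_mul_left_right] at h6
        omega
      omega
    · rintro ⟨h1, h2, h3⟩
      obtain ⟨⟨v, hv⟩, rfl⟩ := Quotient.exists_rep c
      have hne : ((γ ^ v.val : Kˣ) : K) ≠ 0 := Units.ne_zero _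
      have hs0 : s ≠ 0 := by rintro rfl; rw [Nat.gcd_zero_left] at h3; omega
      have hN : ((γ ^ v.val : Kˣ) : K) ^ ((q ^ n - 1) / (q - 1)) ≠ 1 := by
        intro h
        rw [hnorm, ZMod.natCast_rightInverse v] at h
        exact hv h
      refine ⟨⟨(s, ((γ ^ v.val : Kˣ) : K)), by omega, h1, h3, hne, hN⟩, ?_⟩
      refine Prod.ext ?_ ?_
      · change min s (n - s) = s
        omega
      · change Quotient.mk S _ = Quotient.mk S _
        congr 1
        refine Subtype.ext ?_
        change ((ind ((γ ^ v.val : Kˣ) : K) : ℕ) : ZMod m) = v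
        have h := hind _ hne
        rw [hpow] at h
        rw [← ZMod.natCast_rightInverse v, ZMod.natCast_eq_natCast_iff,
          ZMod.natCast_rightInverse v]
        exact (h.of_dvd (by rw [← hMm]; exact dvd_mul_left _ _)).symm
  rw [numLP, hFrange, ncard_range_eq_of_ker_eq F G hFG, hGrange, Set.ncard_prod,
    Set.ncard_coe_finset, Set.ncard_univ, ← mul_assoc, two_mul_card_coprime_lt_half (by omega)]
end LunardonPolverino

/-! ### The orbit count as a sum of greatest common divisors -/

namespace LunardonPolverino
open Finset

/-- Burnside's count for the number of classes of Lunardon-Polverino linear sets. -/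
theorem numLP_div_mul_eq_sum {K : Type u} [Field K] {p r n : ℕ} (hp : p.Prime) (hn : 4 ≤ n)
    (hr : 1 ≤ r) (hcard : Nat.card K = (p ^ r) ^ n) {N w : ℕ} (hN : N = r * Nat.gcd 2 n)
    (hw : (p ^ r - 1) * w = p ^ N - 1) :
    (numLP K (p ^ r) n : ℝ) / ((Nat.totient n : ℝ) / 2) * (2 * N) =
      ∑ j ∈ range N, (gcdDiff (p ^ j - 1) (p ^ N - 1) w + gcdDiff (p ^ j + 1) (p ^ N - 1) w) := by
  have hN0 : N ≠ 0 := by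
    rw [hN]
    exact mul_ne_zero (by omega) (Nat.gcd_pos_of_pos_left _ two_pos).ne'
  have : NeZero N := ⟨hN0⟩
  have h2 := hp.two_le
  have hpN : 1 < p ^ N := Nat.one_lt_pow hN0 h2
  have hpr : 1 < p ^ r := Nat.one_lt_pow (by omega) h2
  have hw0 : 0 < w := Nat.pos_of_ne_zero (by rintro rfl; omega)
  set m := (p ^ r - 1) * w with hm
  have hcop : p.Coprime m := by
    rw [hw]
    have h1 : (p ^ N).Coprime (p ^ N - 1) :=
      (Nat.coprime_self_sub_right hpN.le).2 (Nat.coprime_one_right _)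
    exact Nat.Coprime.coprime_dvd_left (dvd_pow_self p hN0) h1
  have hU : ((ZMod.unitOfCoprime p hcop : (ZMod m)ˣ) : ZMod m) = p := ZMod.coe_unitOfCoprime p hcop
  have hUN : ZMod.unitOfCoprime p hcop ^ N = 1 := by
    refine Units.ext ?_
    have h1 : ((p ^ N : ℕ) : ZMod m) = ((m + 1 : ℕ) : ZMod m) := by
      congr 1
      omega
    rw [Units.val_pow_eq_pow_val, hU, Units.val_one]
    push_cast at h1
    rw [h1, ZMod.natCast_self, zero_add]
  have hMm : lpExp (p ^ r) n * m = (p ^ r) ^ n - 1 := by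
    rw [hw, hN, pow_mul, lpExp_mul]
  have h1 := two_mul_numLP_eq hp hn hr hcard hMm (dvd_mul_right _ _) _ hU hUN
  have h3 := card_signedPow_orbits (a := p ^ r - 1) (w := w) (by omega) hw0 hp.pos _ hU hUN
  rw [← hw, ← h3]
  have hφ : (0 : ℝ) < Nat.totient n := by exact_mod_cast Nat.totient_pos.2 (by omega)
  have h1' : 2 * (numLP K (p ^ r) n : ℝ) = Nat.totient n *
      Nat.card (Quotient (signedPowSetoid _ hUN {v : ZMod m | ¬ (p ^ r - 1) ∣ v.val})) := by
    exact_mod_cast h1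
  congr 1
  rw [div_eq_iff (by positivity)]
  linarith
end LunardonPolverino

/-! ### Common divisors of `p ^ j + 1` and `p ^ N - 1`, and sums over `gcd (j, N)` -/

namespace LunardonPolverino
open Finset

theorem zmod_gcd_pow_eq {p : ℕ} (hp : 0 < p) (j N : ℕ) :
    ((p : ZMod (Nat.gcd (p ^ j + 1) (p ^ N - 1))) ^ j = -1) ∧
      ((p : ZMod (Nat.gcd (p ^ j + 1) (p ^ N - 1))) ^ N = 1) := by
  set G := Nat.gcd (p ^ j + 1) (p ^ N - 1)
  have h1 : ((p ^ j + 1 : ℕ) : ZMod G) = 0 := (ZMod.natCast_eq_zero_iff _ _).2 (Nat.gcd_dvd_left _ _)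
  have h2 : ((p ^ N - 1 : ℕ) : ZMod G) = 0 :=
    (ZMod.natCast_eq_zero_iff _ _).2 (Nat.gcd_dvd_right _ _)
  constructor
  · rw [eq_neg_iff_add_eq_zero]
    exact_mod_cast h1
  · have h3 : ((p ^ N - 1 + 1 : ℕ) : ZMod G) = 1 := by rw [Nat.cast_add, h2, Nat.cast_one, zero_add]
    rw [Nat.sub_add_cancel (Nat.one_le_pow _ _ hp)] at h3
    exact_mod_cast h3

theorem dvd_two_of_one_eq_neg_one {G : ℕ} (h : (1 : ZMod G) = -1) : G ∣ 2 := by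
  rw [← ZMod.natCast_eq_zero_iff]
  have : (1 : ZMod G) + 1 = 0 := eq_neg_iff_add_eq_zero.1 h
  push_cast
  rw [← this]
  norm_num

/-- Modulo the common divisor `p ^ j = -1` and `p ^ N = 1`. Evaluating `p` to the power `lcm (j, N)`
in both ways gives `-1 = 1`. -/
theorem gcd_pow_add_one_dvd_two {p j N : ℕ} (hp : 0 < p) (hodd : Odd (N / Nat.gcd j N)) :
    Nat.gcd (p ^ j + 1) (p ^ N - 1) ∣ 2 := by
  obtain ⟨h1, h2⟩ := zmod_gcd_pow_eq hp j N
  apply dvd_two_of_one_eq_neg_one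
  have e : j * (N / Nat.gcd j N) = N * (j / Nat.gcd j N) := by
    rw [← Nat.mul_div_assoc _ (Nat.gcd_dvd_right _ _), ← Nat.mul_div_assoc _ (Nat.gcd_dvd_left _ _),
      mul_comm]
  have h3 := congrArg (· ^ (N / Nat.gcd j N)) h1
  simp only [← pow_mul, hodd.neg_one_pow] at h3
  rw [e, pow_mul, h2, one_pow] at h3
  exact h3

/-- Write `gcd (j, N)` as `j a` modulo `N`. Since `N / gcd (j, N)` is even, `a` must be odd, and `p
^ gcd (j, N) = (-1) ^ a = -1` modulo the common divisor. -/
theorem gcd_pow_add_one_dvd_pow_gcd_add_one {p j N : ℕ} (hp : 0 < p) (hN : 0 < N)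
    (heven : Even (N / Nat.gcd j N)) :
    Nat.gcd (p ^ j + 1) (p ^ N - 1) ∣ p ^ Nat.gcd j N + 1 := by
  obtain ⟨h1, h2⟩ := zmod_gcd_pow_eq hp j N
  have hd : 0 < Nat.gcd j N := Nat.gcd_pos_of_pos_right _ hN
  have hlt : Nat.gcd j N < N := by
    refine lt_of_le_of_ne (Nat.gcd_le_right _ hN) fun h => ?_
    rw [h, Nat.div_self hN] at heven
    exact absurd heven (by decide)
  obtain ⟨a, -, ha⟩ := Nat.exists_mul_mod_eq_gcd hlt
  have haodd : Odd a := by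
    by_contra hc
    rw [Nat.not_odd_iff_even] at hc
    have h3 : Nat.gcd j N * 2 ∣ N := by
      obtain ⟨t, ht⟩ := heven.two_dvd
      refine ⟨t, ?_⟩
      rw [mul_assoc, ← ht, Nat.mul_div_cancel' (Nat.gcd_dvd_right _ _)]
    have h4 : Nat.gcd j N * 2 ∣ j * a := mul_dvd_mul (Nat.gcd_dvd_left _ _) hc.two_dvd
    rw [← Nat.dvd_mod_iff h3, ha] at h4
    have := Nat.le_of_dvd hd h4
    omega
  rw [← ZMod.natCast_eq_zero_iff]
  push_cast
  rw [← eq_neg_iff_add_eq_zero, ← ha, ← haodd.neg_one_pow, ← h1, ← pow_mul]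
  conv_rhs => rw [← Nat.mod_add_div (j * a) N, pow_add, pow_mul _ N, h2, one_pow, mul_one]

theorem not_two_dvd_of_dvd_pow_sub_one {p N G : ℕ} (hp : 2 ∣ p) (hN : 0 < N) (h0 : 0 < p)
    (h : G ∣ p ^ N - 1) : ¬ 2 ∣ G := by
  intro h2
  have h3 := h2.trans h
  have h4 : 2 ∣ p ^ N := dvd_pow hp hN.ne'
  have := Nat.one_le_pow N p h0
  omega

theorem two_dvd_pow_add_one {p : ℕ} (hp : ¬ 2 ∣ p) (j : ℕ) : 2 ∣ p ^ j + 1 := by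
  have h1 : Odd p := Nat.odd_iff.2 (by omega)
  exact (h1.pow (n := j)).add_one.two_dvd

/-- Raising `p ^ j = -1` to the odd power `r / gcd (j, r)` makes a multiple of `r` an exponent with
value `-1`. If that multiple is odd, then `p ^ r = -1`; if it is even, then `1 = -1`, and the common
divisor is at most `2` and still divides `p ^ r + 1`. -/
theorem gcd_pow_add_one_dvd_gcd {p j r : ℕ} (hp : 0 < p) (hr : 0 < r)
    (hodd : Odd (r / Nat.gcd j r)) :
    Nat.gcd (p ^ j + 1) (p ^ (2 * r) - 1) ∣ Nat.gcd (p ^ j + 1) (p ^ r + 1) := by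
  refine Nat.dvd_gcd (Nat.gcd_dvd_left _ _) ?_
  obtain ⟨h1, h2⟩ := zmod_gcd_pow_eq hp j (2 * r)
  set G := Nat.gcd (p ^ j + 1) (p ^ (2 * r) - 1) with hG
  have e : j * (r / Nat.gcd j r) = r * (j / Nat.gcd j r) := by
    rw [← Nat.mul_div_assoc _ (Nat.gcd_dvd_right _ _), ← Nat.mul_div_assoc _ (Nat.gcd_dvd_left _ _),
      mul_comm]
  have h3 := congrArg (· ^ (r / Nat.gcd j r)) h1
  simp only [← pow_mul, hodd.neg_one_pow] at h3
  rw [e] at h3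
  rcases Nat.even_or_odd' (j / Nat.gcd j r) with ⟨t, ht | ht⟩
  · rw [ht, show r * (2 * t) = 2 * r * t by ring, pow_mul, h2, one_pow] at h3
    have h4 := dvd_two_of_one_eq_neg_one h3
    by_cases hp2 : 2 ∣ p
    · have h5 : ¬ 2 ∣ G := not_two_dvd_of_dvd_pow_sub_one hp2 (by omega) hp (Nat.gcd_dvd_right _ _)
      rcases (Nat.dvd_prime Nat.prime_two).1 h4 with h | h
      · rw [h]; exact one_dvd _
      · exact (h5 h.symm.dvd).elim
    · exact h4.trans (two_dvd_pow_add_one hp2 r)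
  · rw [ht, show r * (2 * t + 1) = 2 * r * t + r by ring, pow_add, pow_mul, h2, one_pow,
      one_mul] at h3
    rw [← ZMod.natCast_eq_zero_iff]
    push_cast
    rw [h3, neg_add_cancel]

theorem gcd_two_mul_of_even_div {j r : ℕ} (hr : 0 < r) (heven : Even (r / Nat.gcd j r)) :
    Nat.gcd j (2 * r) = Nat.gcd j r := by
  have hd : 0 < Nat.gcd j r := Nat.gcd_pos_of_pos_right _ hr
  have h1 : Nat.gcd j (2 * r) = Nat.gcd j r * Nat.gcd (j / Nat.gcd j r) (2 * (r / Nat.gcd j r)) := by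
    rw [← Nat.gcd_mul_left, Nat.mul_div_cancel' (Nat.gcd_dvd_left _ _), mul_left_comm,
      Nat.mul_div_cancel' (Nat.gcd_dvd_right _ _)]
  have h2 := Nat.coprime_div_gcd_div_gcd hd
  have h3 : Nat.Coprime (j / Nat.gcd j r) 2 := h2.coprime_dvd_right heven.two_dvd
  have h4 : Nat.Coprime (j / Nat.gcd j r) (2 * (r / Nat.gcd j r)) := h3.mul_right h2
  rw [h1, h4.gcd_eq_one, mul_one]

theorem two_mul_totient_le {m : ℕ} (hm : Even m) : 2 * Nat.totient m ≤ m := by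
  obtain ⟨k, rfl⟩ := hm.two_dvd
  clear hm
  induction k using Nat.strong_induction_on with
  | _ k ih =>
    rcases Nat.even_or_odd k with hk | hk
    · rcases Nat.eq_zero_or_pos k with rfl | h0
      · simp
      obtain ⟨l, rfl⟩ := hk.two_dvd
      rw [Nat.totient_two_mul_of_even hk]
      have := ih l (by omega)
      omega
    · rw [Nat.totient_two_mul_of_odd hk]
      have := Nat.totient_le k
      omega

/-- The number of `0 < j < N` that are not prime to `N` is at most the sum of the divisors of `N`
other than `1` and `N`. -/
theorem sub_totient_le_sigma {N : ℕ} (hN : 2 ≤ N) :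
    2 * N ≤ ArithmeticFunction.sigma 1 N + Nat.totient N := by
  have h1 : ∑ d ∈ N.divisors, Nat.totient d = N := Nat.sum_totient N
  have h2 : ArithmeticFunction.sigma 1 N = ∑ d ∈ N.divisors, d := by
    rw [ArithmeticFunction.sigma_one_apply]
  have hmem : N ∈ N.divisors := Nat.mem_divisors_self N (by omega)
  rw [h2]
  rw [← Finset.add_sum_erase _ _ hmem] at h1 ⊢
  have h3 : ∑ d ∈ N.divisors.erase N, Nat.totient d ≤ ∑ d ∈ N.divisors.erase N, d :=
    Finset.sum_le_sum fun d _ => Nat.totient_le d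
  omega

theorem card_filter_gcd_eq_one {N : ℕ} :
    ((range N).filter fun j => Nat.gcd j N = 1).card = Nat.totient N := by
  rw [Nat.totient]
  congr 1
  refine filter_congr fun j _ => ?_
  rw [Nat.coprime_comm, Nat.Coprime]

/-- The index `0` contributes `f N`, the indices prime to `N` contribute `f 1` each, and the others
involve proper divisors larger than `1`. -/
theorem sum_gcd_le {N : ℕ} (hN : 2 ≤ N) (f : ℕ → ℝ) {M : ℝ}
    (hf : ∀ e, e ∣ N → 1 < e → e < N → f e ≤ M) :
    ∑ j ∈ range N, f (Nat.gcd j N) ≤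
      f N + Nat.totient N * f 1 + ((N : ℝ) - 1 - Nat.totient N) * M := by
  have h0 : (0 : ℕ) ∈ range N := mem_range.2 (by omega)
  have h1 : ∀ j ∈ (range N).erase 0, f (Nat.gcd j N) ≤
      M + if Nat.gcd j N = 1 then f 1 - M else 0 := by
    intro j hj
    rw [mem_erase, mem_range] at hj
    split_ifs with h
    · rw [h]; linarith
    · rw [add_zero]
      have hpos : 0 < Nat.gcd j N := Nat.gcd_pos_of_pos_right _ (by omega)
      exact hf _ (Nat.gcd_dvd_right _ _) (by omega)
        ((Nat.gcd_le_left _ (by omega)).trans_lt hj.2)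
  have h2 : ∑ j ∈ range N, (if Nat.gcd j N = 1 then f 1 - M else 0) =
      Nat.totient N * (f 1 - M) := by
    rw [← sum_filter, sum_const, card_filter_gcd_eq_one, nsmul_eq_mul]
  rw [← Finset.add_sum_erase _ _ h0, if_neg (by rw [Nat.gcd_zero_left]; omega), zero_add] at h2
  rw [← Finset.add_sum_erase _ _ h0, Nat.gcd_zero_left]
  have h3 := Finset.sum_le_sum h1
  rw [sum_add_distrib, h2, sum_const, card_erase_of_mem h0, card_range, nsmul_eq_mul,
    Nat.cast_sub (by omega), Nat.cast_one] at h3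
  linarith

theorem gcd_eq_half_iff {N j : ℕ} (hj0 : j ≠ 0) (hj : j < 2 * N) :
    Nat.gcd j (2 * N) = N ↔ j = N := by
  constructor
  · intro h
    obtain ⟨t, ht⟩ : N ∣ j := h ▸ Nat.gcd_dvd_left j (2 * N)
    have : t < 2 := by
      by_contra hc
      have : N * 2 ≤ N * t := Nat.mul_le_mul_left _ (by omega)
      omega
    interval_cases t <;> omega
  · rintro rfl
    exact Nat.gcd_mul_left_right 2 j

theorem sum_gcd_two_mul_le {N : ℕ} (hN : 2 ≤ N) (f : ℕ → ℝ) {M : ℝ}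
    (hf : ∀ e, e ∣ 2 * N → 1 < e → e < N → f e ≤ M) :
    ∑ j ∈ range (2 * N), f (Nat.gcd j (2 * N)) ≤
      f (2 * N) + f N + Nat.totient (2 * N) * f 1 +
        ((2 * N : ℝ) - 2 - Nat.totient (2 * N)) * M := by
  -- Only the index `j = N` has greatest common divisor `N` with `2 * N`. Its value is lowered or
  -- raised to `M` here and restored afterwards.
  have h1 := sum_gcd_le (N := 2 * N) (by omega) (fun e => if e = N then M else f e) (M := M)
    (fun e he h1 h2 => by
      split_ifs with h
      · exact le_rfl
      · refine hf e he h1 ?_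
        obtain ⟨t, ht⟩ := he
        have ht2 : 2 ≤ t := by
          by_contra hc
          interval_cases t <;> omega
        have : e * 2 ≤ e * t := Nat.mul_le_mul_left _ ht2
        omega)
  have hmem : N ∈ range (2 * N) := mem_range.2 (by omega)
  rw [← Finset.add_sum_erase _ _ hmem] at h1 ⊢
  have h2 : ∑ j ∈ (range (2 * N)).erase N, (if Nat.gcd j (2 * N) = N then M else f (Nat.gcd j (2 * N)))
      = ∑ j ∈ (range (2 * N)).erase N, f (Nat.gcd j (2 * N)) := by
    refine sum_congr rfl fun j hj => ?_
    rw [mem_erase, mem_range] at hj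
    rw [if_neg]
    intro h
    rcases Nat.eq_zero_or_pos j with rfl | h0
    · rw [Nat.gcd_zero_left] at h; omega
    · exact hj.1 ((gcd_eq_half_iff (by omega) hj.2).1 h)
  simp only [h2] at h1
  rw [Nat.gcd_mul_left_right] at h1 ⊢
  rw [if_pos rfl, if_neg (by omega), if_neg (by omega)] at h1
  push_cast at h1
  linarith
end LunardonPolverino

/-! ### Explicit sums for odd and even `n` -/

namespace LunardonPolverino
open Finset

/-- The greatest common divisor of all `p ^ j + 1` and `p ^ j - 1`: `1` for even `p` and `2` for
odd `p`. -/
def parityGcd (p : ℕ) : ℕ := Nat.gcd 2 (p - 1)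

theorem parityGcd_cases {p : ℕ} (hp : p.Prime) :
    (p = 2 ∧ parityGcd p = 1) ∨ (3 ≤ p ∧ parityGcd p = 2) := by
  rcases hp.eq_two_or_odd' with rfl | h
  · exact Or.inl ⟨rfl, rfl⟩
  · refine Or.inr ⟨?_, Nat.gcd_eq_left ?_⟩
    · have := hp.two_le
      rcases h with ⟨k, rfl⟩
      omega
    · exact (Nat.Odd.sub_odd h odd_one).two_dvd

theorem parityGcd_dvd_pow_sub_one (p j : ℕ) : parityGcd p ∣ p ^ j - 1 := by
  refine (Nat.gcd_dvd_right _ _).trans ?_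
  have := pow_sub_one_dvd_pow_sub_one p (one_dvd j)
  rwa [pow_one] at this

theorem parityGcd_dvd_pow_add_one {p : ℕ} (hp : 0 < p) (j : ℕ) : parityGcd p ∣ p ^ j + 1 := by
  have h : p ^ j + 1 = p ^ j - 1 + 2 := by
    have := Nat.one_le_pow j p hp
    omega
  rw [h]
  exact dvd_add (parityGcd_dvd_pow_sub_one p j) (Nat.gcd_dvd_left _ _)

theorem parityGcd_pos (p : ℕ) : 0 < parityGcd p := Nat.gcd_pos_of_pos_left _ two_pos

theorem pow_sub_one_pos {p N : ℕ} (hp : 2 ≤ p) (hN : 0 < N) : 0 < p ^ N - 1 :=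
  Nat.sub_pos_of_lt (Nat.one_lt_pow hN.ne' hp)

theorem parityGcd_le_gcd {p : ℕ} (hp : 2 ≤ p) (j N : ℕ) :
    parityGcd p ≤ Nat.gcd (p ^ j + 1) (p ^ N - 1) :=
  Nat.le_of_dvd (Nat.gcd_pos_of_pos_left _ (by omega))
    (Nat.dvd_gcd (parityGcd_dvd_pow_add_one (by omega) j) (parityGcd_dvd_pow_sub_one p N))

theorem gcd_eq_parityGcd {p j N : ℕ} (hp : p.Prime) (hN : 0 < N) (hodd : Odd (N / Nat.gcd j N)) :
    Nat.gcd (p ^ j + 1) (p ^ N - 1) = parityGcd p := by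
  refine le_antisymm ?_ (parityGcd_le_gcd hp.two_le j N)
  have h := gcd_pow_add_one_dvd_two hp.pos hodd
  rcases parityGcd_cases hp with ⟨rfl, h2⟩ | ⟨-, h2⟩
  · rw [h2]
    rcases (Nat.dvd_prime Nat.prime_two).1 h with h' | h'
    · exact h'.le
    · exact (not_two_dvd_of_dvd_pow_sub_one dvd_rfl hN two_pos (Nat.gcd_dvd_right _ _)
        h'.symm.dvd).elim
  · rw [h2]
    exact Nat.le_of_dvd two_pos h

theorem gcd_le_pow_gcd_add_one {p j N : ℕ} (hp : p.Prime) (hN : 0 < N) :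
    Nat.gcd (p ^ j + 1) (p ^ N - 1) ≤ p ^ Nat.gcd j N + 1 := by
  refine Nat.le_of_dvd (by omega) ?_
  rcases Nat.even_or_odd (N / Nat.gcd j N) with h | h
  · exact gcd_pow_add_one_dvd_pow_gcd_add_one hp.pos hN h
  · rw [gcd_eq_parityGcd hp hN h]
    exact parityGcd_dvd_pow_add_one hp.pos _

theorem eps_of_odd {p n : ℕ} (hp : p.Prime) (hn : Odd n) :
    eps p n = ((parityGcd p : ℝ) - 1) * ((p : ℝ) - 1) / 2 := by
  rcases parityGcd_cases hp with ⟨rfl, h2⟩ | ⟨h1, h2⟩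
  · rw [eps, if_pos rfl, h2]; norm_num
  · rw [eps, if_neg (by omega), if_pos hn, h2]; norm_num

theorem eps_of_even {p n : ℕ} (hp : p.Prime) (hn : Even n) :
    eps p n = ((parityGcd p : ℝ) - 1) * ((p : ℝ) - 3) / 2 := by
  rcases parityGcd_cases hp with ⟨rfl, h2⟩ | ⟨h1, h2⟩
  · rw [eps, if_pos rfl, h2]; norm_num
  · rw [eps, if_neg (by omega), if_neg (Nat.not_odd_iff_even.2 hn), h2]; norm_num

theorem cast_gcd_pow_sub_one {p : ℕ} (hp : 0 < p) (j N : ℕ) :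
    (Nat.gcd (p ^ j - 1) (p ^ N - 1) : ℝ) = (p : ℝ) ^ Nat.gcd j N - 1 := by
  rw [Nat.pow_sub_one_gcd_pow_sub_one, Nat.cast_sub (Nat.one_le_pow _ _ hp)]
  push_cast
  rfl

/-- For odd `n` the modulus is `p ^ r - 1` itself, so only the zero residue is excluded and each
subtracted divisor is `1`. -/
theorem numLP_of_odd {K : Type u} [Field K] {p r n : ℕ} (hp : p.Prime) (hn : 4 ≤ n)
    (hodd : Odd n) (hr : 1 ≤ r) (hcard : Nat.card K = (p ^ r) ^ n) :
    (numLP K (p ^ r) n : ℝ) / ((Nat.totient n : ℝ) / 2) * (2 * r) =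
      ∑ j ∈ range r, ((p : ℝ) ^ Nat.gcd j r - 3 + Nat.gcd (p ^ j + 1) (p ^ r - 1)) := by
  rw [numLP_div_mul_eq_sum hp hn hr hcard (N := r) (w := 1)
    (by rw [(Nat.coprime_two_left.2 hodd : Nat.gcd 2 n = 1), mul_one]) (mul_one _)]
  refine sum_congr rfl fun j _ => ?_
  rw [gcdDiff, gcdDiff, cast_gcd_pow_sub_one hp.pos, Nat.gcd_one_right, Nat.gcd_one_right]
  push_cast
  ring

theorem numLP_of_even {K : Type u} [Field K] {p r n : ℕ} (hp : p.Prime) (hn : 4 ≤ n)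
    (heven : Even n) (hr : 1 ≤ r) (hcard : Nat.card K = (p ^ r) ^ n) :
    (numLP K (p ^ r) n : ℝ) / ((Nat.totient n : ℝ) / 2) * (4 * r) =
      ∑ j ∈ range (2 * r), ((p : ℝ) ^ Nat.gcd j (2 * r) - 1 - Nat.gcd (p ^ j - 1) (p ^ r + 1) +
        Nat.gcd (p ^ j + 1) (p ^ (2 * r) - 1) - Nat.gcd (p ^ j + 1) (p ^ r + 1)) := by
  have hw : (p ^ r - 1) * (p ^ r + 1) = p ^ (2 * r) - 1 := by
    have h := Nat.sq_sub_sq (p ^ r) 1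
    rw [one_pow] at h
    rw [mul_comm 2 r, pow_mul, h, mul_comm]
  have h := numLP_div_mul_eq_sum hp hn hr hcard (N := 2 * r) (w := p ^ r + 1)
    (by rw [Nat.gcd_eq_left heven.two_dvd, mul_comm]) hw
  rw [show (2 * ((2 * r : ℕ) : ℝ)) = 4 * r by push_cast; ring] at h
  rw [h]
  refine sum_congr rfl fun j _ => ?_
  rw [gcdDiff, gcdDiff, cast_gcd_pow_sub_one hp.pos]
  ring

theorem natCast_pow_le_rpow {p e : ℕ} (hp : 0 < p) {x : ℝ} (h : (e : ℝ) ≤ x) :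
    (p : ℝ) ^ e ≤ (p : ℝ) ^ x := by
  rw [← Real.rpow_natCast]
  exact Real.rpow_le_rpow_of_exponent_le (by exact_mod_cast hp) h

theorem natCast_pow_div_rpow {p : ℕ} (hp : 0 < p) (k : ℕ) (x : ℝ) :
    (p : ℝ) ^ k / (p : ℝ) ^ x = (p : ℝ) ^ ((k : ℝ) - x) := by
  rw [Real.rpow_sub (by exact_mod_cast hp), Real.rpow_natCast]

theorem cast_sub_totient_le_sigma {N : ℕ} (hN : 2 ≤ N) :
    (N : ℝ) - 1 - Nat.totient N ≤ (ArithmeticFunction.sigma 1 N : ℝ) - N - 1 := by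
  have : (2 * N : ℝ) ≤ ArithmeticFunction.sigma 1 N + Nat.totient N := by
    exact_mod_cast sub_totient_le_sigma hN
  linarith

theorem sigma_sub_nonneg {N : ℕ} (hN : 2 ≤ N) :
    0 ≤ (ArithmeticFunction.sigma 1 N : ℝ) - N - 1 := by
  refine le_trans ?_ (cast_sub_totient_le_sigma hN)
  have h : (Nat.totient N : ℝ) + 1 ≤ N := by exact_mod_cast Nat.totient_lt N (by omega)
  linarith

theorem le_div_minFac_of_dvd {e r : ℕ} (he : e ∣ r) (her : e < r) : (e : ℝ) ≤ r / r.minFac := by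
  obtain ⟨t, ht⟩ := he
  have h1 : t ≠ 1 := by rintro rfl; omega
  have h2 : r.minFac ≤ t := by
    refine Nat.minFac_le_of_dvd (by
      rcases Nat.eq_zero_or_pos t with rfl | h
      · omega
      · omega) ⟨e, by rw [ht, mul_comm]⟩
  have h3 : 0 < r.minFac := Nat.minFac_pos r
  rw [le_div_iff₀ (by exact_mod_cast h3)]
  have : e * r.minFac ≤ r := by
    conv_rhs => rw [ht]
    exact Nat.mul_le_mul_left _ h2
  exact_mod_cast this
end LunardonPolverino

/-! ### Estimates of the orbit sum for odd `n` -/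

namespace LunardonPolverino
open Finset

section OddExponent

variable {p r : ℕ}

theorem sum_odd_of_odd (hp : p.Prime) (hr : Odd r) :
    ∑ j ∈ range r, ((p : ℝ) ^ Nat.gcd j r - 3 + Nat.gcd (p ^ j + 1) (p ^ r - 1)) =
      ∑ j ∈ range r, (p : ℝ) ^ Nat.gcd j r + r * (parityGcd p - 3) := by
  have h : (r : ℝ) * (parityGcd p - 3) = ∑ _j ∈ range r, ((parityGcd p : ℝ) - 3) := by
    rw [sum_const, card_range, nsmul_eq_mul]
  rw [h, ← sum_add_distrib]
  refine sum_congr rfl fun j _ => ?_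
  rw [gcd_eq_parityGcd hp hr.pos (hr.of_dvd_nat (Nat.div_dvd_of_dvd (Nat.gcd_dvd_right _ _)))]
  ring

theorem odd_term_ge (hp : p.Prime) (hr : 0 < r) (j : ℕ) :
    (p : ℝ) - 3 + parityGcd p ≤
      (p : ℝ) ^ Nat.gcd j r - 3 + Nat.gcd (p ^ j + 1) (p ^ r - 1) := by
  have h1 : (parityGcd p : ℝ) ≤ Nat.gcd (p ^ j + 1) (p ^ r - 1) := by
    exact_mod_cast parityGcd_le_gcd hp.two_le j r
  have h2 : p ≤ p ^ Nat.gcd j r := Nat.le_self_pow (Nat.gcd_pos_of_pos_right _ hr).ne' p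
  have h3 : (p : ℝ) ≤ (p : ℝ) ^ Nat.gcd j r := by exact_mod_cast h2
  linarith

theorem odd_zero_term (hp : p.Prime) (hr : 0 < r) :
    (p : ℝ) ^ Nat.gcd 0 r - 3 + Nat.gcd (p ^ 0 + 1) (p ^ r - 1) = (p : ℝ) ^ r - 3 + parityGcd p := by
  rw [gcd_eq_parityGcd hp hr (by rw [Nat.gcd_zero_left, Nat.div_self hr]; exact odd_one),
    Nat.gcd_zero_left]

/-- All terms satisfy the lower bound of `odd_term_ge`. Strictness needs one better index: `j = 1`
when `r = 2`, where the common divisor is `p + 1`, and `j = r.minFac` when `r` is composite. -/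
theorem sum_odd_gt (hp : p.Prime) (hr : 1 < r) (h : ¬ (Odd r ∧ r.Prime)) :
    (p : ℝ) ^ r - p + r * ((p : ℝ) - 3 + parityGcd p) <
      ∑ j ∈ range r, ((p : ℝ) ^ Nat.gcd j r - 3 + Nat.gcd (p ^ j + 1) (p ^ r - 1)) := by
  have h0 : (0 : ℕ) ∈ range r := mem_range.2 (by omega)
  rw [← Finset.add_sum_erase _ _ h0, odd_zero_term hp (by omega)]
  have hlt : ∑ _j ∈ (range r).erase 0, ((p : ℝ) - 3 + parityGcd p) <
      ∑ j ∈ (range r).erase 0,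
        ((p : ℝ) ^ Nat.gcd j r - 3 + Nat.gcd (p ^ j + 1) (p ^ r - 1)) := by
    refine Finset.sum_lt_sum (fun j _ => odd_term_ge hp (by omega) j) ?_
    by_cases hpr : r.Prime
    · have hr2 : r = 2 := by
        rcases hpr.eq_two_or_odd' with h' | h'
        · exact h'
        · exact (h ⟨h', hpr⟩).elim
      subst hr2
      refine ⟨1, by simp, ?_⟩
      have h1 : Nat.gcd (p ^ 1 + 1) (p ^ 2 - 1) = p + 1 := by
        have h2 := Nat.sq_sub_sq p 1
        rw [one_pow] at h2
        rw [pow_one, h2, Nat.gcd_mul_right_right]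
      rw [h1, Nat.gcd_one_left]
      have h3 := parityGcd_cases hp
      have h4 : parityGcd p < p + 1 := by omega
      have h5 : (parityGcd p : ℝ) < p + 1 := by exact_mod_cast h4
      push_cast
      linarith
    · have h1 : r.minFac < r := (Nat.not_prime_iff_minFac_lt (by omega)).1 hpr
      have h2 : 1 < r.minFac := (Nat.minFac_prime (by omega)).one_lt
      refine ⟨r.minFac, mem_erase.2 ⟨by omega, mem_range.2 h1⟩, ?_⟩
      rw [Nat.gcd_eq_left (Nat.minFac_dvd r)]
      have h3 : (parityGcd p : ℝ) ≤ Nat.gcd (p ^ r.minFac + 1) (p ^ r - 1) := by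
        exact_mod_cast parityGcd_le_gcd hp.two_le _ r
      have h4 : p ^ 1 < p ^ r.minFac := Nat.pow_lt_pow_right hp.one_lt h2
      have h5 : (p : ℝ) < (p : ℝ) ^ r.minFac := by
        rw [pow_one] at h4
        exact_mod_cast h4
      linarith
  rw [sum_const, card_erase_of_mem h0, card_range, nsmul_eq_mul, Nat.cast_sub (by omega),
    Nat.cast_one] at hlt
  linarith

theorem sum_pow_gcd_of_prime (hr : r.Prime) :
    ∑ j ∈ range r, (p : ℝ) ^ Nat.gcd j r = (p : ℝ) ^ r + (r - 1) * p := by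
  have h0 : (0 : ℕ) ∈ range r := mem_range.2 hr.pos
  rw [← Finset.add_sum_erase _ _ h0, Nat.gcd_zero_left]
  congr 1
  have h : ∀ j ∈ (range r).erase 0, (p : ℝ) ^ Nat.gcd j r = p := by
    intro j hj
    rw [mem_erase, mem_range] at hj
    have : Nat.gcd j r = 1 := by
      rw [Nat.gcd_comm]
      exact (Nat.Prime.coprime_iff_not_dvd hr).2 fun h => by
        have := Nat.le_of_dvd (by omega) h
        omega
    rw [this, pow_one]
  rw [sum_congr rfl h, sum_const, card_erase_of_mem h0, card_range, nsmul_eq_mul,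
    Nat.cast_sub hr.one_le, Nat.cast_one]

theorem sum_pow_gcd_le (hp : p.Prime) (hr : 2 ≤ r) :
    ∑ j ∈ range r, (p : ℝ) ^ Nat.gcd j r ≤ (p : ℝ) ^ r + Nat.totient r * p +
      ((ArithmeticFunction.sigma 1 r : ℝ) - r - 1) * (p : ℝ) ^ ((r : ℝ) / r.minFac) := by
  refine (sum_gcd_le hr (fun e => (p : ℝ) ^ e) (M := (p : ℝ) ^ ((r : ℝ) / r.minFac))
    fun e he _ her => natCast_pow_le_rpow hp.pos (le_div_minFac_of_dvd he her)).trans ?_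
  have h1 := mul_le_mul_of_nonneg_right (cast_sub_totient_le_sigma hr)
    (Real.rpow_nonneg (Nat.cast_nonneg p) ((r : ℝ) / r.minFac))
  simp only [pow_one]
  linarith

theorem exists_gcd_two_pow {s j : ℕ} (hj0 : 0 < j) (hj : j < 2 ^ s) :
    ∃ i < s, Nat.gcd j (2 ^ s) = 2 ^ i := by
  obtain ⟨i, hi, h⟩ := (Nat.dvd_prime_pow Nat.prime_two).1 (Nat.gcd_dvd_right j (2 ^ s))
  refine ⟨i, lt_of_le_of_ne hi ?_, h⟩
  rintro rfl
  have := Nat.gcd_le_left (2 ^ i) hj0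
  omega

theorem pow_gcd_two_pow_le {s j : ℕ} (hj0 : 0 < j) (hj : j < 2 ^ s) :
    (p : ℝ) ^ Nat.gcd j (2 ^ s) ≤ ∑ i ∈ range s, (p : ℝ) ^ (2 ^ i) := by
  obtain ⟨i, hi, h⟩ := exists_gcd_two_pow hj0 hj
  rw [h]
  exact Finset.single_le_sum (f := fun i => (p : ℝ) ^ (2 ^ i)) (fun _ _ => by positivity)
    (mem_range.2 hi)

theorem odd_term_le (hp : p.Prime) (hr : 0 < r) (j : ℕ) :
    (p : ℝ) ^ Nat.gcd j r - 3 + Nat.gcd (p ^ j + 1) (p ^ r - 1) ≤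
      2 * (p : ℝ) ^ Nat.gcd j r - 2 := by
  have h1 : (Nat.gcd (p ^ j + 1) (p ^ r - 1) : ℝ) ≤ (p : ℝ) ^ Nat.gcd j r + 1 := by
    exact_mod_cast gcd_le_pow_gcd_add_one (j := j) hp hr
  linarith

theorem parityGcd_le_two (p : ℕ) : parityGcd p ≤ 2 := Nat.gcd_le_left _ two_pos

/-- For `j ≠ 0` the divisor `gcd (j, r)` is a smaller power of two, so each of the `r - 1` terms is
at most twice the whole tower sum. -/
theorem sum_odd_two_pow_lt (hp : p.Prime) {s : ℕ} (hs : r = 2 ^ s) (hr : 1 < r) :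
    ∑ j ∈ range r, ((p : ℝ) ^ Nat.gcd j r - 3 + Nat.gcd (p ^ j + 1) (p ^ r - 1)) <
      (p : ℝ) ^ r + 2 * r * ∑ i ∈ range s, (p : ℝ) ^ (2 ^ i) := by
  have h0 : (0 : ℕ) ∈ range r := mem_range.2 (by omega)
  rw [← Finset.add_sum_erase _ _ h0, odd_zero_term hp (by omega)]
  have h := Finset.sum_le_card_nsmul ((range r).erase 0)
    (fun j => (p : ℝ) ^ Nat.gcd j r - 3 + Nat.gcd (p ^ j + 1) (p ^ r - 1))
    (2 * ∑ i ∈ range s, (p : ℝ) ^ (2 ^ i))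
    (fun j hj => by
      rw [mem_erase, mem_range] at hj
      have h1 := odd_term_le hp (r := r) (by omega) j
      have h2 : (p : ℝ) ^ Nat.gcd j r ≤ ∑ i ∈ range s, (p : ℝ) ^ (2 ^ i) := by
        rw [hs]
        exact pow_gcd_two_pow_le (by omega) (hs ▸ hj.2)
      linarith)
  rw [card_erase_of_mem h0, card_range, nsmul_eq_mul, Nat.cast_sub (by omega), Nat.cast_one] at h
  have h1 : (parityGcd p : ℝ) ≤ 2 := by exact_mod_cast parityGcd_le_two p
  have h2 : 0 ≤ ∑ i ∈ range s, (p : ℝ) ^ (2 ^ i) := Finset.sum_nonneg fun _ _ => by positivity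
  linarith

theorem sum_odd_even_le (hp : p.Prime) {t : ℕ} (ht : r = 2 * t) (h2 : 2 ≤ t) :
    ∑ j ∈ range r, ((p : ℝ) ^ Nat.gcd j r - 3 + Nat.gcd (p ^ j + 1) (p ^ r - 1)) ≤
      (p : ℝ) ^ r + parityGcd p - 1 + 2 * (p : ℝ) ^ ((r : ℝ) / 2) +
        2 * (Nat.totient r * p) - 2 * r +
        ((r : ℝ) - 2 - Nat.totient r) * ((p : ℝ) ^ ((r : ℝ) / 2) + (p : ℝ) ^ ((r : ℝ) / 4)) := by
  have hp1 : (1 : ℝ) ≤ p := by exact_mod_cast hp.one_le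
  have hp4 : (1 : ℝ) ≤ (p : ℝ) ^ ((r : ℝ) / 4) := Real.one_le_rpow hp1 (by positivity)
  have h := sum_gcd_two_mul_le h2
    (fun e => if Odd (r / e) then (p : ℝ) ^ e - 3 + parityGcd p else 2 * (p : ℝ) ^ e - 2)
    -- This covers both kinds of divisors `e < t`: with `r / e` odd the term is at most `p ^ (r / 2)
    -- - 1`, and with `r / e` even one has `e ≤ r / 4`. The divisor `t` itself is treated
    -- separately.
    (M := (p : ℝ) ^ ((r : ℝ) / 2) + (p : ℝ) ^ ((r : ℝ) / 4) - 2)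
    (fun e he h1 het => by
      have hpar : (parityGcd p : ℝ) ≤ 2 := by exact_mod_cast parityGcd_le_two p
      have h5 : (p : ℝ) ^ e ≤ (p : ℝ) ^ ((r : ℝ) / 2) := by
        refine natCast_pow_le_rpow hp.pos ?_
        rw [ht]
        push_cast
        have : (e : ℝ) ≤ t := by exact_mod_cast het.le
        linarith
      split_ifs with hodd
      · linarith
      · have h6 : (p : ℝ) ^ e ≤ (p : ℝ) ^ ((r : ℝ) / 4) := by
          refine natCast_pow_le_rpow hp.pos ?_
          rw [← ht] at he
          obtain ⟨k, hk⟩ := he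
          rw [hk, Nat.mul_div_cancel_left _ (by omega), Nat.not_odd_iff_even] at hodd
          obtain ⟨l, hl⟩ := hodd.two_dvd
          have h7 : 2 ≤ l := by
            by_contra hc
            have h8 : e * (2 * l) ≤ e * (2 * 1) := Nat.mul_le_mul_left _ (by omega)
            rw [← hl, ← hk] at h8
            omega
          have h8 : e * (2 * 2) ≤ e * (2 * l) := Nat.mul_le_mul_left _ (by omega)
          rw [← hl, ← hk] at h8
          have h9 : (e : ℝ) * 4 ≤ r := by exact_mod_cast h8
          linarith
        linarith)
  rw [← ht] at h
  have hle : ∑ j ∈ range r, ((p : ℝ) ^ Nat.gcd j r - 3 + Nat.gcd (p ^ j + 1) (p ^ r - 1)) ≤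
      ∑ j ∈ range r, (if Odd (r / Nat.gcd j r) then (p : ℝ) ^ Nat.gcd j r - 3 + parityGcd p
        else 2 * (p : ℝ) ^ Nat.gcd j r - 2) := by
    refine sum_le_sum fun j _ => ?_
    split_ifs with hodd
    · rw [gcd_eq_parityGcd hp (by omega) hodd]
    · exact odd_term_le hp (by omega) j
  refine hle.trans (h.trans ?_)
  have e1 : Odd (r / r) := by rw [Nat.div_self (by omega)]; exact odd_one
  have e2 : ¬ Odd (r / t) := by
    rw [ht, Nat.mul_div_cancel _ (by omega)]; decide
  have e3 : ¬ Odd (r / 1) := by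
    rw [Nat.div_one, ht, Nat.not_odd_iff_even]; exact even_two_mul t
  rw [if_pos e1, if_neg e2, if_neg e3, pow_one]
  have e4 : (p : ℝ) ^ t ≤ (p : ℝ) ^ ((r : ℝ) / 2) := by
    refine natCast_pow_le_rpow hp.pos ?_
    rw [ht]
    push_cast
    linarith
  have e5 : (2 * t : ℝ) = r := by rw [ht]; push_cast; rfl
  rw [e5]
  linarith

end OddExponent
end LunardonPolverino

/-! ### Estimates of the orbit sum for even `n` -/

namespace LunardonPolverino
open Finset

section EvenExponent

variable {p r : ℕ}

/-- The contribution of the `j`-th power of Frobenius to the orbit count for even exponents. -/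
noncomputable def evenTerm (p r j : ℕ) : ℝ :=
  (p : ℝ) ^ Nat.gcd j (2 * r) - 1 - Nat.gcd (p ^ j - 1) (p ^ r + 1) +
    Nat.gcd (p ^ j + 1) (p ^ (2 * r) - 1) - Nat.gcd (p ^ j + 1) (p ^ r + 1)

theorem pow_add_one_dvd (p r : ℕ) : p ^ r + 1 ∣ p ^ (2 * r) - 1 := by
  have h := Nat.sq_sub_sq (p ^ r) 1
  rw [one_pow] at h
  rw [mul_comm 2 r, pow_mul, h]
  exact dvd_mul_right _ _

theorem gcd_pow_sub_one_le (hp : p.Prime) (hr : 0 < r) (j : ℕ) :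
    (Nat.gcd (p ^ j - 1) (p ^ r + 1) : ℝ) ≤ (p : ℝ) ^ Nat.gcd j (2 * r) - 1 := by
  rw [← cast_gcd_pow_sub_one hp.pos]
  exact_mod_cast Nat.le_of_dvd
    (Nat.gcd_pos_of_pos_right _ (pow_sub_one_pos hp.two_le (by omega)))
    (Nat.gcd_dvd_gcd_of_dvd_right _ (pow_add_one_dvd p r))

theorem gcd_pow_add_one_le (p r j : ℕ) :
    (Nat.gcd (p ^ j + 1) (p ^ r + 1) : ℝ) ≤ Nat.gcd (p ^ j + 1) (p ^ (2 * r) - 1) := by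
  exact_mod_cast Nat.le_of_dvd (Nat.gcd_pos_of_pos_left _ (by omega))
    (Nat.gcd_dvd_gcd_of_dvd_right _ (pow_add_one_dvd p r))

theorem evenTerm_nonneg (hp : p.Prime) (hr : 0 < r) (j : ℕ) : 0 ≤ evenTerm p r j := by
  have h1 := gcd_pow_sub_one_le hp hr j
  have h2 := gcd_pow_add_one_le p r j
  rw [evenTerm]
  linarith

theorem evenTerm_zero_ge (p r : ℕ) : (p : ℝ) ^ (2 * r) - (p : ℝ) ^ r - 2 ≤ evenTerm p r 0 := by
  have h2 := gcd_pow_add_one_le p r 0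
  rw [evenTerm]
  have h3 : Nat.gcd (p ^ 0 - 1) (p ^ r + 1) = p ^ r + 1 := by
    rw [pow_zero, Nat.sub_self, Nat.gcd_zero_left]
  rw [h3, Nat.gcd_zero_left]
  push_cast
  linarith

theorem evenTerm_self_ge (hp : 0 < p) : (p : ℝ) ^ r - 3 ≤ evenTerm p r r := by
  have h2 := gcd_pow_add_one_le p r r
  have h3 : Nat.gcd (p ^ r - 1) (p ^ r + 1) ≤ 2 := by
    refine Nat.le_of_dvd two_pos ?_
    have h4 := Nat.dvd_sub (Nat.gcd_dvd_right (p ^ r - 1) (p ^ r + 1))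
      (Nat.gcd_dvd_left (p ^ r - 1) (p ^ r + 1))
    have := Nat.one_le_pow r p hp
    rwa [show p ^ r + 1 - (p ^ r - 1) = 2 by omega] at h4
  have h5 : (Nat.gcd (p ^ r - 1) (p ^ r + 1) : ℝ) ≤ 2 := by exact_mod_cast h3
  rw [evenTerm, Nat.gcd_mul_left_right]
  linarith

theorem sum_evenTerm_ge_zero_term (hp : p.Prime) (hr : 0 < r) :
    (p : ℝ) ^ (2 * r) - (p : ℝ) ^ r - 2 ≤ ∑ j ∈ range (2 * r), evenTerm p r j :=
  (evenTerm_zero_ge p r).trans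
    (Finset.single_le_sum (fun j _ => evenTerm_nonneg hp hr j) (mem_range.2 (by omega)))

/-- All terms are nonnegative, so `j = 0` and `j = r` may be kept alone; the loss `p ^ r` at `j = 0`
is compensated at `j = r`. -/
theorem sum_evenTerm_ge (hp : p.Prime) (hr : 0 < r) :
    (p : ℝ) ^ (2 * r) - 5 ≤ ∑ j ∈ range (2 * r), evenTerm p r j := by
  have h1 : ({0, r} : Finset ℕ) ⊆ range (2 * r) := by
    intro j hj
    rw [mem_insert, mem_singleton] at hj
    rw [mem_range]
    omega
  have h2 := Finset.sum_le_sum_of_subset_of_nonneg (f := evenTerm p r) h1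
    (fun j _ _ => evenTerm_nonneg hp hr j)
  rw [Finset.sum_pair (by omega)] at h2
  have h3 := evenTerm_zero_ge p r
  have h4 := evenTerm_self_ge (r := r) hp.pos
  linarith

/-- For `r / gcd (j, r)` odd the first divisor divides the second. Otherwise `gcd (j, 2 r) = gcd (j,
r)`, and the subtracted divisor, being at least `1`, absorbs the `+ 1`. -/
theorem gcd_sub_gcd_le (hp : p.Prime) (hr : 0 < r) (j : ℕ) :
    (Nat.gcd (p ^ j + 1) (p ^ (2 * r) - 1) : ℝ) - Nat.gcd (p ^ j + 1) (p ^ r + 1) ≤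
      if Odd (r / Nat.gcd j r) then 0 else (p : ℝ) ^ Nat.gcd j r := by
  split_ifs with h
  · have h1 : (Nat.gcd (p ^ j + 1) (p ^ (2 * r) - 1) : ℝ) ≤ Nat.gcd (p ^ j + 1) (p ^ r + 1) := by
      exact_mod_cast Nat.le_of_dvd (Nat.gcd_pos_of_pos_left _ (by omega))
        (gcd_pow_add_one_dvd_gcd hp.pos hr h)
    linarith
  · rw [Nat.not_odd_iff_even] at h
    have h1 : (Nat.gcd (p ^ j + 1) (p ^ (2 * r) - 1) : ℝ) ≤ (p : ℝ) ^ Nat.gcd j (2 * r) + 1 := by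
      exact_mod_cast gcd_le_pow_gcd_add_one (j := j) hp (by omega)
    rw [gcd_two_mul_of_even_div hr h] at h1
    have h2 : (1 : ℝ) ≤ Nat.gcd (p ^ j + 1) (p ^ r + 1) := by
      exact_mod_cast Nat.gcd_pos_of_pos_left _ (by omega)
    linarith

theorem sum_range_two_mul_gcd (r : ℕ) (f : ℕ → ℝ) :
    ∑ j ∈ range (2 * r), f (Nat.gcd j r) = 2 * ∑ j ∈ range r, f (Nat.gcd j r) := by
  rw [two_mul, sum_range_add, two_mul]
  congr 1
  refine sum_congr rfl fun j _ => ?_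
  rw [Nat.gcd_self_add_left]

theorem sum_pow_gcd_two_mul_le (hr : 2 ≤ r) (hp : p.Prime) :
    ∑ j ∈ range (2 * r), (p : ℝ) ^ Nat.gcd j (2 * r) ≤
      (p : ℝ) ^ (2 * r) + Nat.totient (2 * r) * p +
        ((ArithmeticFunction.sigma 1 (2 * r) : ℝ) - 2 * r - 1) * (p : ℝ) ^ r := by
  have hp1 : (1 : ℝ) ≤ p := by exact_mod_cast hp.one_le
  have h := sum_gcd_le (N := 2 * r) (by omega) (fun e => (p : ℝ) ^ e) (M := (p : ℝ) ^ r)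
    (fun e he _ h2 => by
      refine pow_le_pow_right₀ hp1 ?_
      obtain ⟨t, ht⟩ := he
      have ht2 : 2 ≤ t := by
        by_contra hc
        have h3 : e * t ≤ e * 1 := Nat.mul_le_mul_left _ (by omega)
        omega
      have : e * 2 ≤ e * t := Nat.mul_le_mul_left _ ht2
      omega)
  have h1 := cast_sub_totient_le_sigma (N := 2 * r) (by omega)
  have h2 := mul_le_mul_of_nonneg_right h1 (pow_nonneg (by linarith : (0 : ℝ) ≤ p) r)
  simp only [pow_one] at h
  push_cast at h h2 ⊢
  linarith

theorem sum_evenTerm_le (hp : p.Prime) (hr : 2 ≤ r) :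
    ∑ j ∈ range (2 * r), evenTerm p r j ≤
      (p : ℝ) ^ (2 * r) + Nat.totient (2 * r) * p +
        ((ArithmeticFunction.sigma 1 (2 * r) : ℝ) - 2 * r - 1) * (p : ℝ) ^ r - 2 * r -
        ∑ j ∈ range (2 * r), (Nat.gcd (p ^ j - 1) (p ^ r + 1) : ℝ) +
        2 * ∑ j ∈ range r, (if Odd (r / Nat.gcd j r) then 0 else (p : ℝ) ^ Nat.gcd j r) := by
  have h1 := sum_pow_gcd_two_mul_le hr hp
  have h2 := sum_le_sum fun j (_ : j ∈ range (2 * r)) => gcd_sub_gcd_le hp (by omega : 0 < r) j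
  rw [sum_range_two_mul_gcd r (fun e => if Odd (r / e) then 0 else (p : ℝ) ^ e)] at h2
  have h3 : ∑ j ∈ range (2 * r), evenTerm p r j =
      ∑ j ∈ range (2 * r), (p : ℝ) ^ Nat.gcd j (2 * r) - 2 * r -
        ∑ j ∈ range (2 * r), (Nat.gcd (p ^ j - 1) (p ^ r + 1) : ℝ) +
        ∑ j ∈ range (2 * r), ((Nat.gcd (p ^ j + 1) (p ^ (2 * r) - 1) : ℝ) -
          Nat.gcd (p ^ j + 1) (p ^ r + 1)) := by
    have h4 : (2 * r : ℝ) = ∑ _j ∈ range (2 * r), (1 : ℝ) := by simp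
    rw [h4, ← sum_sub_distrib, ← sum_sub_distrib, ← sum_add_distrib]
    refine sum_congr rfl fun j _ => ?_
    rw [evenTerm]
    ring
  linarith

theorem le_sum_range_two_mul {f : ℕ → ℝ} {c : ℝ} (h0 : ∀ j, 0 ≤ f j) (h : ∀ i, c ≤ f (2 * i))
    (k : ℕ) : k * c ≤ ∑ j ∈ range (2 * k), f j := by
  induction k with
  | zero => simp
  | succ k ih =>
    rw [mul_add, mul_one, sum_range_succ, sum_range_succ]
    have h1 := h k
    have h2 := h0 (2 * k + 1)
    push_cast
    linarith

/-- For odd `r`, `p + 1` divides `p ^ r + 1` and every `p ^ (2 i) - 1`. The even indices thus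
subtract at least `r (p + 1)`, which outweighs `φ(2 r) p ≤ r p`. -/
theorem sum_evenTerm_of_odd_le (hp : p.Prime) (hr : 2 ≤ r) (hodd : Odd r) :
    ∑ j ∈ range (2 * r), evenTerm p r j ≤ (p : ℝ) ^ (2 * r) +
        ((ArithmeticFunction.sigma 1 (2 * r) : ℝ) - 2 * r - 1) * (p : ℝ) ^ r - 3 * r := by
  have h1 := sum_evenTerm_le hp hr
  have h2 : ∑ j ∈ range r, (if Odd (r / Nat.gcd j r) then 0 else (p : ℝ) ^ Nat.gcd j r) = 0 :=
    sum_eq_zero fun j _ => if_pos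
      (hodd.of_dvd_nat (Nat.div_dvd_of_dvd (Nat.gcd_dvd_right _ _)))
  have h3 := le_sum_range_two_mul (f := fun j => (Nat.gcd (p ^ j - 1) (p ^ r + 1) : ℝ))
    (c := (p : ℝ) + 1) (fun j => Nat.cast_nonneg _) (fun i => by
      have h4 : p + 1 ∣ p ^ (2 * i) - 1 := by
        have h5 := pow_add_one_dvd p 1
        rw [pow_one, mul_one] at h5
        exact h5.trans (pow_sub_one_dvd_pow_sub_one p (dvd_mul_right 2 i))
      have h6 : p + 1 ∣ p ^ r + 1 := by
        have := hodd.nat_add_dvd_pow_add_pow p 1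
        rwa [one_pow] at this
      have h7 := Nat.le_of_dvd (Nat.gcd_pos_of_pos_right (p ^ (2 * i) - 1) (Nat.succ_pos (p ^ r)))
        (Nat.dvd_gcd h4 h6)
      exact_mod_cast h7) r
  have h4 : 2 * Nat.totient (2 * r) ≤ 2 * r := two_mul_totient_le (even_two_mul r)
  have h5 : (Nat.totient (2 * r) : ℝ) ≤ r := by exact_mod_cast (by omega : Nat.totient (2 * r) ≤ r)
  have h6 := mul_le_mul_of_nonneg_right h5 (Nat.cast_nonneg (α := ℝ) p)
  rw [h2] at h1
  linarith

theorem sum_evenTerm_two_pow_lt (hp : p.Prime) (hr : 2 ≤ r) {s : ℕ} (hs : r = 2 ^ s) :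
    ∑ j ∈ range (2 * r), evenTerm p r j < (p : ℝ) ^ (2 * r) +
        ((ArithmeticFunction.sigma 1 (2 * r) : ℝ) - 2 * r - 1) * (p : ℝ) ^ r +
        4 * r * ∑ i ∈ range s, (p : ℝ) ^ (2 ^ i) := by
  have h1 := sum_evenTerm_le hp hr
  have hr0 : (0 : ℝ) < r := by exact_mod_cast (by omega : 0 < r)
  have hS : (p : ℝ) ≤ ∑ i ∈ range s, (p : ℝ) ^ (2 ^ i) := by
    have hs0 : 0 < s := Nat.pos_of_ne_zero (by rintro rfl; omega)
    have := Finset.single_le_sum (f := fun i => (p : ℝ) ^ (2 ^ i)) (fun _ _ => by positivity)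
      (mem_range.2 hs0)
    simpa using this
  have hp0 : (0 : ℝ) ≤ p := Nat.cast_nonneg p
  have h2 : ∑ j ∈ range r, (if Odd (r / Nat.gcd j r) then 0 else (p : ℝ) ^ Nat.gcd j r) ≤
      r * ∑ i ∈ range s, (p : ℝ) ^ (2 ^ i) := by
    have h3 := Finset.sum_le_card_nsmul (range r)
      (fun j => if Odd (r / Nat.gcd j r) then 0 else (p : ℝ) ^ Nat.gcd j r)
      (∑ i ∈ range s, (p : ℝ) ^ (2 ^ i)) (fun j hj => by
        rw [mem_range] at hj
        split_ifs with hodd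
        · linarith
        · have hj0 : 0 < j := by
            rcases Nat.eq_zero_or_pos j with rfl | h
            · rw [Nat.gcd_zero_left, Nat.div_self (by omega)] at hodd
              exact (hodd odd_one).elim
            · exact h
          rw [hs]
          exact pow_gcd_two_pow_le hj0 (hs ▸ hj))
    rwa [card_range, nsmul_eq_mul] at h3
  have h3 : 0 ≤ ∑ j ∈ range (2 * r), (Nat.gcd (p ^ j - 1) (p ^ r + 1) : ℝ) :=
    sum_nonneg fun j _ => Nat.cast_nonneg _
  have h4 : 2 * Nat.totient (2 * r) ≤ 2 * r := two_mul_totient_le (even_two_mul r)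
  have h5 : (Nat.totient (2 * r) : ℝ) ≤ r := by exact_mod_cast (by omega : Nat.totient (2 * r) ≤ r)
  have h6 := mul_le_mul_of_nonneg_right h5 hp0
  have h7 := mul_le_mul_of_nonneg_left hS hr0.le
  have h8 : 0 ≤ (r : ℝ) * ∑ i ∈ range s, (p : ℝ) ^ (2 ^ i) := by
    have : 0 ≤ (r : ℝ) * p := by positivity
    linarith
  linarith

/-- As `r` is even, the terms linear in `p` total `4 φ(r) p ≤ 2 r p`, which is exactly offset by the
constants, the trivial common divisors and `4 r ε`. Strictness comes from having treated the divisor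
`r / 2` apart, which saves one copy of `p ^ (r / 4)`. -/
theorem sum_evenTerm_even_lt (hp : p.Prime) {t : ℕ} (ht : r = 2 * t) (h2 : 2 ≤ t) :
    ∑ j ∈ range (2 * r), evenTerm p r j - 4 * r * (((parityGcd p : ℝ) - 1) * ((p : ℝ) - 3) / 2) <
      (p : ℝ) ^ (2 * r) +
        ((ArithmeticFunction.sigma 1 (2 * r) : ℝ) - 2 * r - 1) * (p : ℝ) ^ r +
        2 * (p : ℝ) ^ ((r : ℝ) / 2) +
        2 * ((ArithmeticFunction.sigma 1 r : ℝ) - r - 1) * (p : ℝ) ^ ((r : ℝ) / 4) := by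
  have hp1 : (1 : ℝ) ≤ p := by exact_mod_cast hp.one_le
  have hp4 : (1 : ℝ) ≤ (p : ℝ) ^ ((r : ℝ) / 4) := Real.one_le_rpow hp1 (by positivity)
  have h := sum_gcd_two_mul_le h2
    (fun e => if Odd (r / e) then 0 else (p : ℝ) ^ e)
    (M := (p : ℝ) ^ ((r : ℝ) / 4))
    (fun e he h1 het => by
      split_ifs with hodd
      · linarith
      · refine natCast_pow_le_rpow hp.pos ?_
        rw [← ht] at he
        obtain ⟨k, hk⟩ := he
        rw [hk, Nat.mul_div_cancel_left _ (by omega), Nat.not_odd_iff_even] at hodd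
        obtain ⟨l, hl⟩ := hodd.two_dvd
        have h7 : 2 ≤ l := by
          by_contra hc
          have h8 : e * (2 * l) ≤ e * (2 * 1) := Nat.mul_le_mul_left _ (by omega)
          rw [← hl, ← hk] at h8
          omega
        have h8 : e * (2 * 2) ≤ e * (2 * l) := Nat.mul_le_mul_left _ (by omega)
        rw [← hl, ← hk] at h8
        have h9 : (e : ℝ) * 4 ≤ r := by exact_mod_cast h8
        linarith)
  rw [← ht] at h
  have e1 : Odd (r / r) := by rw [Nat.div_self (by omega)]; exact odd_one
  have e2 : ¬ Odd (r / t) := by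
    rw [ht, Nat.mul_div_cancel _ (by omega)]; decide
  have e3 : ¬ Odd (r / 1) := by
    rw [Nat.div_one, ht, Nat.not_odd_iff_even]; exact even_two_mul t
  have e4 : (p : ℝ) ^ t ≤ (p : ℝ) ^ ((r : ℝ) / 2) := by
    refine natCast_pow_le_rpow hp.pos ?_
    rw [ht]
    push_cast
    linarith
  have e5 : (2 * t : ℝ) = r := by rw [ht]; push_cast; rfl
  simp only [if_pos e1, if_neg e2, if_neg e3, pow_one, e5] at h
  have h1 := sum_evenTerm_le hp (r := r) (by omega)
  have hG : (2 * r : ℝ) * parityGcd p ≤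
      ∑ j ∈ range (2 * r), (Nat.gcd (p ^ j - 1) (p ^ r + 1) : ℝ) := by
    have h3 := Finset.card_nsmul_le_sum (range (2 * r))
      (fun j => (Nat.gcd (p ^ j - 1) (p ^ r + 1) : ℝ)) (parityGcd p) (fun j _ => by
        exact_mod_cast Nat.le_of_dvd (Nat.gcd_pos_of_pos_right _ (Nat.succ_pos _))
          (Nat.dvd_gcd (parityGcd_dvd_pow_sub_one p j) (parityGcd_dvd_pow_add_one hp.pos r)))
    rw [card_range, nsmul_eq_mul] at h3
    exact_mod_cast h3
  have hev : Even r := ht ▸ even_two_mul t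
  have hφ2 : Nat.totient (2 * r) = 2 * Nat.totient r := Nat.totient_two_mul_of_even hev
  have hφ : 2 * (Nat.totient r : ℝ) ≤ r := by exact_mod_cast two_mul_totient_le hev
  have hφp := mul_le_mul_of_nonneg_right hφ (by linarith : (0 : ℝ) ≤ p)
  have hτ := mul_le_mul_of_nonneg_right (cast_sub_totient_le_sigma (N := r) (by omega))
    (by linarith : (0 : ℝ) ≤ (p : ℝ) ^ ((r : ℝ) / 4))
  rw [hφ2] at h1
  push_cast at h1
  rcases parityGcd_cases hp with ⟨rfl, hc⟩ | ⟨h3, hc⟩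
  · rw [hc] at hG ⊢
    push_cast at *
    linarith
  · rw [hc] at hG ⊢
    push_cast at *
    linarith

end EvenExponent
end LunardonPolverino

/-! ### Bounds for the normalised number of classes -/

namespace LunardonPolverino
open Finset

theorem mul_one_add_div {A c y a b : ℝ} (h : A / b = y) : A / c * (1 + a / b) = (A + a * y) / c := by
  rw [← h]; ring

theorem mul_one_add_div_add_div {A c y y' a a' b b' : ℝ} (h : A / b = y) (h' : A / b' = y') :
    A / c * (1 + a / b + a' / b') = (A + a * y + a' * y') / c := by
  rw [← h, ← h']; ring

theorem mul_one_add_div_add_div_add_div {A c y y' y'' a a' a'' b b' b'' : ℝ} (h : A / b = y)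
    (h' : A / b' = y') (h'' : A / b'' = y'') :
    A / c * (1 + a / b + a' / b' + a'' / b'') = (A + a * y + a' * y' + a'' * y'') / c := by
  rw [← h, ← h', ← h'']; ring

theorem sum_Icc_two_pow (p s : ℕ) :
    ∑ i ∈ Icc 1 s, (p : ℝ) ^ (2 ^ (i - 1)) = ∑ i ∈ range s, (p : ℝ) ^ (2 ^ i) := by
  induction s with
  | zero => simp
  | succ s ih => rw [sum_range_succ, ← ih, sum_Icc_succ_top (by omega), Nat.add_sub_cancel]

theorem eps_nonneg {p : ℕ} (hp : p.Prime) (n : ℕ) : 0 ≤ eps p n := by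
  rw [eps]
  split_ifs with h1 h2
  · exact le_rfl
  · have : (1 : ℝ) ≤ p := by exact_mod_cast hp.one_le
    linarith
  · have h3 : 3 ≤ p := by have := hp.two_le; omega
    have : (3 : ℝ) ≤ p := by exact_mod_cast h3
    linarith

section OddExponent

variable {K : Type u} [Field K] {p r n : ℕ}

theorem excess_of_odd (hp : p.Prime) (hn : 4 ≤ n) (hodd : Odd n) (hr : 1 ≤ r)
    (hcard : Nat.card K = (p ^ r) ^ n) :
    excess K p r n * (2 * r) =
      ∑ j ∈ range r, ((p : ℝ) ^ Nat.gcd j r - 3 + Nat.gcd (p ^ j + 1) (p ^ r - 1)) -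
        r * (((parityGcd p : ℝ) - 1) * ((p : ℝ) - 1)) := by
  rw [excess, sub_mul, numLP_of_odd hp hn hodd hr hcard, eps_of_odd hp hodd]
  ring

/-- The minimal term of the orbit sum for odd `n` equals `2 ε`. This is why subtracting `ε` leaves
exactly `(p ^ r - p) / (2 r)` for odd primes `r`. -/
theorem parity_identity (hp : p.Prime) :
    (p : ℝ) - 3 + parityGcd p = ((parityGcd p : ℝ) - 1) * ((p : ℝ) - 1) := by
  rcases parityGcd_cases hp with ⟨rfl, h⟩ | ⟨-, h⟩
  · rw [h]; norm_num
  · rw [h]; push_cast; ring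

theorem lt_excess_of_odd (hp : p.Prime) (hn : 4 ≤ n) (hodd : Odd n) (hr : 1 < r)
    (hcard : Nat.card K = (p ^ r) ^ n) (h : ¬ (Odd r ∧ r.Prime)) :
    ((p : ℝ) ^ r - p) / (2 * r) < excess K p r n := by
  have hr0 : (0 : ℝ) < r := by exact_mod_cast (by omega : 0 < r)
  rw [div_lt_iff₀ (by positivity), excess_of_odd hp hn hodd hr.le hcard, ← parity_identity hp]
  have := sum_odd_gt hp hr h
  linarith

theorem excess_of_odd_of_odd (hp : p.Prime) (hn : 4 ≤ n) (hodd : Odd n)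
    (hcard : Nat.card K = (p ^ r) ^ n) (h : Odd r) :
    excess K p r n * (2 * r) = ∑ j ∈ range r, (p : ℝ) ^ Nat.gcd j r - r * p := by
  rw [excess_of_odd hp hn hodd h.pos hcard, ← parity_identity hp, sum_odd_of_odd hp h]
  ring

theorem eq_excess_of_odd_of_prime (hp : p.Prime) (hn : 4 ≤ n) (hodd : Odd n)
    (hcard : Nat.card K = (p ^ r) ^ n) (h : Odd r) (h' : r.Prime) :
    ((p : ℝ) ^ r - p) / (2 * r) = excess K p r n := by
  have hr0 : (0 : ℝ) < r := by exact_mod_cast h.pos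
  rw [div_eq_iff (by positivity), excess_of_odd_of_odd hp hn hodd hcard h, sum_pow_gcd_of_prime h']
  ring

theorem excess_lt_of_odd_of_odd (hp : p.Prime) (hn : 4 ≤ n) (hodd : Odd n) (hr : 1 < r)
    (hcard : Nat.card K = (p ^ r) ^ n) (h : Odd r) :
    excess K p r n < (p : ℝ) ^ r / (2 * r) *
      (1 + ((ArithmeticFunction.sigma 1 r : ℝ) - r - 1) /
        (p : ℝ) ^ ((r : ℝ) * (1 - 1 / (r.minFac : ℝ)))) := by
  have hr0 : (0 : ℝ) < r := by exact_mod_cast h.pos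
  have hp0 : (0 : ℝ) < p := by exact_mod_cast hp.pos
  rw [mul_one_add_div (natCast_pow_div_rpow hp.pos r _), lt_div_iff₀ (by positivity),
    excess_of_odd_of_odd hp hn hodd hcard h]
  have h1 := sum_pow_gcd_le hp hr
  have h2 : (r : ℝ) - r * (1 - 1 / (r.minFac : ℝ)) = r / r.minFac := by ring
  have h3 : (Nat.totient r : ℝ) < r := by exact_mod_cast Nat.totient_lt r hr
  have h4 := mul_lt_mul_of_pos_right h3 hp0
  rw [h2]
  linarith

theorem excess_lt_of_odd_of_two_pow (hp : p.Prime) (hn : 4 ≤ n) (hodd : Odd n) (hr : 1 < r)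
    (hcard : Nat.card K = (p ^ r) ^ n) {s : ℕ} (hs : r = 2 ^ s) :
    excess K p r n < (p : ℝ) ^ r / (2 * r) *
      (1 + ((ArithmeticFunction.sigma 1 r : ℝ) - r - 1) / (p : ℝ) ^ ((r : ℝ) / 2)) +
        ∑ i ∈ Icc 1 s, (p : ℝ) ^ (2 ^ (i - 1)) := by
  have hr0 : (0 : ℝ) < r := by exact_mod_cast (by omega : 0 < r)
  have hp1 : (1 : ℝ) ≤ p := by exact_mod_cast hp.one_le
  have hc : (1 : ℝ) ≤ parityGcd p := by exact_mod_cast parityGcd_pos p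
  rw [mul_one_add_div rfl, sum_Icc_two_pow, div_add' _ _ _ (by positivity),
    lt_div_iff₀ (by positivity), excess_of_odd hp hn hodd hr.le hcard]
  have h1 := sum_odd_two_pow_lt hp hs hr
  have h2 : 0 ≤ ((ArithmeticFunction.sigma 1 r : ℝ) - r - 1) *
      ((p : ℝ) ^ r / (p : ℝ) ^ ((r : ℝ) / 2)) :=
    mul_nonneg (sigma_sub_nonneg hr) (by positivity)
  have h3 : 0 ≤ (r : ℝ) * (((parityGcd p : ℝ) - 1) * ((p : ℝ) - 1)) :=
    mul_nonneg hr0.le (mul_nonneg (by linarith) (by linarith))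
  linarith

theorem four_le_of_even_of_card_primeFactors (h : Even r) (h1 : 1 < r.primeFactors.card) :
    ∃ t, r = 2 * t ∧ 2 ≤ t := by
  obtain ⟨t, ht⟩ := h.two_dvd
  refine ⟨t, ht, ?_⟩
  by_contra hc
  have h2 : r = 0 ∨ r = 2 := by omega
  rcases h2 with rfl | rfl
  · simp at h1
  · rw [Nat.prime_two.primeFactors, card_singleton] at h1
    omega

theorem excess_lt_of_odd_of_even (hp : p.Prime) (hn : 4 ≤ n) (hodd : Odd n)
    (hcard : Nat.card K = (p ^ r) ^ n) (h : Even r) (h1 : 1 < r.primeFactors.card) :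
    excess K p r n < (p : ℝ) ^ r / (2 * r) *
      (1 + ((ArithmeticFunction.sigma 1 r : ℝ) - r) / (p : ℝ) ^ ((r : ℝ) / 2) +
        ((ArithmeticFunction.sigma 1 r : ℝ) - r - 1) / (p : ℝ) ^ (3 * (r : ℝ) / 4)) := by
  obtain ⟨t, ht, ht2⟩ := four_le_of_even_of_card_primeFactors h h1
  have hr0 : (0 : ℝ) < r := by exact_mod_cast (by omega : 0 < r)
  have hp1 : (1 : ℝ) ≤ p := by exact_mod_cast hp.one_le
  have hp4 : (1 : ℝ) ≤ (p : ℝ) ^ ((r : ℝ) / 4) := Real.one_le_rpow hp1 (by positivity)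
  have hp2 : (1 : ℝ) ≤ (p : ℝ) ^ ((r : ℝ) / 2) := Real.one_le_rpow hp1 (by positivity)
  rw [mul_one_add_div_add_div (natCast_pow_div_rpow hp.pos r _)
    (natCast_pow_div_rpow hp.pos r _), lt_div_iff₀ (by positivity),
    excess_of_odd hp hn hodd (by omega) hcard,
    show (r : ℝ) - r / 2 = r / 2 by ring, show (r : ℝ) - 3 * r / 4 = r / 4 by ring]
  have h2 := sum_odd_even_le hp ht ht2
  have hφ : 2 * (Nat.totient r : ℝ) ≤ r := by exact_mod_cast two_mul_totient_le h
  have hφp := mul_le_mul_of_nonneg_right hφ (by linarith : (0 : ℝ) ≤ p)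
  have hτ := mul_le_mul_of_nonneg_right (cast_sub_totient_le_sigma (N := r) (by omega))
    (by linarith : (0 : ℝ) ≤ (p : ℝ) ^ ((r : ℝ) / 2) + (p : ℝ) ^ ((r : ℝ) / 4))
  rcases parityGcd_cases hp with ⟨rfl, hc⟩ | ⟨h3, hc⟩
  · rw [hc] at h2 ⊢
    push_cast at *
    linarith
  · rw [hc] at h2 ⊢
    have hr4 : (4 : ℝ) ≤ r := by exact_mod_cast (by omega : 4 ≤ r)
    push_cast at *
    linarith

end OddExponent

section EvenExponent

variable {K : Type u} [Field K] {p r n : ℕ}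

theorem excess_of_even (hp : p.Prime) (hn : 4 ≤ n) (heven : Even n) (hr : 1 ≤ r)
    (hcard : Nat.card K = (p ^ r) ^ n) :
    excess K p r n * (4 * r) = ∑ j ∈ range (2 * r), evenTerm p r j - 4 * r * eps p n := by
  rw [excess, sub_mul, numLP_of_even hp hn heven hr hcard, mul_comm (eps p n)]
  rfl

theorem excess_lt_of_even_of_odd (hp : p.Prime) (hn : 4 ≤ n) (heven : Even n) (hr : 1 < r)
    (hcard : Nat.card K = (p ^ r) ^ n) (h : Odd r) :
    excess K p r n < (p : ℝ) ^ (2 * r) / (4 * r) *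
      (1 + ((ArithmeticFunction.sigma 1 (2 * r) : ℝ) - 2 * r - 1) / (p : ℝ) ^ r) := by
  have hr0 : (0 : ℝ) < r := by exact_mod_cast h.pos
  have hp0 : (0 : ℝ) < p := by exact_mod_cast hp.pos
  have hdiv : (p : ℝ) ^ (2 * r) / (p : ℝ) ^ r = (p : ℝ) ^ r := by
    rw [two_mul, pow_add, mul_div_cancel_right₀ _ (by positivity)]
  rw [mul_one_add_div hdiv, lt_div_iff₀ (by positivity), excess_of_even hp hn heven hr.le hcard]
  have h1 := sum_evenTerm_of_odd_le hp hr h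
  have h2 : 0 ≤ 4 * r * eps p n := mul_nonneg (by positivity) (eps_nonneg hp n)
  linarith

theorem excess_lt_of_even_of_two_pow (hp : p.Prime) (hn : 4 ≤ n) (heven : Even n) (hr : 1 < r)
    (hcard : Nat.card K = (p ^ r) ^ n) {s : ℕ} (hs : r = 2 ^ s) :
    excess K p r n < (p : ℝ) ^ (2 * r) / (4 * r) *
      (1 + ((ArithmeticFunction.sigma 1 (2 * r) : ℝ) - 2 * r - 1) / (p : ℝ) ^ r) +
        ∑ i ∈ Icc 1 s, (p : ℝ) ^ (2 ^ (i - 1)) := by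
  have hr0 : (0 : ℝ) < r := by exact_mod_cast (by omega : 0 < r)
  have hp0 : (0 : ℝ) < p := by exact_mod_cast hp.pos
  have hdiv : (p : ℝ) ^ (2 * r) / (p : ℝ) ^ r = (p : ℝ) ^ r := by
    rw [two_mul, pow_add, mul_div_cancel_right₀ _ (by positivity)]
  rw [mul_one_add_div hdiv, sum_Icc_two_pow, div_add' _ _ _ (by positivity),
    lt_div_iff₀ (by positivity), excess_of_even hp hn heven hr.le hcard]
  have h1 := sum_evenTerm_two_pow_lt hp hr hs
  have h2 : 0 ≤ 4 * r * eps p n := mul_nonneg (by positivity) (eps_nonneg hp n)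
  linarith

theorem excess_lt_of_even_of_even (hp : p.Prime) (hn : 4 ≤ n) (heven : Even n)
    (hcard : Nat.card K = (p ^ r) ^ n) (h : Even r) (h1 : 1 < r.primeFactors.card) :
    excess K p r n < (p : ℝ) ^ (2 * r) / (4 * r) *
      (1 + ((ArithmeticFunction.sigma 1 (2 * r) : ℝ) - 2 * r - 1) / (p : ℝ) ^ r +
        2 / (p : ℝ) ^ (3 * (r : ℝ) / 2) +
        2 * ((ArithmeticFunction.sigma 1 r : ℝ) - r - 1) / (p : ℝ) ^ (7 * (r : ℝ) / 4)) := by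
  obtain ⟨t, ht, ht2⟩ := four_le_of_even_of_card_primeFactors h h1
  have hr0 : (0 : ℝ) < r := by exact_mod_cast (by omega : 0 < r)
  have hp0 : (0 : ℝ) < p := by exact_mod_cast hp.pos
  have hdiv : (p : ℝ) ^ (2 * r) / (p : ℝ) ^ r = (p : ℝ) ^ r := by
    rw [two_mul, pow_add, mul_div_cancel_right₀ _ (by positivity)]
  have hdiv2 : (p : ℝ) ^ (2 * r) / (p : ℝ) ^ (3 * (r : ℝ) / 2) = (p : ℝ) ^ ((r : ℝ) / 2) := by
    rw [natCast_pow_div_rpow hp.pos]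
    congr 1
    push_cast
    ring
  have hdiv3 : (p : ℝ) ^ (2 * r) / (p : ℝ) ^ (7 * (r : ℝ) / 4) = (p : ℝ) ^ ((r : ℝ) / 4) := by
    rw [natCast_pow_div_rpow hp.pos]
    congr 1
    push_cast
    ring
  rw [mul_one_add_div_add_div_add_div hdiv hdiv2 hdiv3, lt_div_iff₀ (by positivity),
    excess_of_even hp hn heven (by omega) hcard, eps_of_even hp heven]
  exact sum_evenTerm_even_lt hp ht ht2

/-- The term `j = 0` suffices: the last summand `p ^ r` of the tower, taken `4 r` times, absorbs its
loss `p ^ r + 2`, and the earlier summands absorb `ε ≤ p`. -/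
theorem lt_excess_of_even_of_two_pow (hp : p.Prime) (hn : 4 ≤ n) (heven : Even n) (hr : 1 < r)
    (hcard : Nat.card K = (p ^ r) ^ n) {s : ℕ} (hs : r = 2 ^ s) :
    ((p : ℝ) ^ (2 * r) - p) / (4 * r) - ∑ i ∈ Icc 1 (s + 1), (p : ℝ) ^ (2 ^ (i - 1)) <
      excess K p r n := by
  have hr2 : (2 : ℝ) ≤ r := by exact_mod_cast hr
  have hp2 : (2 : ℝ) ≤ p := by exact_mod_cast hp.two_le
  rw [sum_Icc_two_pow, div_sub' (by positivity), div_lt_iff₀ (by positivity),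
    excess_of_even hp hn heven hr.le hcard, sum_range_succ, ← hs]
  have hs0 : 0 < s := Nat.pos_of_ne_zero (by rintro rfl; omega)
  have hS : (p : ℝ) ≤ ∑ i ∈ range s, (p : ℝ) ^ (2 ^ i) := by
    have := Finset.single_le_sum (f := fun i => (p : ℝ) ^ (2 ^ i)) (fun _ _ => by positivity)
      (mem_range.2 hs0)
    simpa using this
  have h1 := sum_evenTerm_ge_zero_term (r := r) hp (by omega)
  have h2 : eps p n ≤ p := by
    rw [eps]
    split_ifs <;> linarith
  have h3 := mul_le_mul_of_nonneg_left (h2.trans hS) (by positivity : (0 : ℝ) ≤ 4 * r)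
  have h4 : (p : ℝ) ^ 2 ≤ (p : ℝ) ^ r := pow_le_pow_right₀ (by linarith) hr
  have h5 : (4 : ℝ) ≤ (p : ℝ) ^ r := by nlinarith
  have h6 : 8 * (p : ℝ) ^ r ≤ 4 * r * (p : ℝ) ^ r :=
    mul_le_mul_of_nonneg_right (by linarith) (by positivity)
  linarith

theorem two_mul_mul_le_pow (hp : 3 ≤ p) (hr : 3 ≤ r) : 2 * r * p ≤ p ^ r := by
  induction r, hr using Nat.le_induction with
  | base => nlinarith [Nat.mul_le_mul hp hp]
  | succ k hk ih =>
    rw [pow_succ]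
    have : 2 * k * p * 3 ≤ p ^ k * p := Nat.mul_le_mul ih hp
    nlinarith

/-- Here `r ≥ 3`, so for odd `p` the subtracted `p ^ r ≥ 2 r p` pays for `4 r ε = 2 r (p - 3)`. The
divisor-sum term only weakens the bound. -/
theorem lt_excess_of_even_of_not_two_pow (hp : p.Prime) (hn : 4 ≤ n) (heven : Even n) (hr : 1 < r)
    (hcard : Nat.card K = (p ^ r) ^ n) (h : ¬ ∃ s : ℕ, r = 2 ^ s) :
    (p : ℝ) ^ (2 * r) / (4 * r) * (1 - 1 / (p : ℝ) ^ r -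
      ((ArithmeticFunction.sigma 1 (2 * r) : ℝ) - 2 * r - 1) / (p : ℝ) ^ (3 * (r : ℝ) / 2) -
        1 / (p : ℝ) ^ (2 * r - 1)) < excess K p r n := by
  have hr0 : (0 : ℝ) < r := by exact_mod_cast (by omega : 0 < r)
  have hp0 : (0 : ℝ) < p := by exact_mod_cast hp.pos
  have hr3 : 3 ≤ r := by
    by_contra hc
    exact h ⟨1, by omega⟩
  have hdiv : (p : ℝ) ^ (2 * r) / (p : ℝ) ^ r = (p : ℝ) ^ r := by
    rw [two_mul, pow_add, mul_div_cancel_right₀ _ (by positivity)]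
  have hdiv2 : (p : ℝ) ^ (2 * r) / (p : ℝ) ^ (2 * r - 1) = p := by
    rw [show 2 * r = (2 * r - 1) + 1 by omega, pow_succ, Nat.add_sub_cancel,
      mul_div_cancel_left₀ _ (by positivity)]
  have hτ : 0 ≤ ((ArithmeticFunction.sigma 1 (2 * r) : ℝ) - 2 * r - 1) *
      ((p : ℝ) ^ (2 * r) / (p : ℝ) ^ (3 * (r : ℝ) / 2)) := by
    have := sigma_sub_nonneg (N := 2 * r) (by omega)
    push_cast at this
    exact mul_nonneg this (by positivity)
  have e : (p : ℝ) ^ (2 * r) / (4 * r) * (1 - 1 / (p : ℝ) ^ r -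
      ((ArithmeticFunction.sigma 1 (2 * r) : ℝ) - 2 * r - 1) / (p : ℝ) ^ (3 * (r : ℝ) / 2) -
        1 / (p : ℝ) ^ (2 * r - 1)) =
      ((p : ℝ) ^ (2 * r) - (p : ℝ) ^ (2 * r) / (p : ℝ) ^ r -
        ((ArithmeticFunction.sigma 1 (2 * r) : ℝ) - 2 * r - 1) *
          ((p : ℝ) ^ (2 * r) / (p : ℝ) ^ (3 * (r : ℝ) / 2)) -
        (p : ℝ) ^ (2 * r) / (p : ℝ) ^ (2 * r - 1)) / (4 * r) := by ring
  rw [e, hdiv, hdiv2, div_lt_iff₀ (by positivity), excess_of_even hp hn heven hr.le hcard,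
    eps_of_even hp heven]
  have h1 := sum_evenTerm_ge (r := r) hp (by omega)
  have hr3' : (3 : ℝ) ≤ r := by exact_mod_cast hr3
  rcases parityGcd_cases hp with ⟨rfl, hc⟩ | ⟨h3, hc⟩
  · have h4 : (2 : ℝ) ^ 3 ≤ 2 ^ r := pow_le_pow_right₀ (by norm_num) hr3
    rw [hc]
    push_cast at *
    linarith
  · have h4 : (2 * r * p : ℝ) ≤ (p : ℝ) ^ r := by exact_mod_cast two_mul_mul_le_pow h3 hr3
    have h5 : (3 : ℝ) ≤ p := by exact_mod_cast h3
    rw [hc]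
    push_cast at *
    linarith

end EvenExponent
end LunardonPolverino

/-! ### Asymptotics -/

namespace LunardonPolverino
open Finset

variable {K : Type u} [Field K] {p r n : ℕ}

theorem abs_sum_odd_sub_le (hp : p.Prime) (hr : 0 < r) :
    |∑ j ∈ range r, ((p : ℝ) ^ Nat.gcd j r - 3 + Nat.gcd (p ^ j + 1) (p ^ r - 1)) - (p : ℝ) ^ r| ≤
      2 * r * (p : ℝ) ^ ((r : ℝ) / 2) := by
  have hp2 : (2 : ℝ) ≤ p := by exact_mod_cast hp.two_le
  have hc0 : (1 : ℝ) ≤ parityGcd p := by exact_mod_cast parityGcd_pos p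
  have hc : (parityGcd p : ℝ) ≤ 2 := by exact_mod_cast parityGcd_le_two p
  have hr1 : (1 : ℝ) ≤ r := by exact_mod_cast hr
  have hs : (1 : ℝ) ≤ (p : ℝ) ^ ((r : ℝ) / 2) := Real.one_le_rpow (by linarith) (by positivity)
  have hrs : (1 : ℝ) ≤ r * (p : ℝ) ^ ((r : ℝ) / 2) := one_le_mul_of_one_le_of_one_le hr1 hs
  have h0 : (0 : ℕ) ∈ range r := mem_range.2 hr
  rw [← Finset.add_sum_erase _ _ h0, odd_zero_term hp hr]
  have hlow : 0 ≤ ∑ j ∈ (range r).erase 0,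
      ((p : ℝ) ^ Nat.gcd j r - 3 + Nat.gcd (p ^ j + 1) (p ^ r - 1)) :=
    sum_nonneg fun j _ => le_trans (by linarith) (odd_term_ge hp hr j)
  have hup := Finset.sum_le_card_nsmul ((range r).erase 0)
    (fun j => (p : ℝ) ^ Nat.gcd j r - 3 + Nat.gcd (p ^ j + 1) (p ^ r - 1))
    (2 * (p : ℝ) ^ ((r : ℝ) / 2)) (fun j hj => by
      rw [mem_erase, mem_range] at hj
      have h1 := odd_term_le hp hr j
      have h2 : (p : ℝ) ^ Nat.gcd j r ≤ (p : ℝ) ^ ((r : ℝ) / 2) := by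
        refine natCast_pow_le_rpow hp.pos ?_
        have h3 := le_div_minFac_of_dvd (Nat.gcd_dvd_right j r)
          ((Nat.gcd_le_left r (by omega : 0 < j)).trans_lt hj.2)
        refine h3.trans (div_le_div_of_nonneg_left (by linarith) (by norm_num) ?_)
        exact_mod_cast (Nat.minFac_prime (by omega)).two_le
      linarith)
  rw [card_erase_of_mem h0, card_range, nsmul_eq_mul, Nat.cast_sub hr, Nat.cast_one] at hup
  rw [abs_le]
  constructor <;> linarith

theorem abs_sum_even_sub_le (hp : p.Prime) (hr : 0 < r) :
    |∑ j ∈ range (2 * r), evenTerm p r j - (p : ℝ) ^ (2 * r)| ≤ 4 * r * (p : ℝ) ^ r := by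
  have hp2 : (2 : ℝ) ≤ p := by exact_mod_cast hp.two_le
  have hr1 : (1 : ℝ) ≤ r := by exact_mod_cast hr
  have hs : (1 : ℝ) ≤ (p : ℝ) ^ r := one_le_pow₀ (by linarith)
  have hrs : (p : ℝ) ^ r ≤ r * (p : ℝ) ^ r := le_mul_of_one_le_left (by linarith) hr1
  have hlow := sum_evenTerm_ge_zero_term hp hr
  have h0 : (0 : ℕ) ∈ range (2 * r) := mem_range.2 (by omega)
  have hterm : ∀ j, evenTerm p r j ≤ (p : ℝ) ^ Nat.gcd j (2 * r) - 1 +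
      Nat.gcd (p ^ j + 1) (p ^ (2 * r) - 1) := by
    intro j
    have h1 : (0 : ℝ) ≤ Nat.gcd (p ^ j - 1) (p ^ r + 1) := Nat.cast_nonneg _
    have h2 : (0 : ℝ) ≤ Nat.gcd (p ^ j + 1) (p ^ r + 1) := Nat.cast_nonneg _
    rw [evenTerm]
    linarith
  have hzero : evenTerm p r 0 ≤ (p : ℝ) ^ (2 * r) + 1 := by
    have h1 := hterm 0
    have h2 : (Nat.gcd (p ^ 0 + 1) (p ^ (2 * r) - 1) : ℝ) ≤ 2 := by
      exact_mod_cast Nat.gcd_le_left _ two_pos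
    rw [Nat.gcd_zero_left] at h1
    linarith
  have hup := Finset.sum_le_card_nsmul ((range (2 * r)).erase 0) (evenTerm p r)
    (2 * (p : ℝ) ^ r) (fun j hj => by
      rw [mem_erase, mem_range] at hj
      have h1 := hterm j
      have h2 : (Nat.gcd (p ^ j + 1) (p ^ (2 * r) - 1) : ℝ) ≤ (p : ℝ) ^ Nat.gcd j (2 * r) + 1 := by
        exact_mod_cast gcd_le_pow_gcd_add_one (j := j) hp (by omega)
      have h3 : (p : ℝ) ^ Nat.gcd j (2 * r) ≤ (p : ℝ) ^ r := by
        refine pow_le_pow_right₀ (by linarith) ?_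
        have h4 := le_div_minFac_of_dvd (Nat.gcd_dvd_right j (2 * r))
          ((Nat.gcd_le_left (2 * r) (by omega : 0 < j)).trans_lt hj.2)
        rw [Nat.minFac_eq_two_iff (2 * r) |>.2 (dvd_mul_right 2 r)] at h4
        push_cast at h4
        rw [mul_div_cancel_left₀ _ (by norm_num)] at h4
        exact_mod_cast h4
      linarith)
  rw [card_erase_of_mem h0, card_range, nsmul_eq_mul, Nat.cast_sub (by omega), Nat.cast_one] at hup
  rw [← Finset.add_sum_erase _ _ h0] at hlow ⊢
  push_cast at hup
  rw [abs_le]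
  constructor <;> linarith

/-- From `1 + x ≤ exp x` and `log 2 > 1 / 2`; the constant does not depend on `p`. -/
theorem natCast_le_eight_mul_rpow (hp : 2 ≤ p) (r : ℕ) :
    (r : ℝ) ≤ 8 * (p : ℝ) ^ ((r : ℝ) / 4) := by
  have hp2 : (2 : ℝ) ≤ p := by exact_mod_cast hp
  have h1 := Real.add_one_le_exp (Real.log 2 * ((r : ℝ) / 4))
  rw [← Real.rpow_def_of_pos two_pos] at h1
  have h2 : (2 : ℝ) ^ ((r : ℝ) / 4) ≤ (p : ℝ) ^ ((r : ℝ) / 4) :=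
    Real.rpow_le_rpow two_pos.le hp2 (by positivity)
  have h3 : (1 / 2 : ℝ) * ((r : ℝ) / 4) ≤ Real.log 2 * ((r : ℝ) / 4) :=
    mul_le_mul_of_nonneg_right (by linarith [Real.log_two_gt_d9]) (by positivity)
  linarith

theorem exists_forall_four_mul_div_rpow_lt {η : ℝ} (hη : 0 < η) :
    ∃ Q : ℕ, ∀ p r : ℕ, p.Prime → Q ≤ p ^ r → 4 * (r : ℝ) / (p : ℝ) ^ ((r : ℝ) / 2) < η := by
  -- Because `r ≤ 8 q ^ (1 / 4)` with `q = p ^ r`, the quotient is at most `32 / q ^ (1 / 4)`. The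
  -- threshold thus depends on `q` only, whether `p` or `r` grows.
  obtain ⟨Q, hQ⟩ := exists_nat_gt ((32 / η) ^ 4)
  refine ⟨Q, fun p r hp h => ?_⟩
  have hp0 : (0 : ℝ) < p := by exact_mod_cast hp.pos
  set x := (p : ℝ) ^ ((r : ℝ) / 4) with hx
  have hx0 : 0 < x := by positivity
  have h1 : x * x = (p : ℝ) ^ ((r : ℝ) / 2) := by
    rw [← Real.rpow_add hp0]
    congr 1
    ring
  have h2 : x ^ 4 = (p : ℝ) ^ r := by
    rw [← Real.rpow_natCast, ← Real.rpow_natCast, ← Real.rpow_mul hp0.le]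
    congr 1
    push_cast
    ring
  have h3 : 32 / η < x := by
    refine lt_of_pow_lt_pow_left₀ 4 hx0.le (hQ.trans_le ?_)
    rw [h2]
    exact_mod_cast h
  rw [div_lt_iff₀ hη] at h3
  rw [← h1, div_lt_iff₀ (by positivity)]
  have h4 := natCast_le_eight_mul_rpow hp.two_le r
  rw [← hx] at h4
  have h5 := mul_lt_mul_of_pos_right h3 hx0
  linarith

theorem abs_numLP_div_sub_one_lt_of_odd (hn : 4 ≤ n) (hodd : Odd n) {η : ℝ} (hη : 0 < η) :
    ∃ Q : ℕ, ∀ p r : ℕ, p.Prime → 1 ≤ r → Q ≤ p ^ r → ∀ (K : Type u) [Field K],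
      Nat.card K = (p ^ r) ^ n →
        |(numLP K (p ^ r) n : ℝ) / ((p : ℝ) ^ r * (Nat.totient n : ℝ) / (4 * r)) - 1| < η := by
  obtain ⟨Q, hQ⟩ := exists_forall_four_mul_div_rpow_lt hη
  refine ⟨Q, fun p r hp hr hq K _ hcard => ?_⟩
  refine lt_of_le_of_lt ?_ (hQ p r hp hq)
  have hp0 : (0 : ℝ) < p := by exact_mod_cast hp.pos
  have hr0 : (0 : ℝ) < r := by exact_mod_cast hr
  have hφ : (0 : ℝ) < Nat.totient n := by exact_mod_cast Nat.totient_pos.2 (by omega)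
  have e : (numLP K (p ^ r) n : ℝ) / ((p : ℝ) ^ r * (Nat.totient n : ℝ) / (4 * r)) - 1 =
      ((numLP K (p ^ r) n : ℝ) / ((Nat.totient n : ℝ) / 2) * (2 * r) - (p : ℝ) ^ r) /
        (p : ℝ) ^ r := by
    field_simp
    ring
  have h1 := abs_sum_odd_sub_le hp hr
  have h2 : (p : ℝ) ^ r = (p : ℝ) ^ ((r : ℝ) / 2) * (p : ℝ) ^ ((r : ℝ) / 2) := by
    rw [← Real.rpow_add hp0, add_halves, Real.rpow_natCast]
  rw [e, numLP_of_odd hp hn hodd hr hcard, abs_div, abs_of_pos (by positivity : 0 < (p : ℝ) ^ r),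
    div_le_div_iff₀ (by positivity) (by positivity)]
  nth_rewrite 2 [h2]
  rw [← mul_assoc]
  refine mul_le_mul_of_nonneg_right (h1.trans ?_) (by positivity)
  exact mul_le_mul_of_nonneg_right (by linarith) (by positivity)

theorem abs_numLP_div_sub_one_lt_of_even (hn : 4 ≤ n) (heven : Even n) {η : ℝ} (hη : 0 < η) :
    ∃ Q : ℕ, ∀ p r : ℕ, p.Prime → 1 ≤ r → Q ≤ p ^ r → ∀ (K : Type u) [Field K],
      Nat.card K = (p ^ r) ^ n →
        |(numLP K (p ^ r) n : ℝ) / ((p : ℝ) ^ (2 * r) * (Nat.totient n : ℝ) / (8 * r)) - 1| < η := by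
  obtain ⟨Q, hQ⟩ := exists_forall_four_mul_div_rpow_lt hη
  refine ⟨Q, fun p r hp hr hq K _ hcard => ?_⟩
  refine lt_of_le_of_lt ?_ (hQ p r hp hq)
  have hp0 : (0 : ℝ) < p := by exact_mod_cast hp.pos
  have hp1 : (1 : ℝ) ≤ p := by exact_mod_cast hp.one_le
  have hr0 : (0 : ℝ) < r := by exact_mod_cast hr
  have hφ : (0 : ℝ) < Nat.totient n := by exact_mod_cast Nat.totient_pos.2 (by omega)
  have e : (numLP K (p ^ r) n : ℝ) / ((p : ℝ) ^ (2 * r) * (Nat.totient n : ℝ) / (8 * r)) - 1 =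
      ((numLP K (p ^ r) n : ℝ) / ((Nat.totient n : ℝ) / 2) * (4 * r) - (p : ℝ) ^ (2 * r)) /
        (p : ℝ) ^ (2 * r) := by
    field_simp
    ring
  have h1 := abs_sum_even_sub_le hp hr
  have h2 : (p : ℝ) ^ ((r : ℝ) / 2) ≤ (p : ℝ) ^ r := by
    rw [← Real.rpow_natCast]
    exact Real.rpow_le_rpow_of_exponent_le hp1 (by linarith)
  rw [e, numLP_of_even hp hn heven hr hcard, abs_div,
    abs_of_pos (by positivity : 0 < (p : ℝ) ^ (2 * r))]
  refine (div_le_div_of_nonneg_right h1 (by positivity)).trans ?_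
  rw [two_mul, pow_add, mul_div_mul_right _ _ (by positivity)]
  exact div_le_div_of_nonneg_left (by positivity) (by positivity) h2
end LunardonPolverino

theorem theorem4p3 :
    -- the bounds
    (∀ (n p r : ℕ), 4 ≤ n → p.Prime → 1 < r →
      ∀ (K : Type u) [Field K], Nat.card K = (p ^ r) ^ n →
      (Odd n →
        (¬ (Odd r ∧ r.Prime) →
          ((p : ℝ) ^ r - p) / (2 * r) < LunardonPolverino.excess K p r n) ∧
        (Odd r ∧ r.Prime →
          ((p : ℝ) ^ r - p) / (2 * r) = LunardonPolverino.excess K p r n) ∧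
        (Odd r →
          LunardonPolverino.excess K p r n <
            (p : ℝ) ^ r / (2 * r) *
              (1 + ((ArithmeticFunction.sigma 1 r : ℝ) - r - 1) /
                (p : ℝ) ^ ((r : ℝ) * (1 - 1 / (r.minFac : ℝ))))) ∧
        (∀ s₁ : ℕ, r = 2 ^ s₁ →
          LunardonPolverino.excess K p r n <
            (p : ℝ) ^ r / (2 * r) *
              (1 + ((ArithmeticFunction.sigma 1 r : ℝ) - r - 1) / (p : ℝ) ^ ((r : ℝ) / 2)) +
            ∑ i ∈ Finset.Icc 1 s₁, (p : ℝ) ^ (2 ^ (i - 1))) ∧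
        (Even r → 1 < r.primeFactors.card →
          LunardonPolverino.excess K p r n <
            (p : ℝ) ^ r / (2 * r) *
              (1 + ((ArithmeticFunction.sigma 1 r : ℝ) - r) / (p : ℝ) ^ ((r : ℝ) / 2) +
                ((ArithmeticFunction.sigma 1 r : ℝ) - r - 1) / (p : ℝ) ^ (3 * (r : ℝ) / 4)))) ∧
      (Even n →
        (Odd r →
          LunardonPolverino.excess K p r n <
            (p : ℝ) ^ (2 * r) / (4 * r) *
              (1 + ((ArithmeticFunction.sigma 1 (2 * r) : ℝ) - 2 * r - 1) / (p : ℝ) ^ r)) ∧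
        (∀ s₁ : ℕ, r = 2 ^ s₁ →
          LunardonPolverino.excess K p r n <
            (p : ℝ) ^ (2 * r) / (4 * r) *
              (1 + ((ArithmeticFunction.sigma 1 (2 * r) : ℝ) - 2 * r - 1) / (p : ℝ) ^ r) +
            ∑ i ∈ Finset.Icc 1 s₁, (p : ℝ) ^ (2 ^ (i - 1))) ∧
        (Even r → 1 < r.primeFactors.card →
          LunardonPolverino.excess K p r n <
            (p : ℝ) ^ (2 * r) / (4 * r) *
              (1 + ((ArithmeticFunction.sigma 1 (2 * r) : ℝ) - 2 * r - 1) / (p : ℝ) ^ r +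
                2 / (p : ℝ) ^ (3 * (r : ℝ) / 2) +
                2 * ((ArithmeticFunction.sigma 1 r : ℝ) - r - 1) / (p : ℝ) ^ (7 * (r : ℝ) / 4))) ∧
        (∀ s₁ : ℕ, r = 2 ^ s₁ →
          ((p : ℝ) ^ (2 * r) - p) / (4 * r) -
              ∑ i ∈ Finset.Icc 1 (s₁ + 1), (p : ℝ) ^ (2 ^ (i - 1)) <
            LunardonPolverino.excess K p r n) ∧
        ((¬ ∃ s₁ : ℕ, r = 2 ^ s₁) →
          (p : ℝ) ^ (2 * r) / (4 * r) *
              (1 - 1 / (p : ℝ) ^ r -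
                ((ArithmeticFunction.sigma 1 (2 * r) : ℝ) - 2 * r - 1) / (p : ℝ) ^ (3 * (r : ℝ) / 2) -
                1 / (p : ℝ) ^ (2 * r - 1)) <
            LunardonPolverino.excess K p r n))) ∧
    -- the asymptotics for odd `n`, as `q = p ^ r` tends to infinity over all prime powers
    (∀ n : ℕ, 4 ≤ n → Odd n → ∀ η : ℝ, 0 < η → ∃ Q : ℕ, ∀ p r : ℕ, p.Prime → 1 ≤ r →
      Q ≤ p ^ r → ∀ (K : Type u) [Field K], Nat.card K = (p ^ r) ^ n →
        |(LunardonPolverino.numLP K (p ^ r) n : ℝ) /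
          ((p : ℝ) ^ r * (Nat.totient n : ℝ) / (4 * r)) - 1| < η) ∧
    -- the asymptotics for even `n`
    (∀ n : ℕ, 4 ≤ n → Even n → ∀ η : ℝ, 0 < η → ∃ Q : ℕ, ∀ p r : ℕ, p.Prime → 1 ≤ r →
      Q ≤ p ^ r → ∀ (K : Type u) [Field K], Nat.card K = (p ^ r) ^ n →
        |(LunardonPolverino.numLP K (p ^ r) n : ℝ) /
          ((p : ℝ) ^ (2 * r) * (Nat.totient n : ℝ) / (8 * r)) - 1| < η) := by
  refine ⟨?_, fun n hn hodd η hη => LunardonPolverino.abs_numLP_div_sub_one_lt_of_odd hn hodd hη,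
    fun n hn heven η hη => LunardonPolverino.abs_numLP_div_sub_one_lt_of_even hn heven hη⟩
  intro n p r hn hp hr K _ hcard
  refine ⟨fun hodd => ⟨?_, ?_, ?_, ?_, ?_⟩, fun heven => ⟨?_, ?_, ?_, ?_, ?_⟩⟩
  · exact LunardonPolverino.lt_excess_of_odd hp hn hodd hr hcard
  · exact fun h => LunardonPolverino.eq_excess_of_odd_of_prime hp hn hodd hcard h.1 h.2
  · exact LunardonPolverino.excess_lt_of_odd_of_odd hp hn hodd hr hcard
  · exact fun s hs => LunardonPolverino.excess_lt_of_odd_of_two_pow hp hn hodd hr hcard hs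
  · exact LunardonPolverino.excess_lt_of_odd_of_even hp hn hodd hcard
  · exact LunardonPolverino.excess_lt_of_even_of_odd hp hn heven hr hcard
  · exact fun s hs => LunardonPolverino.excess_lt_of_even_of_two_pow hp hn heven hr hcard hs
  · exact LunardonPolverino.excess_lt_of_even_of_even hp hn heven hcard
  · exact fun s hs => LunardonPolverino.lt_excess_of_even_of_two_pow hp hn heven hr hcard hs
  · exact LunardonPolverino.lt_excess_of_even_of_not_two_pow hp hn heven hr hcard
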